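/- All graphs are finite and simple. A $C_s$-symmetric graph is a graph $G=(V,E)$ together with an automorphism $\sigma$ of $G$ with $\sigma^2=\mathrm{id}$; write $v'=\sigma(v)$. A vertex $v$ is fixed if $v'=v$, and an edge $xy$ is fixed if $\{x',y'\}=\{x,y\}$. $G$ is $(2,2)$-tight if $|E|=2|V|-2$ and $|E'|\le 2|V'|-2$ for every subgraph $(V',E')$ with $V'\neq\emptyset$; it is $(2,2)$-$C_s$-tight if it is $C_s$-symmetric, $(2,2)$-tight and has no fixed edge. Isomorphisms of $C_s$-symmetric graphs are graph isomorphisms that commute with the automorphisms $\sigma$. Base graphs (up to isomorphism of $C_s$-symmetric graphs): (1) $F_2$: the vertices $x_1,\dots,x_4$ induce a $K_4$, so do $x_1',\dots,x_4'$, and there are the two further edges $x_1x_2'$, $x_2x_1'$; no fixed vertex. (2) $W_5$: a fixed hub joined to all vertices of a 4-cycle, $\sigma$ exchanging opposite vertices of the 4-cycle. (3) $Wd(4,2)$: two copies of $K_4$ sharing exactly one vertex; this vertex is fixed and $\sigma$ exchanges the two copies. (4), (5) $F_1$: two disjoint edges $ab$, $a'b'$ exchanged by $\sigma$, and two further, non-adjacent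 vertices $s,t$, each joined to all of $a,b,a',b'$; in (4) $s'=t$, in (5) $s$ and $t$ are fixed. (6) $K_{3,4}$ with the three vertices of one part fixed and the four vertices of the other part exchanged in two pairs. Moves, applied to a $C_s$-symmetric graph $G$ and producing a $C_s$-symmetric graph: - Fixed-vertex 0-extension: add a fixed vertex $v$ with the edges $vx$, $vx'$, where $x'\neq x$. - Symmetrised 0-extension: add two vertices $v\neq v'$, with $v$ adjacent to $x,y$ and $v'$ adjacent to $x',y'$, where $x\ne y$. - Symmetrised 1-extension: delete an edge $xy$ that is not fixed, and the edge $x'y'$, and add two vertices $v\neq v'$, with $v$ adjacent to $x,y,z$ and $v'$ adjacent to $x',y',z'$, where $z\neq x,y$. - Symmetrised vertex-to-$K_4$ at a vertex $w\ne w'$: add six distinct vertices $a,b,c,a',b',c'$ and the edges making $\{w,a,b,c\}$ and $\{w',a',b',c'\}$ copies of $K_4$; for each neighbour $x$ of $w$ in $G$ choose $d_x\in\{w,a,b,c\}$ and replace the edges $wx$, $w'x'$ by $d_xx$, $d_x'x'$. - Symmetrised vertex-to-$C_4$ at a vertex $w$, in one of three forms. (i) $w\ne w'$: add $u\neq u'$;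 two distinct neighbours $v_1,v_2$ of $w$ become adjacent to both $w$ and $u$, every other neighbour of $w$ in $G$ becomes adjacent to exactly one of $w$ and $u$, and symmetrically for $w',u'$. (ii) $w=w'$: add one fixed vertex $u$; a neighbour $v_1\neq v_1'$ of $w$ and its image $v_1'$ become adjacent to both $w$ and $u$, and every other neighbour of $w$ becomes adjacent to exactly one of $w$ and $u$, symmetrically. (iii) $w=w'$: add $u\ne u'$; two distinct neighbours $v_1,v_2$ of $w$ become adjacent to both $w$ and $u$, their images $v_1',v_2'$ become adjacent to both $w$ and $u'$, and every other neighbour of $w$ becomes adjacent to exactly one of $w,u,u'$, symmetrically. - Vertex-to-$(2,2)$-$C_s$-tight at a fixed vertex $w$: replace $w$ by a $(2,2)$-$C_s$-tight graph $H$ (disjoint from $G$), and replace each edge $wx$ by an edge $y_xx$ with $y_x\in V(H)$, where $y_{x'}=(y_x)'$. Theorem. A $C_s$-symmetric graph with at least two vertices is $(2,2)$-$C_s$-tight if and only if it can be generated from copies of the six base graphs by a finite sequence of these moves. -/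

import Mathlib

universe u

/-- A `C_s`-symmetric graph on `V`: a simple graph with an action of the group of order two
by graph automorphisms, given by the automorphism `σ` (with `σ ∘ σ = id`) by which the
reflection acts. -/
structure CsGraph (V : Type u) where
  graph : SimpleGraph V
  σ : V → V
  invol : ∀ v, σ (σ v) = v
  adj_σ : ∀ v w, graph.Adj v w → graph.Adj (σ v) (σ w)

/-- `(2,2)`-tightness: every non-empty subgraph `(V', E')` has `|E'| ≤ 2|V'| - 2`, and
`|E| = 2|V| - 2`. -/
def IsTwoTwoTight {V : Type u} (G : SimpleGraph V) : Prop :=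
  (∀ H : G.Subgraph, H.verts.Nonempty → H.edgeSet.ncard + 2 ≤ 2 * H.verts.ncard) ∧
    G.edgeSet.ncard + 2 = 2 * Nat.card V

namespace CsGraph

variable {U V W : Type u}

/-- `(2,2)`-`C_s`-tightness: `(2,2)`-tight, and no edge is mapped to itself by `σ` (neither
with its ends exchanged nor with both ends fixed). -/
def IsTight (A : CsGraph V) : Prop :=
  IsTwoTwoTight A.graph ∧ ∀ e ∈ A.graph.edgeSet, Sym2.map A.σ e ≠ e

/-- Isomorphism of `C_s`-symmetric graphs: a graph isomorphism commuting with the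
reflections. -/
def Isomorphic {V : Type*} {W : Type*} (A : CsGraph V) (B : CsGraph W) : Prop :=
  ∃ f : A.graph ≃g B.graph, ∀ v, f (A.σ v) = B.σ (f v)

/-! ### The six base graphs -/

/-- `F₂` (two copies of `K₄` joined by two disjoint edges), no fixed vertex. -/
def baseF2 : CsGraph (Fin 8) where
  graph := SimpleGraph.fromRel fun i j => (i, j) ∈ ([(0, 1), (0, 2), (0, 3), (1, 2), (1, 3),
    (2, 3), (4, 5), (4, 6), (4, 7), (5, 6), (5, 7), (6, 7), (2, 5), (3, 4)] :
      List (Fin 8 × Fin 8))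
  σ := ![6, 7, 4, 5, 2, 3, 0, 1]
  invol := by decide
  adj_σ := by simp only [SimpleGraph.fromRel_adj]; decide

/-- The wheel `W₅` (hub `2`, rim `0, 1, 3, 4`), one fixed vertex. -/
def baseW5 : CsGraph (Fin 5) where
  graph := SimpleGraph.fromRel fun i j => (i, j) ∈ ([(0, 1), (1, 3), (3, 4), (4, 0), (2, 0),
    (2, 1), (2, 3), (2, 4)] : List (Fin 5 × Fin 5))
  σ := ![3, 4, 2, 0, 1]
  invol := by decide
  adj_σ := by simp only [SimpleGraph.fromRel_adj]; decide

/-- The windmill `Wd(4,2)` (two copies of `K₄` sharing the vertex `6`), one fixed vertex. -/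
def baseWd42 : CsGraph (Fin 7) where
  graph := SimpleGraph.fromRel fun i j => (i, j) ∈ ([(0, 1), (0, 2), (1, 2), (0, 6), (1, 6),
    (2, 6), (3, 4), (3, 5), (4, 5), (3, 6), (4, 6), (5, 6)] : List (Fin 7 × Fin 7))
  σ := ![5, 3, 4, 1, 2, 0, 6]
  invol := by decide
  adj_σ := by simp only [SimpleGraph.fromRel_adj]; decide

/-- `F₁` (two disjoint edges `12` and `34`, all of whose ends are joined to the two
non-adjacent vertices `0` and `5`), no fixed vertex. -/
def baseF1 : CsGraph (Fin 6) where
  graph := SimpleGraph.fromRel fun i j => (i, j) ∈ ([(0, 1), (0, 2), (0, 3), (0, 4), (1, 2),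
    (1, 5), (2, 5), (3, 4), (3, 5), (4, 5)] : List (Fin 6 × Fin 6))
  σ := ![5, 3, 4, 1, 2, 0]
  invol := by decide
  adj_σ := by simp only [SimpleGraph.fromRel_adj]; decide

/-- `F₁` (two disjoint edges `01` and `45`, all of whose ends are joined to the two
non-adjacent vertices `2` and `3`), two fixed vertices. -/
def baseF1' : CsGraph (Fin 6) where
  graph := SimpleGraph.fromRel fun i j => (i, j) ∈ ([(0, 1), (0, 2), (0, 3), (1, 2), (1, 3),
    (2, 4), (3, 5), (3, 4), (2, 5), (4, 5)] : List (Fin 6 × Fin 6))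
  σ := ![4, 5, 2, 3, 0, 1]
  invol := by decide
  adj_σ := by simp only [SimpleGraph.fromRel_adj]; decide

/-- `K_{3,4}` (parts `2, 3, 4` and `0, 1, 5, 6`), the part of size three fixed pointwise. -/
def baseK34 : CsGraph (Fin 7) where
  graph := SimpleGraph.fromRel fun i j => (i, j) ∈ ([(0, 2), (0, 3), (0, 4), (1, 2), (1, 3),
    (1, 4), (5, 2), (5, 3), (5, 4), (6, 2), (6, 3), (6, 4)] : List (Fin 7 × Fin 7))
  σ := ![5, 6, 2, 3, 4, 0, 1]
  invol := by decide
  adj_σ := by simp only [SimpleGraph.fromRel_adj]; decide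

/-- `A` is a copy of one of the six base graphs. -/
def IsBase (A : CsGraph V) : Prop :=
  A.Isomorphic baseF2 ∨ A.Isomorphic baseW5 ∨ A.Isomorphic baseWd42 ∨
    A.Isomorphic baseF1 ∨ A.Isomorphic baseF1' ∨ A.Isomorphic baseK34

/-! ### The moves

In each move `B` is the new graph. Its vertices are the old ones, embedded by `ι`, together
with some new ones; the edges of `B` are listed explicitly. -/

/-- `ι` embeds the vertices of `A` into those of `B`, compatibly with the reflections, and
`N` is the set of new vertices. -/
def IsVertexExtension (A : CsGraph V) (B : CsGraph W) (ι : V → W) (N : Set W) : Prop :=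
  Function.Injective ι ∧ (∀ v, ι (A.σ v) = B.σ (ι v)) ∧ (Set.range ι)ᶜ = N

/-- The edges of `A` incident with neither `w` nor its mirror image. -/
def edgesAvoiding (A : CsGraph V) (w : V) : Set (Sym2 V) :=
  {e | e ∈ A.graph.edgeSet ∧ w ∉ e ∧ A.σ w ∉ e}

/-- Fixed-vertex 0-extension: add a fixed vertex `v` adjacent to a vertex `x` and to its
mirror image `σ x ≠ x`. -/
def FixedZeroExtension (A : CsGraph V) (B : CsGraph W) : Prop :=
  ∃ (ι : V → W) (v : W) (x : V),
    B.σ v = v ∧ A.IsVertexExtension B ι {v} ∧ A.σ x ≠ x ∧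
    B.graph.edgeSet = Sym2.map ι '' A.graph.edgeSet ∪ {s(v, ι x), s(v, ι (A.σ x))}

/-- Symmetrised 0-extension: add a pair `v`, `σ v`, with `v` adjacent to `x`, `y` and `σ v`
adjacent to `σ x`, `σ y`. -/
def ZeroExtension (A : CsGraph V) (B : CsGraph W) : Prop :=
  ∃ (ι : V → W) (v : W) (x y : V),
    B.σ v ≠ v ∧ A.IsVertexExtension B ι {v, B.σ v} ∧ x ≠ y ∧
    B.graph.edgeSet = Sym2.map ι '' A.graph.edgeSet ∪
      {s(v, ι x), s(v, ι y), s(B.σ v, ι (A.σ x)), s(B.σ v, ι (A.σ y))}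

/-- Symmetrised 1-extension: delete an edge orbit `{xy, σxσy}` of size two and add a pair
`v`, `σ v`, with `v` adjacent to `x`, `y`, `z` and `σ v` adjacent to `σ x`, `σ y`, `σ z`. -/
def OneExtension (A : CsGraph V) (B : CsGraph W) : Prop :=
  ∃ (ι : V → W) (v : W) (x y z : V),
    B.σ v ≠ v ∧ A.IsVertexExtension B ι {v, B.σ v} ∧
    A.graph.Adj x y ∧ s(A.σ x, A.σ y) ≠ s(x, y) ∧ z ≠ x ∧ z ≠ y ∧
    B.graph.edgeSet =
      Sym2.map ι '' (A.graph.edgeSet \ {s(x, y), s(A.σ x, A.σ y)}) ∪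
        {s(v, ι x), s(v, ι y), s(v, ι z),
          s(B.σ v, ι (A.σ x)), s(B.σ v, ι (A.σ y)), s(B.σ v, ι (A.σ z))}

/-- Symmetrised vertex-to-`K₄`: for a vertex `w` that is not fixed, expand `w` to a copy of
`K₄` on `w, a, b, c` and `σ w` to the mirror image of it. Each neighbour `x` of `w` is
re-attached to one vertex `d x` of the first copy, and `σ x` to `σ (d x)`. -/
def VertexToK4 (A : CsGraph V) (B : CsGraph W) : Prop :=
  ∃ (ι : V → W) (w : V) (a b c : W) (d : V → W),
    A.σ w ≠ w ∧ [a, b, c, B.σ a, B.σ b, B.σ c].Nodup ∧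
    A.IsVertexExtension B ι {a, b, c, B.σ a, B.σ b, B.σ c} ∧
    (∀ x, A.graph.Adj w x → d x ∈ ({ι w, a, b, c} : Set W)) ∧
    B.graph.edgeSet = Sym2.map ι '' A.edgesAvoiding w ∪
      {e | ∃ x, A.graph.Adj w x ∧ (e = s(d x, ι x) ∨ e = s(B.σ (d x), ι (A.σ x)))} ∪
      {e | ∃ p ∈ ({ι w, a, b, c} : Set W), ∃ q ∈ ({ι w, a, b, c} : Set W),
        p ≠ q ∧ (e = s(p, q) ∨ e = s(B.σ p, B.σ q))}

/-- The edge set arising when `w` is split into `w` and a new vertex `u`, where `w` is joined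
to `P` and `u` to `Q`, and symmetrically for the mirror images. -/
def IsSplit (A : CsGraph V) (B : CsGraph W) (ι : V → W) (w : V) (u : W) (P Q : Set V) : Prop :=
  B.graph.edgeSet = Sym2.map ι '' A.edgesAvoiding w ∪
    {e | ∃ p ∈ P, e = s(ι w, ι p) ∨ e = s(ι (A.σ w), ι (A.σ p))} ∪
    {e | ∃ q ∈ Q, e = s(u, ι q) ∨ e = s(B.σ u, ι (A.σ q))}

/-- Symmetrised vertex-to-`C₄` at a pair `w`, `σ w` of distinct vertices: add a pair `u`, `σ u`;
two neighbours `v₁`, `v₂` of `w` become adjacent to both `w` and `u`, every other neighbour of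
`w` is adjacent to exactly one of `w` and `u`, and symmetrically for `σ w`, `σ u`. -/
def VertexToC4Pair (A : CsGraph V) (B : CsGraph W) : Prop :=
  ∃ (ι : V → W) (w : V) (u : W) (v₁ v₂ : V) (P Q : Set V),
    A.σ w ≠ w ∧ B.σ u ≠ u ∧ A.IsVertexExtension B ι {u, B.σ u} ∧
    v₁ ≠ v₂ ∧ P ∪ Q = A.graph.neighborSet w ∧ P ∩ Q = {v₁, v₂} ∧
    A.IsSplit B ι w u P Q

/-- Vertex-to-`C₄` at a fixed vertex `w` with a single new vertex `u`, which is fixed too: a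
neighbour `v₁` of `w` and its mirror image become adjacent to both `w` and `u`, every other
neighbour of `w` is adjacent to exactly one of `w` and `u`, symmetrically. -/
def VertexToC4Fixed (A : CsGraph V) (B : CsGraph W) : Prop :=
  ∃ (ι : V → W) (w : V) (u : W) (v₁ : V) (P Q : Set V),
    A.σ w = w ∧ B.σ u = u ∧ A.IsVertexExtension B ι {u} ∧
    A.σ v₁ ≠ v₁ ∧ P ∪ Q = A.graph.neighborSet w ∧ P ∩ Q = {v₁, A.σ v₁} ∧
    (∀ p ∈ P, A.σ p ∈ P) ∧ (∀ q ∈ Q, A.σ q ∈ Q) ∧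
    A.IsSplit B ι w u P Q

/-- Symmetrised vertex-to-`C₄` at a fixed vertex `w` with a pair `u`, `σ u` of new vertices:
two neighbours `v₁`, `v₂` of `w` become adjacent to both `w` and `u`, their mirror images become
adjacent to both `w` and `σ u`, and every other neighbour of `w` is adjacent to exactly one of
`w`, `u`, `σ u`, symmetrically. -/
def VertexToC4FixedPair (A : CsGraph V) (B : CsGraph W) : Prop :=
  ∃ (ι : V → W) (w : V) (u : W) (v₁ v₂ : V) (P Q : Set V),
    A.σ w = w ∧ B.σ u ≠ u ∧ A.IsVertexExtension B ι {u, B.σ u} ∧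
    v₁ ≠ v₂ ∧ P ∪ Q ∪ A.σ '' Q = A.graph.neighborSet w ∧ P ∩ Q = {v₁, v₂} ∧
    (∀ p ∈ P, A.σ p ∈ P) ∧ Q ∩ A.σ '' Q ⊆ P ∧
    A.IsSplit B ι w u P Q

/-- Vertex-to-`(2,2)`-`C_s`-tight: replace a fixed vertex `w` of `A` by a `(2,2)`-`C_s`-tight
graph `H`, replacing each edge `wx` by an edge from `x` to a vertex `y x` of `H`, symmetrically.
Only the values of `ι` away from `w` matter. -/
def VertexToTight (A : CsGraph V) (B : CsGraph W) : Prop :=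
  ∃ (U : Type u) (H : CsGraph U) (w : V) (κ : U → W) (ι : V → W) (y : V → U),
    H.IsTight ∧ A.σ w = w ∧
    H.IsVertexExtension B κ (ι '' {w}ᶜ) ∧
    Set.InjOn ι {w}ᶜ ∧ (∀ x, x ≠ w → ι (A.σ x) = B.σ (ι x)) ∧
    (∀ x, A.graph.Adj w x → y (A.σ x) = H.σ (y x)) ∧
    B.graph.edgeSet = Sym2.map κ '' H.graph.edgeSet ∪ Sym2.map ι '' A.edgesAvoiding w ∪
      {e | ∃ x, A.graph.Adj w x ∧ e = s(κ (y x), ι x)}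

/-- `B` arises from `A` by one of the moves. -/
def Move (A : CsGraph V) (B : CsGraph W) : Prop :=
  A.FixedZeroExtension B ∨ A.ZeroExtension B ∨ A.OneExtension B ∨ A.VertexToK4 B ∨
    A.VertexToC4Pair B ∨ A.VertexToC4Fixed B ∨ A.VertexToC4FixedPair B ∨ A.VertexToTight B

/-- The graphs that can be generated from the base graphs by a finite sequence of moves. -/
inductive Generated : {V : Type u} → CsGraph V → Prop
  | base {V : Type u} (A : CsGraph V) : A.IsBase → Generated A
  | step {V W : Type u} (A : CsGraph V) (B : CsGraph W) :
      Generated A → A.Move B → Generated B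

end CsGraph

-- Write i(X) for the number of edges inside a non-empty vertex set X, and call 2|X| − 2 − i(X) the
-- deficiency of X. Sparsity says that deficiencies are non-negative, and X is tight if its
-- deficiency is 0. Since i is supermodular, tight sets that meet have tight union and intersection.
-- The absence of fixed edges enters mainly through parity: the edges inside an invariant set come
-- in mirror pairs, so its deficiency is even, and a fixed vertex has even degree.
--
-- Moves preserve tightness. Each move changes |E| by exactly twice the change of |V|
-- (`Preserves.count`), so only sparsity and the absence of fixed edges have to be followed. For
-- sparsity, the symmetrised 0- and 1-extensions and the splits with a pair of new vertices are two
-- unsymmetric operations in succession (`IsSparse.zeroExtension`, `IsSparse.oneExtension`,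
-- `IsSparse.split`), and the two substitution moves are handled by counting inside and between
-- fibres (`IsSparse.of_fibers`). The same edge count, read backwards, makes a smaller graph tight
-- as soon as it is sparse without fixed edges.
--
-- For the converse, argue by induction on |V|. A vertex of degree two is removed by an inverse
-- 0-extension. If there is a proper invariant tight set with at least two vertices, a largest one
-- receives at most one edge from each outside vertex and can be contracted. What remains is an
-- `Irreducible` graph: minimum degree at least three, and no invariant tight set with at least two
-- vertices except the whole vertex set. There, parity gives more: a set of deficiency at most 1
-- that contains two vertices together with their mirror images covers everything up to reflection
-- (`Irreducible.mem_or_mem`). Hence, after deleting v and σ v, adding a mirror pair of edges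
-- destroys sparsity only if some tight set avoiding v and σ v contains both ends of one of them
-- (`exchange_sparse`).
--
-- An irreducible graph has a vertex v of degree three, not fixed by parity. If no reduction exists,
-- each pair of its neighbours is adjacent, or is a pair whose edge would be fixed, or is blocked by
-- a tight set (`Irreducible.pair_cases`). Two pairs cannot both be blocked, and the mixed
-- combinations that arise are impossible as well. So either at least two edges run between the
-- neighbours, or two pairs are fixed pairs, which forces all three neighbours to be fixed. In each
-- of these situations one finds a base graph, whose vertex set is invariant and tight and therefore
-- everything, or else an inverse vertex-to-`K₄` or vertex-to-`C₄` move.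

universe v

open Set

/-! ### Edges inside a vertex set and `(2,2)`-sparsity of edge sets -/

section EdgeSets

variable {V : Type*} {W : Type*}

/-- The elements of the edge set `E` with both ends in `X`. -/
def edgesWithin (E : Set (Sym2 V)) (X : Set V) : Set (Sym2 V) :=
  {e | e ∈ E ∧ ∀ v ∈ e, v ∈ X}

@[simp] theorem mk_mem_edgesWithin {E : Set (Sym2 V)} {X : Set V} {a b : V} :
    s(a, b) ∈ edgesWithin E X ↔ s(a, b) ∈ E ∧ a ∈ X ∧ b ∈ X := by
  simp [edgesWithin]

theorem edgesWithin_mono {E F : Set (Sym2 V)} {X Y : Set V} (h : E ⊆ F) (h' : X ⊆ Y) :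
    edgesWithin E X ⊆ edgesWithin F Y :=
  fun _ he => ⟨h he.1, fun v hv => h' (he.2 v hv)⟩

@[simp] theorem edgesWithin_univ (E : Set (Sym2 V)) : edgesWithin E univ = E := by
  ext e; simp [edgesWithin]

theorem edgesWithin_inter (E : Set (Sym2 V)) (X Y : Set V) :
    edgesWithin E (X ∩ Y) = edgesWithin E X ∩ edgesWithin E Y := by
  ext e
  induction e using Sym2.ind with | _ a b => ?_
  simp only [mk_mem_edgesWithin, mem_inter_iff]; tauto

/-- `(2,2)`-sparsity of an edge set. -/
def IsSparse (E : Set (Sym2 V)) : Prop :=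
  ∀ X : Set V, X.Nonempty → (edgesWithin E X).ncard + 2 ≤ 2 * X.ncard

theorem IsSparse.mono [Finite V] {E F : Set (Sym2 V)} (hF : IsSparse F) (h : E ⊆ F) :
    IsSparse E := fun X hX =>
  (Nat.add_le_add_right (ncard_le_ncard (edgesWithin_mono h subset_rfl)) 2).trans (hF X hX)

/-- Supermodularity: an edge inside X or inside Y lies inside the union, and an edge inside both
lies inside the intersection. What the inequality loses are the edges between X \ Y and Y \ X. -/
theorem ncard_edgesWithin_add_le [Finite V] (E : Set (Sym2 V)) (X Y : Set V) :
    (edgesWithin E X).ncard + (edgesWithin E Y).ncard ≤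
      (edgesWithin E (X ∪ Y)).ncard + (edgesWithin E (X ∩ Y)).ncard := by
  rw [← ncard_union_add_ncard_inter, ← edgesWithin_inter]
  gcongr
  · exact toFinite _
  · exact union_subset (edgesWithin_mono subset_rfl subset_union_left)
      (edgesWithin_mono subset_rfl subset_union_right)

/-- An edge between `X \ Y` and `Y \ X` makes the supermodular inequality strict. -/
theorem ncard_edgesWithin_add_lt [Finite V] {E : Set (Sym2 V)} {X Y : Set V} {a b : V}
    (hab : s(a, b) ∈ E) (ha : a ∈ X) (ha' : a ∉ Y) (hb : b ∈ Y) (hb' : b ∉ X) :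
    (edgesWithin E X).ncard + (edgesWithin E Y).ncard <
      (edgesWithin E (X ∪ Y)).ncard + (edgesWithin E (X ∩ Y)).ncard := by
  rw [← ncard_union_add_ncard_inter, ← edgesWithin_inter]
  gcongr
  refine ncard_lt_ncard ⟨union_subset (edgesWithin_mono subset_rfl subset_union_left)
      (edgesWithin_mono subset_rfl subset_union_right), fun h => ?_⟩
  have : s(a, b) ∈ edgesWithin E X ∪ edgesWithin E Y := h (by simp [*])
  simp [*] at this

theorem ncard_edgesWithin_insert [Finite V] {E : Set (Sym2 V)} {X : Set V} {v : V} (hv : v ∉ X)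
    (hl : s(v, v) ∉ E) : (edgesWithin E (insert v X)).ncard =
      (edgesWithin E X).ncard + {x | x ∈ X ∧ s(v, x) ∈ E}.ncard := by
  have hinj : InjOn (fun x => s(v, x)) {x | x ∈ X ∧ s(v, x) ∈ E} := by
    intro x _ y _ h
    rcases Sym2.eq_iff.1 h with h | h
    exacts [h.2, h.2.trans h.1]
  rw [← hinj.ncard_image, ← ncard_union_eq]
  · congr 1
    ext e
    induction e using Sym2.ind with | _ a b => ?_
    simp only [mk_mem_edgesWithin, mem_insert_iff, mem_union, mem_image, mem_ofPred_eq, Sym2.eq_iff]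
    constructor
    · rintro ⟨h, rfl | ha, rfl | hb⟩
      · exact (hl h).elim
      · exact Or.inr ⟨b, ⟨hb, h⟩, by simp⟩
      · exact Or.inr ⟨a, ⟨ha, by rwa [Sym2.eq_swap]⟩, by simp⟩
      · exact Or.inl ⟨h, ha, hb⟩
    · rintro (h | ⟨x, ⟨hx, h⟩, ⟨rfl, rfl⟩ | ⟨rfl, rfl⟩⟩)
      · tauto
      · exact ⟨h, by simp [hx]⟩
      · exact ⟨by rwa [Sym2.eq_swap], by simp [hx]⟩
  · rw [Set.disjoint_left]
    rintro e he ⟨x, -, rfl⟩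
    simp at he
    exact hv he.2.1

theorem edgesWithin_image {E : Set (Sym2 V)} {f : V → W} (hf : Function.Injective f)
    (X : Set V) : edgesWithin (Sym2.map f '' E) (f '' X) = Sym2.map f '' edgesWithin E X := by
  ext e
  constructor
  · rintro ⟨⟨e, he, rfl⟩, h⟩
    refine ⟨e, ⟨he, fun v hv => ?_⟩, rfl⟩
    obtain ⟨w, hw, hwv⟩ := h (f v) (Sym2.mem_map.2 ⟨v, hv, rfl⟩)
    exact hf hwv ▸ hw
  · rintro ⟨e, ⟨he, h⟩, rfl⟩
    refine ⟨⟨e, he, rfl⟩, fun w hw => ?_⟩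
    obtain ⟨v, hv, rfl⟩ := Sym2.mem_map.1 hw
    exact ⟨v, h v hv, rfl⟩

theorem IsSparse.image [Finite W] {E : Set (Sym2 V)} {f : V → W} (hE : IsSparse E)
    (hf : Function.Injective f) : IsSparse (Sym2.map f '' E) := by
  intro X hX
  have hfin : Finite V := Finite.of_injective f hf
  have h1 : edgesWithin (Sym2.map f '' E) X = Sym2.map f '' edgesWithin E (f ⁻¹' X) := by
    rw [← edgesWithin_image hf]
    ext e
    constructor
    · rintro ⟨⟨e, he, rfl⟩, h⟩
      refine ⟨⟨e, he, rfl⟩, fun w hw => ?_⟩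
      obtain ⟨v, hv, rfl⟩ := Sym2.mem_map.1 hw
      exact ⟨v, h _ hw, rfl⟩
    · exact fun h => edgesWithin_mono subset_rfl (image_preimage_subset f X) h
  rw [h1, ncard_image_of_injective _ (Sym2.map.injective hf)]
  rcases (f ⁻¹' X).eq_empty_or_nonempty with h | h
  · have : edgesWithin E ∅ = ∅ := by
      ext e
      induction e using Sym2.ind with | _ a b => simp
    rw [h, this]
    have := (ncard_pos).2 hX
    simp; omega
  · have h2 := hE _ h
    have h3 : (f ⁻¹' X).ncard ≤ X.ncard := by
      rw [← ncard_image_of_injective _ hf]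
      exact ncard_le_ncard (image_preimage_subset f X)
    omega

theorem IsSparse.of_image [Finite W] {E : Set (Sym2 V)} {f : V → W}
    (hE : IsSparse (Sym2.map f '' E)) (hf : Function.Injective f) : IsSparse E := by
  intro X hX
  have := hE (f '' X) (hX.image f)
  rwa [edgesWithin_image hf, ncard_image_of_injective _ (Sym2.map.injective hf),
    ncard_image_of_injective _ hf] at this

/-- In a sparse edge set, tight sets are closed under union and intersection if they meet. -/
theorem IsSparse.union_inter_tight [Finite V] {E : Set (Sym2 V)} (hE : IsSparse E) {X Y : Set V}
    (hX : (edgesWithin E X).ncard + 2 = 2 * X.ncard)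
    (hY : (edgesWithin E Y).ncard + 2 = 2 * Y.ncard) (h : (X ∩ Y).Nonempty) :
    (edgesWithin E (X ∪ Y)).ncard + 2 = 2 * (X ∪ Y).ncard ∧
      (edgesWithin E (X ∩ Y)).ncard + 2 = 2 * (X ∩ Y).ncard := by
  have h1 := ncard_edgesWithin_add_le E X Y
  have h2 := ncard_union_add_ncard_inter X Y
  have h3 := hE _ h
  have h4 := hE (X ∪ Y) (h.mono (inter_subset_left.trans subset_union_left))
  omega

/-- In `ZMod 2` the cardinality is a sum of ones, and the terms of an element and its image cancel.
-/
theorem even_ncard_of_involution {s : Set V} (hs : s.Finite) (g : V → V)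
    (hg : ∀ x ∈ s, g x ∈ s) (hi : ∀ x ∈ s, g (g x) = x) (hn : ∀ x ∈ s, g x ≠ x) :
    Even s.ncard := by
  classical
  rw [ncard_eq_toFinset_card s hs, ← ZMod.natCast_eq_zero_iff_even, Finset.cast_card]
  refine Finset.sum_involution (fun a _ => g a) ?_ ?_ ?_ ?_
  · intros; decide
  · intro a ha _; exact hn a (by simpa using ha)
  · intro a ha; simpa using hg a (by simpa using ha)
  · intro a ha; exact hi a (by simpa using ha)

end EdgeSets

/-- Among the subgraphs on a given vertex set the induced one has the most edges, so only induced
subgraphs have to be tested. -/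
theorem isTwoTwoTight_iff {V : Type*} [Finite V] (G : SimpleGraph V) :
    IsTwoTwoTight G ↔ IsSparse G.edgeSet ∧ G.edgeSet.ncard + 2 = 2 * Nat.card V := by
  refine and_congr_left fun _ => ⟨fun h X hX => ?_, fun h H hH => ?_⟩
  · have := h ((⊤ : G.Subgraph).induce X) hX
    have h' : edgesWithin G.edgeSet X = ((⊤ : G.Subgraph).induce X).edgeSet := by
      ext e
      induction e using Sym2.ind with | _ a b => ?_
      simp
      tauto
    rwa [h']
  · refine (Nat.add_le_add_right (ncard_le_ncard fun e he => ?_) 2).trans (h _ hH)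
    exact ⟨H.edgeSet_subset he, fun v hv => H.mem_verts_of_mem_edge he hv⟩

/-- The edge count makes `2 * Nat.card V` at least 2, whereas `Nat.card` of an infinite type is 0.
-/
theorem IsTwoTwoTight.finite {V : Type*} {G : SimpleGraph V} (h : IsTwoTwoTight G) :
    Finite V := by
  have := h.2
  exact Nat.finite_of_card_ne_zero (by omega)

/-! ### Operations on edge sets that preserve sparsity -/

section Operations

variable {V : Type*} {W : Type*} [Finite W]

/-- One vertex pays for two edges, except in the set {v}, which contains no edge. Working inside W
and discarding the old edges at v allows the operation to be applied twice in a row, at v and at its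
mirror image. -/
theorem IsSparse.zeroExtension {E : Set (Sym2 W)} (hE : IsSparse E) {v x y : W}
    (hx : x ≠ v) (hy : y ≠ v) :
    IsSparse ({e | e ∈ E ∧ v ∉ e} ∪ {s(v, x), s(v, y)}) := by
  intro X hX
  by_cases hv : v ∈ X
  · by_cases hX' : (X \ {v}).Nonempty
    · have h1 : edgesWithin ({e | e ∈ E ∧ v ∉ e} ∪ {s(v, x), s(v, y)}) X ⊆
          edgesWithin E (X \ {v}) ∪ {s(v, x), s(v, y)} := by
        rintro e ⟨⟨he, hve⟩ | he, h⟩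
        · exact Or.inl ⟨he, fun a ha => ⟨h a ha, fun h => hve (h ▸ ha)⟩⟩
        · exact Or.inr he
      have h2 := (ncard_le_ncard h1).trans (ncard_union_le _ _)
      have h3 := ncard_insert_le s(v, x) {s(v, y)}
      have h4 := hE _ hX'
      have h5 := ncard_sdiff_singleton_add_one hv
      rw [ncard_singleton] at h3
      omega
    · obtain rfl : X = {v} := by
        apply subset_antisymm _ (by simpa using hv)
        simpa [sdiff_nonempty] using hX'
      have h1 : edgesWithin ({e | e ∈ E ∧ v ∉ e} ∪ {s(v, x), s(v, y)}) {v} = ∅ := by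
        rw [eq_empty_iff_forall_notMem]
        rintro e ⟨⟨he, hve⟩ | rfl | rfl, h⟩
        · induction e using Sym2.ind with | _ a b => ?_
          simp at h hve; grind
        · simp at h; exact hx h
        · simp at h; exact hy h
      rw [h1]; simp
  · refine (Nat.add_le_add_right (ncard_le_ncard ?_) 2).trans (hE X hX)
    rintro e ⟨⟨he, hve⟩ | rfl | rfl, h⟩
    · exact ⟨he, h⟩
    · simp at h; exact (hv h.1).elim
    · simp at h; exact (hv h.1).elim

/-- A set containing v, x and y may gain three edges, but it has lost xy. A set missing x or y gains
at most two, as in a 0-extension along the remaining two vertices. -/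
theorem IsSparse.oneExtension {E : Set (Sym2 W)} (hE : IsSparse E) {v x y z : W}
    (hx : x ≠ v) (hy : y ≠ v) (hz : z ≠ v) (hxy : s(x, y) ∈ E) :
    IsSparse ({e | e ∈ E ∧ v ∉ e ∧ e ≠ s(x, y)} ∪ {s(v, x), s(v, y), s(v, z)}) := by
  intro X hX
  by_cases hv : v ∈ X
  swap
  · refine (Nat.add_le_add_right (ncard_le_ncard ?_) 2).trans (hE X hX)
    rintro e ⟨⟨he, hve, -⟩ | rfl | rfl | rfl, h⟩
    · exact ⟨he, h⟩
    all_goals simp at h; exact (hv h.1).elim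
  by_cases hxX : x ∈ X
  swap
  · refine (Nat.add_le_add_right (ncard_le_ncard ?_) 2).trans (hE.zeroExtension hy hz X hX)
    rintro e ⟨⟨he, hve, -⟩ | rfl | rfl | rfl, h⟩
    · exact ⟨Or.inl ⟨he, hve⟩, h⟩
    · simp at h; exact (hxX h.2).elim
    all_goals exact ⟨by simp, h⟩
  by_cases hyX : y ∈ X
  swap
  · refine (Nat.add_le_add_right (ncard_le_ncard ?_) 2).trans (hE.zeroExtension hx hz X hX)
    rintro e ⟨⟨he, hve, -⟩ | rfl | rfl | rfl, h⟩
    · exact ⟨Or.inl ⟨he, hve⟩, h⟩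
    · exact ⟨by simp, h⟩
    · simp at h; exact (hyX h.2).elim
    · exact ⟨by simp, h⟩
  have h1 : edgesWithin ({e | e ∈ E ∧ v ∉ e ∧ e ≠ s(x, y)} ∪ {s(v, x), s(v, y), s(v, z)}) X ⊆
      (edgesWithin E (X \ {v}) \ {s(x, y)}) ∪ {s(v, x), s(v, y), s(v, z)} := by
    rintro e ⟨⟨he, hve, hne⟩ | he, h⟩
    · exact Or.inl ⟨⟨he, fun a ha => ⟨h a ha, fun h => hve (h ▸ ha)⟩⟩, hne⟩
    · exact Or.inr he
  have h2 := (ncard_le_ncard h1).trans (ncard_union_le _ _)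
  have h3 := ncard_insert_le s(v, x) {s(v, y), s(v, z)}
  have h3' := ncard_insert_le s(v, y) {s(v, z)}
  have h4 := hE (X \ {v}) ⟨x, hxX, hx⟩
  have h5 := ncard_sdiff_singleton_add_one hv
  have h6 : s(x, y) ∈ edgesWithin E (X \ {v}) := by simp [*]
  have h7 := ncard_sdiff_singleton_add_one h6
  rw [ncard_singleton] at h3'
  omega

/-- Splitting a vertex `u` off `w` so that at most two neighbours are shared. -/
theorem IsSparse.split {E E' : Set (Sym2 W)} (hE : IsSparse E) {u w v₁ v₂ : W}
    (h₁ : ∀ e ∈ E', u ∉ e → e ∈ E) (h₂ : ∀ q, s(u, q) ∈ E' → s(w, q) ∈ E)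
    (h₃ : ∀ q, s(u, q) ∈ E' → s(w, q) ∈ E' → q = v₁ ∨ q = v₂) (hl : s(u, u) ∉ E') :
    IsSparse E' := by
  intro X hX
  by_cases hu : u ∈ X
  swap
  · refine (Nat.add_le_add_right (ncard_le_ncard ?_) 2).trans (hE X hX)
    exact fun e he => ⟨h₁ e he.1 fun h => hu (he.2 u h), he.2⟩
  have h5 := ncard_sdiff_singleton_add_one hu
  -- Replace u by w in X: edges at u become edges at w, and the only ones lost are those that
  -- coincide with an edge already present, whose other ends lie in D.
  have key : ∀ D : Set W, (∀ q, s(u, q) ∈ E' → q ∈ X → w ∈ X → s(w, q) ∈ E' → q ∈ D) →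
      (edgesWithin E' X).ncard ≤ (edgesWithin E (insert w (X \ {u}))).ncard + D.ncard := by
    intro D hD
    have h0 : u ∉ X \ {u} := by simp
    have h1 := ncard_edgesWithin_insert h0 hl
    rw [insert_sdiff_singleton, insert_eq_of_mem hu] at h1
    have h2 : {x | x ∈ X \ {u} ∧ s(u, x) ∈ E'} ⊆
        {x | (x ∈ X \ {u} ∧ s(u, x) ∈ E') ∧ x ∉ D} ∪ D := by
      intro x hx; by_cases h : x ∈ D
      exacts [Or.inr h, Or.inl ⟨hx, h⟩]
    have h3 := (ncard_le_ncard h2).trans (ncard_union_le _ _)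
    have hinj : InjOn (fun x => s(w, x)) {x | (x ∈ X \ {u} ∧ s(u, x) ∈ E') ∧ x ∉ D} := by
      intro x _ y _ h
      rcases Sym2.eq_iff.1 h with h | h
      exacts [h.2, h.2.trans h.1]
    rw [← hinj.ncard_image] at h3
    have h4 : edgesWithin E' (X \ {u}) ∪
        (fun x => s(w, x)) '' {x | (x ∈ X \ {u} ∧ s(u, x) ∈ E') ∧ x ∉ D} ⊆
        edgesWithin E (insert w (X \ {u})) := by
      rintro e (he | ⟨x, ⟨⟨hx, hx'⟩, -⟩, rfl⟩)
      · exact ⟨h₁ e he.1 fun h => (he.2 u h).2 rfl, fun v hv => Or.inr (he.2 v hv)⟩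
      · exact mk_mem_edgesWithin.2 ⟨h₂ x hx', by simp, Or.inr hx⟩
    have h6 := ncard_le_ncard h4
    rw [ncard_union_eq] at h6
    · omega
    · rw [Set.disjoint_left]
      rintro e he ⟨x, ⟨⟨hx, hx'⟩, hxD⟩, rfl⟩
      rw [mk_mem_edgesWithin] at he
      exact hxD (hD x hx' hx.1 he.2.1.1 he.1)
  by_cases hw : w ∈ X
  -- The hypotheses allow u = w, when E' is contained in E.
  · by_cases huw : u = w
    · subst huw
      have h7 : edgesWithin E' X ⊆ edgesWithin E X := by
        rintro e he
        refine ⟨?_, he.2⟩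
        by_cases h : u ∈ e
        · obtain ⟨b, rfl⟩ := Sym2.mem_iff_exists.1 h
          exact h₂ b he.1
        · exact h₁ e he.1 h
      exact (Nat.add_le_add_right (ncard_le_ncard h7) 2).trans (hE X hX)
    -- With u and w both in X, the disappearance of u pays for the two edges lost.
    have h6 := key {v₁, v₂} fun q hq _ _ hq' => h₃ q hq hq'
    have hw' : w ∈ X \ {u} := ⟨hw, fun h => huw h.symm⟩
    rw [insert_eq_of_mem hw'] at h6
    have h7 := hE _ ⟨w, hw'⟩
    have h8 := ncard_insert_le v₁ {v₂}
    rw [ncard_singleton] at h8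
    omega
  -- With w outside X nothing is lost, and exchanging u for w does not enlarge the set.
  · have h6 := key ∅ fun q _ _ h => (hw h).elim
    have h7 := hE (insert w (X \ {u})) (insert_nonempty _ _)
    have h8 := ncard_insert_le w (X \ {u})
    rw [ncard_empty] at h6
    omega

/-- If the edges inside the fibres of `π` are sparse and the remaining edges are mapped injectively
into a sparse edge set, then the edge set is sparse. -/
theorem IsSparse.of_fibers [Finite V] {E : Set (Sym2 V)} {E' : Set (Sym2 W)} (hE : IsSparse E)
    (π : W → V)
    (hfib : ∀ c : V, ∀ X ⊆ π ⁻¹' {c}, X.Nonempty → (edgesWithin E' X).ncard + 2 ≤ 2 * X.ncard)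
    (hmap : ∀ a b, s(a, b) ∈ E' → π a ≠ π b → s(π a, π b) ∈ E)
    (hinj : ∀ a b c d, s(a, b) ∈ E' → s(c, d) ∈ E' → π a ≠ π b → π a = π c → π b = π d →
      a = c ∧ b = d) : IsSparse E' := by
  classical
  intro X hX
  have : Fintype V := Fintype.ofFinite V
  have : Fintype W := Fintype.ofFinite W
  have hsplit : edgesWithin E' X ⊆ {e | e ∈ edgesWithin E' X ∧ ¬ (Sym2.map π e).IsDiag} ∪
      ⋃ c ∈ (π '' X).toFinset, edgesWithin E' (X ∩ π ⁻¹' {c}) := by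
    intro e he
    induction e using Sym2.ind with | _ a b => ?_
    by_cases hab : π a = π b
    · right
      rw [mk_mem_edgesWithin] at he
      simp only [mem_iUnion]
      exact ⟨π a, by simpa using ⟨a, he.2.1, rfl⟩, by simp [he, hab]⟩
    · exact Or.inl ⟨he, by simpa using hab⟩
  have h1 := (ncard_le_ncard hsplit).trans (ncard_union_le _ _)
  have h2 : {e | e ∈ edgesWithin E' X ∧ ¬ (Sym2.map π e).IsDiag}.ncard ≤
      (edgesWithin E (π '' X)).ncard := by
    refine ncard_le_ncard_of_injOn (Sym2.map π) ?_ ?_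
    · rintro e ⟨he, hd⟩
      induction e using Sym2.ind with | _ a b => ?_
      rw [mk_mem_edgesWithin] at he
      rw [Sym2.map_mk, mk_mem_edgesWithin]
      exact ⟨hmap a b he.1 (by simpa using hd), ⟨a, he.2.1, rfl⟩, ⟨b, he.2.2, rfl⟩⟩
    · rintro e ⟨he, hd⟩ e' ⟨he', hd'⟩ h
      induction e using Sym2.ind with | _ a b => ?_
      induction e' using Sym2.ind with | _ c d => ?_
      simp only [Sym2.map_mk, Sym2.mk_isDiag_iff] at h hd hd'
      rcases Sym2.eq_iff.1 h with ⟨h, h'⟩ | ⟨h, h'⟩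
      · obtain ⟨rfl, rfl⟩ := hinj a b c d he.1 he'.1 hd h h'
        rfl
      · obtain ⟨rfl, rfl⟩ := hinj a b d c he.1 (by rw [Sym2.eq_swap]; exact he'.1) hd h h'
        exact Sym2.eq_swap
  have h3 : (⋃ c ∈ (π '' X).toFinset, edgesWithin E' (X ∩ π ⁻¹' {c})).ncard ≤
      ∑ c ∈ (π '' X).toFinset, (edgesWithin E' (X ∩ π ⁻¹' {c})).ncard :=
    Finset.set_ncard_biUnion_le _ _
  have h4 : ∑ c ∈ (π '' X).toFinset, ((edgesWithin E' (X ∩ π ⁻¹' {c})).ncard + 2) ≤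
      ∑ c ∈ (π '' X).toFinset, 2 * (X ∩ π ⁻¹' {c}).ncard := by
    refine Finset.sum_le_sum fun c hc => hfib c _ inter_subset_right ?_
    obtain ⟨x, hx, rfl⟩ := by simpa using hc
    exact ⟨x, hx, rfl⟩
  have h5 : X.ncard = ∑ c ∈ (π '' X).toFinset, (X ∩ π ⁻¹' {c}).ncard := by
    rw [ncard_eq_toFinset_card', Finset.card_eq_sum_card_fiberwise (f := π)
      (t := (π '' X).toFinset)]
    · refine Finset.sum_congr rfl fun c _ => ?_
      rw [ncard_eq_toFinset_card']
      congr 1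
      ext x; simp
    · intro x hx
      simp at hx ⊢
      exact ⟨x, hx, rfl⟩
  -- The edges inside fibres number at most 2|X| − 2|π X| and the others at most 2|π X| − 2, which
  -- adds up to 2|X| − 2.
  rw [Finset.sum_add_distrib, ← Finset.mul_sum, ← h5, Finset.sum_const, smul_eq_mul,
    ← ncard_eq_toFinset_card'] at h4
  have h6 := hE (π '' X) (hX.image π)
  omega

end Operations

/-! ### The extension moves preserve tightness -/

namespace CsGraph

variable {U V W : Type u}

theorem σ_injective (A : CsGraph V) : Function.Injective A.σ :=
  Function.LeftInverse.injective A.invol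

theorem adj_σ_iff (A : CsGraph V) {a b : V} :
    A.graph.Adj (A.σ a) (A.σ b) ↔ A.graph.Adj a b :=
  ⟨fun h => by simpa [A.invol] using A.adj_σ _ _ h, A.adj_σ a b⟩

/-- No edge is mapped to itself by the reflection. -/
def NoFixedEdge (A : CsGraph V) : Prop :=
  ∀ a b, A.graph.Adj a b → ¬ (A.σ a = a ∧ A.σ b = b) ∧ A.σ a ≠ b

theorem noFixedEdge_iff (A : CsGraph V) :
    A.NoFixedEdge ↔ ∀ e ∈ A.graph.edgeSet, Sym2.map A.σ e ≠ e := by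
  constructor
  · intro h e he
    induction e using Sym2.ind with | _ a b => ?_
    intro h'
    have := h a b he
    rcases Sym2.eq_iff.1 h' with h' | h'
    · exact this.1 h'
    · exact this.2 h'.1
  · intro h a b hab
    have := h s(a, b) hab
    rw [Sym2.map_mk, Ne, Sym2.eq_iff, not_or] at this
    refine ⟨this.1, fun h' => this.2 ⟨h', ?_⟩⟩
    rw [← h', A.invol]

theorem isTight_iff [Finite V] (A : CsGraph V) :
    A.IsTight ↔ IsSparse A.graph.edgeSet ∧ A.NoFixedEdge ∧
      A.graph.edgeSet.ncard + 2 = 2 * Nat.card V := by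
  rw [IsTight, isTwoTwoTight_iff, noFixedEdge_iff]; tauto

namespace IsVertexExtension

variable {A : CsGraph V} {B : CsGraph W} {ι : V → W} {N : Set W}

theorem ne (h : A.IsVertexExtension B ι N) (x : V) {v : W} (hv : v ∈ N) : ι x ≠ v := by
  rintro rfl
  rw [← h.2.2] at hv
  exact hv ⟨x, rfl⟩

theorem notMem_of_mem_image (h : A.IsVertexExtension B ι N) {F : Set (Sym2 V)} {e : Sym2 W}
    (he : e ∈ Sym2.map ι '' F) {v : W} (hv : v ∈ N) : v ∉ e := by
  obtain ⟨e, -, rfl⟩ := he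
  intro h'
  obtain ⟨x, -, hx⟩ := Sym2.mem_map.1 h'
  exact h.ne x hv hx

theorem finite [Finite V] (h : A.IsVertexExtension B ι N) (hN : N.Finite) : Finite W := by
  rw [← finite_univ_iff, ← union_compl_self (range ι), h.2.2]
  exact (finite_range ι).union hN

theorem card [Finite W] (h : A.IsVertexExtension B ι N) :
    Nat.card W = Nat.card V + N.ncard := by
  rw [← h.2.2, ← ncard_range_of_injective h.1, ncard_add_ncard_compl]

theorem eq_or_mem (h : A.IsVertexExtension B ι N) (p : W) : (∃ x, p = ι x) ∨ p ∈ N := by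
  by_cases hp : p ∈ range ι
  · obtain ⟨x, rfl⟩ := hp; exact Or.inl ⟨x, rfl⟩
  · right; rw [← h.2.2]; exact hp

end IsVertexExtension

theorem mk_mem_map_image {ι : V → W} (hι : Function.Injective ι) {F : Set (Sym2 V)} {x y : V} :
    s(ι x, ι y) ∈ Sym2.map ι '' F ↔ s(x, y) ∈ F := by
  rw [← Sym2.map_mk, (Sym2.map.injective hι).mem_set_image]

section Counting

theorem ncard_pair_edges {α : Type*} {v x y : α} (h : x ≠ y) :
    ({s(v, x), s(v, y)} : Set (Sym2 α)).ncard = 2 := by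
  rw [ncard_pair]
  rw [Ne, Sym2.eq_iff]; grind

theorem ncard_triple_edges {α : Type*} {v x y z : α} (hxy : x ≠ y) (hxz : z ≠ x) (hyz : z ≠ y) :
    ({s(v, x), s(v, y), s(v, z)} : Set (Sym2 α)).ncard = 3 := by
  rw [ncard_eq_three]
  refine ⟨_, _, _, ?_, ?_, ?_, rfl⟩ <;> rw [Ne, Sym2.eq_iff] <;> grind

end Counting

/-- What has to be shown to see that a move preserves tightness. -/
structure Preserves (A : CsGraph V) (B : CsGraph W) : Prop where
  finite : Finite V → Finite W
  count : Finite V → A.NoFixedEdge →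
    B.graph.edgeSet.ncard + 2 * Nat.card V = A.graph.edgeSet.ncard + 2 * Nat.card W
  noFixedEdge : A.NoFixedEdge → B.NoFixedEdge
  sparse : Finite V → A.NoFixedEdge → IsSparse A.graph.edgeSet → IsSparse B.graph.edgeSet

theorem Preserves.isTight {A : CsGraph V} {B : CsGraph W} (h : Preserves A B) (hA : A.IsTight) :
    B.IsTight := by
  have hV := hA.1.finite
  have hW := h.finite hV
  rw [isTight_iff] at hA ⊢
  have := h.count hV hA.2.1
  exact ⟨h.sparse hV hA.2.1 hA.1, h.noFixedEdge hA.2.1, by omega⟩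

/-- The form needed for inverse moves: the edge count is transferred from the larger graph, so
counting never has to be repeated for a reduction. -/
theorem Preserves.isTight_of_sparse [Finite V] {A : CsGraph V} {B : CsGraph W} (h : Preserves A B)
    (hB : B.IsTight) (hA : IsSparse A.graph.edgeSet) (hA' : A.NoFixedEdge) : A.IsTight := by
  have hW := hB.1.finite
  rw [isTight_iff] at hB ⊢
  have := h.count ‹_› hA'
  exact ⟨hA, hA', by omega⟩

theorem FixedZeroExtension.preserves {A : CsGraph V} {B : CsGraph W}
    (h : A.FixedZeroExtension B) : Preserves A B := by
  obtain ⟨ι, v, x, hv, hι, hx, hE⟩ := h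
  have hadj : ∀ a b, B.graph.Adj a b ↔ s(a, b) ∈ Sym2.map ι '' A.graph.edgeSet ∪
      {s(v, ι x), s(v, ι (A.σ x))} := by
    intro a b; rw [← hE, SimpleGraph.mem_edgeSet]
  have hW : Finite V → Finite W := fun _ => hι.finite (by simp)
  have hne : ∀ y, ι y ≠ v := fun y => hι.ne y rfl
  refine ⟨hW, fun hV _ => ?_, fun hA => ?_, fun hV hA hsp => ?_⟩
  · have := hW hV
    rw [hE, hι.card, ncard_union_eq, ncard_image_of_injective _ (Sym2.map.injective hι.1),
      ncard_pair_edges (fun h => hx (hι.1 h).symm), ncard_singleton]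
    · ring
    · rw [Set.disjoint_left]
      rintro e he (rfl | rfl) <;>
      exact hι.notMem_of_mem_image he (rfl : v ∈ {v}) (by simp)
  · intro a b hab
    rw [hadj] at hab
    rcases hab with ⟨e, he, hab⟩ | hab
    · induction e using Sym2.ind with | _ c d => ?_
      have h1 := hA c d he
      have h2 := hι.2.1 c
      have h3 := hι.2.1 d
      have := hι.1
      rcases Sym2.eq_iff.1 hab with ⟨rfl, rfl⟩ | ⟨rfl, rfl⟩
      · rw [← h2, ← h3, this.eq_iff, this.eq_iff, this.ne_iff]; exact h1
      · rw [← h2, ← h3, this.eq_iff, this.eq_iff, this.ne_iff]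
        refine ⟨fun h => h1.1 h.symm, fun h => h1.2 ?_⟩
        rw [← h, A.invol]
    · have h1 := hι.2.1 x
      have h2 := hι.2.1 (A.σ x)
      have := hι.1.ne hx
      have := hne x
      have := hne (A.σ x)
      rw [A.invol] at h2
      rcases hab with hab | hab <;> rcases Sym2.eq_iff.1 hab with ⟨rfl, rfl⟩ | ⟨rfl, rfl⟩ <;> grind
  · have := hW hV
    refine ((hsp.image hι.1).zeroExtension (hne x) (hne (A.σ x))).mono ?_
    rw [hE]
    refine union_subset_union (fun e he => ⟨he, hι.notMem_of_mem_image he rfl⟩) subset_rfl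

/-- The reflection moves every edge joining an old vertex to a non-fixed new one. -/
theorem noFixedEdge_of_extension {A : CsGraph V} {B : CsGraph W} {ι : V → W} {N : Set W}
    (hA : A.NoFixedEdge) (hι : A.IsVertexExtension B ι N) (hN : ∀ v ∈ N, B.σ v ∈ N)
    (h₁ : ∀ x y, B.graph.Adj (ι x) (ι y) → A.graph.Adj x y)
    (h₂ : ∀ x, ∀ v ∈ N, B.graph.Adj (ι x) v → ¬ (B.σ v = v ∧ A.σ x = x))
    (h₃ : ∀ v ∈ N, ∀ u ∈ N, B.graph.Adj v u → B.σ v ≠ v ∧ B.σ v ≠ u) : B.NoFixedEdge := by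
  intro a b hab
  have h4 := fun x => hι.2.1 x
  rcases hι.eq_or_mem a with ⟨x, rfl⟩ | ha <;> rcases hι.eq_or_mem b with ⟨y, rfl⟩ | hb
  · rw [← h4, ← h4, hι.1.eq_iff, hι.1.eq_iff, hι.1.ne_iff]; exact hA x y (h₁ x y hab)
  · rw [← h4, hι.1.eq_iff]
    refine ⟨fun h => h₂ x b hb hab h.symm, hι.ne _ hb⟩
  · rw [← h4, hι.1.eq_iff]
    refine ⟨fun h => h₂ y a ha hab.symm h, (hι.ne _ (hN _ ha)).symm⟩
  · exact ⟨fun h => (h₃ a ha b hb hab).1 h.1, (h₃ a ha b hb hab).2⟩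

theorem ZeroExtension.preserves {A : CsGraph V} {B : CsGraph W}
    (h : A.ZeroExtension B) : Preserves A B := by
  obtain ⟨ι, v, x, y, hv, hι, hxy, hE⟩ := h
  have hadj : ∀ a b, B.graph.Adj a b ↔ s(a, b) ∈ Sym2.map ι '' A.graph.edgeSet ∪
      {s(v, ι x), s(v, ι y), s(B.σ v, ι (A.σ x)), s(B.σ v, ι (A.σ y))} := by
    intro a b; rw [← hE, SimpleGraph.mem_edgeSet]
  have hW : Finite V → Finite W := fun _ => hι.finite (by simp)
  have hne : ∀ y, ι y ≠ v := fun y => hι.ne y (by simp)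
  have hne' : ∀ y, ι y ≠ B.σ v := fun y => hι.ne y (by simp)
  refine ⟨hW, fun hV _ => ?_, fun hA => ?_, fun hV hA hsp => ?_⟩
  · have := hW hV
    have h4 : ({s(v, ι x), s(v, ι y), s(B.σ v, ι (A.σ x)), s(B.σ v, ι (A.σ y))} :
        Set (Sym2 W)).ncard = 4 := by
      have : ({s(v, ι x), s(v, ι y), s(B.σ v, ι (A.σ x)), s(B.σ v, ι (A.σ y))} :
        Set (Sym2 W)) = {s(v, ι x), s(v, ι y)} ∪ {s(B.σ v, ι (A.σ x)), s(B.σ v, ι (A.σ y))} := by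
        simp only [insert_union, singleton_union]
      rw [this, ncard_union_eq, ncard_pair_edges (hι.1.ne hxy),
        ncard_pair_edges (hι.1.ne (A.σ_injective.ne hxy))]
      rw [Set.disjoint_left]
      rintro e (rfl | rfl) (h | h) <;> rcases Sym2.eq_iff.1 h with h | h <;> grind
    rw [hE, hι.card, ncard_union_eq, ncard_image_of_injective _ (Sym2.map.injective hι.1),
      ncard_pair hv.symm, h4]
    · ring
    · rw [Set.disjoint_left]
      rintro e he (rfl | rfl | rfl | rfl)
      · exact hι.notMem_of_mem_image he (by simp : v ∈ {v, B.σ v}) (by simp)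
      · exact hι.notMem_of_mem_image he (by simp : v ∈ {v, B.σ v}) (by simp)
      · exact hι.notMem_of_mem_image he (by simp : B.σ v ∈ {v, B.σ v}) (by simp)
      · exact hι.notMem_of_mem_image he (by simp : B.σ v ∈ {v, B.σ v}) (by simp)
  · refine noFixedEdge_of_extension hA hι ?_ ?_ ?_ ?_
    · rintro u (rfl | rfl) <;> simp [B.invol]
    · intro p q h
      rw [hadj] at h
      simpa [mk_mem_map_image hι.1, hne, hne'] using h
    · rintro p u (rfl | rfl) - ⟨h, -⟩
      exacts [hv h, hv (B.σ_injective h)]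
    · intro p hp q hq h
      rw [hadj] at h
      rcases h with h | h
      · exact (hι.notMem_of_mem_image h hp (by simp)).elim
      · simp at h hp hq; grind
  · have := hW hV
    -- The symmetrised extension is one 0-extension at v followed by one at its mirror image.
    refine (((hsp.image hι.1).zeroExtension (hne x) (hne y)).zeroExtension
      (hne' (A.σ x)) (hne' (A.σ y))).mono ?_
    rw [hE]
    rintro e (he | rfl | rfl | rfl | rfl)
    · exact Or.inl ⟨Or.inl ⟨he, hι.notMem_of_mem_image he (by simp)⟩,
        hι.notMem_of_mem_image he (by simp)⟩
    · exact Or.inl ⟨by simp, by simp [hv, (hne' _).symm]⟩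
    · exact Or.inl ⟨by simp, by simp [hv, (hne' _).symm]⟩
    · simp
    · simp

theorem OneExtension.preserves {A : CsGraph V} {B : CsGraph W}
    (h : A.OneExtension B) : Preserves A B := by
  obtain ⟨ι, v, x, y, z, hv, hι, hxy, hxy', hzx, hzy, hE⟩ := h
  have hxy0 := hxy.ne
  have hadj : ∀ a b, B.graph.Adj a b ↔ s(a, b) ∈
      Sym2.map ι '' (A.graph.edgeSet \ {s(x, y), s(A.σ x, A.σ y)}) ∪
        {s(v, ι x), s(v, ι y), s(v, ι z),
          s(B.σ v, ι (A.σ x)), s(B.σ v, ι (A.σ y)), s(B.σ v, ι (A.σ z))} := by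
    intro a b; rw [← hE, SimpleGraph.mem_edgeSet]
  have hW : Finite V → Finite W := fun _ => hι.finite (by simp)
  have hne : ∀ y, ι y ≠ v := fun y => hι.ne y (by simp)
  have hne' : ∀ y, ι y ≠ B.σ v := fun y => hι.ne y (by simp)
  refine ⟨hW, fun hV _ => ?_, fun hA => ?_, fun hV hA hsp => ?_⟩
  · have := hW hV
    have h6 : ({s(v, ι x), s(v, ι y), s(v, ι z), s(B.σ v, ι (A.σ x)), s(B.σ v, ι (A.σ y)),
        s(B.σ v, ι (A.σ z))} : Set (Sym2 W)).ncard = 6 := by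
      have : ({s(v, ι x), s(v, ι y), s(v, ι z), s(B.σ v, ι (A.σ x)), s(B.σ v, ι (A.σ y)),
        s(B.σ v, ι (A.σ z))} : Set (Sym2 W)) = {s(v, ι x), s(v, ι y), s(v, ι z)} ∪
          {s(B.σ v, ι (A.σ x)), s(B.σ v, ι (A.σ y)), s(B.σ v, ι (A.σ z))} := by
        simp only [insert_union, singleton_union]
      rw [this, ncard_union_eq, ncard_triple_edges (hι.1.ne hxy0) (hι.1.ne hzx) (hι.1.ne hzy),
        ncard_triple_edges (hι.1.ne (A.σ_injective.ne hxy0)) (hι.1.ne (A.σ_injective.ne hzx))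
          (hι.1.ne (A.σ_injective.ne hzy))]
      rw [Set.disjoint_left]
      rintro e (rfl | rfl | rfl) (h | h | h) <;> rcases Sym2.eq_iff.1 h with h | h <;> grind
    have h2 : ({s(x, y), s(A.σ x, A.σ y)} : Set (Sym2 V)) ⊆ A.graph.edgeSet := by
      rintro e (rfl | rfl)
      exacts [hxy, A.adj_σ _ _ hxy]
    have h3 := ncard_sdiff_add_ncard_of_subset h2
    rw [ncard_pair hxy'.symm] at h3
    rw [hE, hι.card, ncard_union_eq, ncard_image_of_injective _ (Sym2.map.injective hι.1),
      ncard_pair hv.symm, h6]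
    · omega
    · rw [Set.disjoint_left]
      rintro e he (rfl | rfl | rfl | rfl | rfl | rfl)
      iterate 3 exact hι.notMem_of_mem_image he (by simp : v ∈ {v, B.σ v}) (by simp)
      iterate 3 exact hι.notMem_of_mem_image he (by simp : B.σ v ∈ {v, B.σ v}) (by simp)
  · refine noFixedEdge_of_extension hA hι ?_ ?_ ?_ ?_
    · rintro u (rfl | rfl) <;> simp [B.invol]
    · intro p q h
      rw [hadj] at h
      simp only [mem_union, mk_mem_map_image hι.1] at h
      rcases h with h | h
      · exact h.1
      · simp [hne, hne'] at h
    · rintro p u (rfl | rfl) - ⟨h, -⟩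
      exacts [hv h, hv (B.σ_injective h)]
    · intro p hp q hq h
      rw [hadj] at h
      rcases h with h | h
      · exact (hι.notMem_of_mem_image h hp (by simp)).elim
      · simp at h hp hq; grind
  · have := hW hV
    have h1 : s(ι x, ι y) ∈ Sym2.map ι '' A.graph.edgeSet := by
      rw [mk_mem_map_image hι.1]; exact hxy
    -- The mirror image of xy survives the first 1-extension because xy is not a fixed edge; it is
    -- then available for the second.
    have h2 : s(ι (A.σ x), ι (A.σ y)) ∈ {e | e ∈ Sym2.map ι '' A.graph.edgeSet ∧ v ∉ e ∧
        e ≠ s(ι x, ι y)} ∪ {s(v, ι x), s(v, ι y), s(v, ι z)} := by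
      refine Or.inl ⟨?_, ?_, ?_⟩
      · rw [mk_mem_map_image hι.1]; exact A.adj_σ _ _ hxy
      · simp [(hne _).symm]
      · exact fun h => hxy' (Sym2.map.injective hι.1 h)
    refine (((hsp.image hι.1).oneExtension (hne x) (hne y) (hne z) h1).oneExtension
      (hne' (A.σ x)) (hne' (A.σ y)) (hne' (A.σ z)) h2).mono ?_
    rw [hE]
    rintro e (⟨e, he, rfl⟩ | he)
    · have he' : Sym2.map ι e ∈ Sym2.map ι '' A.graph.edgeSet := ⟨e, he.1, rfl⟩
      refine Or.inl ⟨Or.inl ⟨he', hι.notMem_of_mem_image he' (by simp), ?_⟩,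
        hι.notMem_of_mem_image he' (by simp), ?_⟩
      · rw [← Sym2.map_mk, (Sym2.map.injective hι.1).ne_iff]; exact fun h => he.2 (by simp [h])
      · rw [← Sym2.map_mk, (Sym2.map.injective hι.1).ne_iff]; exact fun h => he.2 (by simp [h])
    · simp only [mem_insert_iff, mem_singleton_iff] at he
      rcases he with rfl | rfl | rfl | he
      · exact Or.inl ⟨by simp, by simp [hv, (hne' _).symm], by simp [(hne _).symm]⟩
      · exact Or.inl ⟨by simp, by simp [hv, (hne' _).symm], by simp [(hne _).symm]⟩
      · exact Or.inl ⟨by simp, by simp [hv, (hne' _).symm], by simp [(hne _).symm]⟩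
      · exact Or.inr he

end CsGraph

/-! ### The vertex splitting moves preserve tightness -/

namespace CsGraph

variable {U V W : Type u}

theorem injOn_mk {α β : Type*} {P : Set α} {f g : α → β} (hg : InjOn g P)
    (hfg : ∀ x ∈ P, ∀ y ∈ P, f x ≠ g y) : InjOn (fun x => s(f x, g x)) P := by
  intro x hx y hy h
  rcases Sym2.eq_iff.1 h with h | h
  · exact hg hx hy h.2
  · exact (hfg x hx y hy h.1).elim

theorem setOf_exists_eq_or_eq {α β : Type*} (P : Set α) (F G : α → β) :
    {e | ∃ p ∈ P, e = F p ∨ e = G p} = F '' P ∪ G '' P := by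
  ext e
  simp only [mem_ofPred_eq, mem_union, mem_image, eq_comm (a := e)]
  grind

theorem mem_edgesAvoiding {A : CsGraph V} {w x y : V} : s(x, y) ∈ A.edgesAvoiding w ↔
    A.graph.Adj x y ∧ x ≠ w ∧ y ≠ w ∧ x ≠ A.σ w ∧ y ≠ A.σ w := by
  simp only [edgesAvoiding, mem_ofPred_eq, SimpleGraph.mem_edgeSet, Sym2.mem_iff]
  grind

theorem ncard_edgeSet_of_fixed [Finite V] {A : CsGraph V} {w : V} (hw : A.σ w = w) :
    A.graph.edgeSet.ncard = (A.edgesAvoiding w).ncard + (A.graph.neighborSet w).ncard := by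
  have hinj : InjOn (fun x => s(w, x)) (A.graph.neighborSet w) := by
    refine injOn_mk (f := fun _ => w) (injOn_id _) fun x _ y hy => ?_
    exact SimpleGraph.Adj.ne hy
  rw [← hinj.ncard_image, ← ncard_union_eq]
  · congr 1
    ext e
    induction e using Sym2.ind with | _ a b => ?_
    simp only [mem_union, mem_edgesAvoiding, SimpleGraph.mem_edgeSet, mem_image,
      SimpleGraph.mem_neighborSet, Sym2.eq_iff, hw]
    constructor
    · intro h
      by_cases ha : a = w
      · exact Or.inr ⟨b, ha ▸ h, by simp [ha]⟩
      by_cases hb : b = w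
      · exact Or.inr ⟨a, hb ▸ h.symm, by simp [hb]⟩
      exact Or.inl ⟨h, ha, hb, ha, hb⟩
    · rintro (h | ⟨x, hx, ⟨rfl, rfl⟩ | ⟨rfl, rfl⟩⟩)
      exacts [h.1, hx, hx.symm]
  · rw [Set.disjoint_left]
    rintro e he ⟨x, -, rfl⟩
    exact (mem_edgesAvoiding.1 he).2.1 rfl

/-- Without fixed edges w and σ w are not adjacent, so their stars are disjoint, and the reflection
exchanges them. -/
theorem ncard_edgeSet_of_not_fixed [Finite V] {A : CsGraph V} {w : V} (hw : A.σ w ≠ w)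
    (hA : A.NoFixedEdge) :
    A.graph.edgeSet.ncard = (A.edgesAvoiding w).ncard + 2 * (A.graph.neighborSet w).ncard := by
  have hww : ¬ A.graph.Adj w (A.σ w) := fun h => (hA _ _ h).2 rfl
  have hinj : InjOn (fun x => s(w, x)) (A.graph.neighborSet w) := by
    refine injOn_mk (f := fun _ => w) (injOn_id _) fun x _ y hy => ?_
    exact SimpleGraph.Adj.ne hy
  have hinj' : InjOn (fun x => s(A.σ w, A.σ x)) (A.graph.neighborSet w) := by
    refine injOn_mk (f := fun _ => A.σ w) A.σ_injective.injOn fun x _ y hy => ?_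
    exact A.σ_injective.ne (SimpleGraph.Adj.ne hy)
  have h2 : 2 * (A.graph.neighborSet w).ncard =
      ((fun x => s(w, x)) '' A.graph.neighborSet w ∪
        (fun x => s(A.σ w, A.σ x)) '' A.graph.neighborSet w).ncard := by
    rw [ncard_union_eq, hinj.ncard_image, hinj'.ncard_image, two_mul]
    rw [Set.disjoint_left]
    rintro e ⟨x, hx, rfl⟩ ⟨y, hy, h⟩
    rcases Sym2.eq_iff.1 h with h | h
    · exact hw h.1
    · have : y = A.σ w := by rw [← h.2, A.invol]
      subst this
      exact hww hy
  rw [h2, ← ncard_union_eq]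
  · congr 1
    ext e
    induction e using Sym2.ind with | _ a b => ?_
    simp only [mem_union, mem_edgesAvoiding, SimpleGraph.mem_edgeSet, mem_image,
      SimpleGraph.mem_neighborSet, Sym2.eq_iff]
    constructor
    · intro h
      have h' := A.adj_σ _ _ h
      by_cases ha : a = w
      · exact Or.inr <| Or.inl ⟨b, ha ▸ h, by simp [ha]⟩
      by_cases hb : b = w
      · exact Or.inr <| Or.inl ⟨a, hb ▸ h.symm, by simp [hb]⟩
      by_cases ha' : a = A.σ w
      · refine Or.inr <| Or.inr ⟨A.σ b, ?_, by simp [ha', A.invol]⟩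
        rwa [ha', A.invol] at h'
      by_cases hb' : b = A.σ w
      · refine Or.inr <| Or.inr ⟨A.σ a, ?_, by simp [hb', A.invol]⟩
        rw [hb', A.invol] at h'
        exact h'.symm
      exact Or.inl ⟨h, ha, hb, ha', hb'⟩
    · rintro (h | ⟨x, hx, ⟨rfl, rfl⟩ | ⟨rfl, rfl⟩⟩ | ⟨x, hx, ⟨rfl, rfl⟩ | ⟨rfl, rfl⟩⟩)
      exacts [h.1, hx, hx.symm, A.adj_σ _ _ hx, (A.adj_σ _ _ hx).symm]
  · rw [Set.disjoint_left]
    rintro e he (⟨x, -, rfl⟩ | ⟨x, -, rfl⟩)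
    · exact (mem_edgesAvoiding.1 he).2.1 rfl
    · exact (mem_edgesAvoiding.1 he).2.2.2.1 rfl

/-! ### Vertex splits: adjacency, sparsity and edge counts -/

section Split

variable {A : CsGraph V} {B : CsGraph W} {ι : V → W} {N : Set W} {w : V} {u : W} {P Q : Set V}

theorem IsSplit.adj_iff (hs : A.IsSplit B ι w u P Q) (a b : W) : B.graph.Adj a b ↔
    s(a, b) ∈ Sym2.map ι '' A.edgesAvoiding w ∨
    (∃ p ∈ P, s(a, b) = s(ι w, ι p) ∨ s(a, b) = s(ι (A.σ w), ι (A.σ p))) ∨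
    (∃ q ∈ Q, s(a, b) = s(u, ι q) ∨ s(a, b) = s(B.σ u, ι (A.σ q))) := by
  rw [← SimpleGraph.mem_edgeSet, hs, ← or_assoc]; rfl

theorem IsSplit.adj_of_adj (hs : A.IsSplit B ι w u P Q) (hι : A.IsVertexExtension B ι {u, B.σ u})
    (hP : P ⊆ A.graph.neighborSet w) {x y : V} (h : B.graph.Adj (ι x) (ι y)) :
    A.graph.Adj x y := by
  have hu : ∀ x, ι x ≠ u := fun x => hι.ne x (by simp)
  have hu' : ∀ x, ι x ≠ B.σ u := fun x => hι.ne x (by simp)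
  have hinj : ∀ a b, ι a = ι b ↔ a = b := fun a b => hι.1.eq_iff
  rw [hs.adj_iff, mk_mem_map_image hι.1, mem_edgesAvoiding] at h
  simp only [Sym2.eq_iff, hu, hu', hinj, false_and, and_false, or_false, exists_false] at h
  rcases h with h | ⟨p, hp, (⟨rfl, rfl⟩ | ⟨rfl, rfl⟩) | ⟨rfl, rfl⟩ | ⟨rfl, rfl⟩⟩
  exacts [h.1, hP hp, (hP hp).symm, A.adj_σ _ _ (hP hp), (A.adj_σ _ _ (hP hp)).symm]

theorem IsSplit.adj_new (hs : A.IsSplit B ι w u P Q) (hι : A.IsVertexExtension B ι {u, B.σ u})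
    {b : W} (h : B.graph.Adj u b) : (∃ q ∈ Q, b = ι q) ∨ B.σ u = u ∧ ∃ q ∈ Q, b = ι (A.σ q) := by
  have hu : ∀ x, u ≠ ι x := fun x => (hι.ne x (by simp)).symm
  rw [hs.adj_iff] at h
  simp only [Sym2.eq_iff, hu, false_and, and_false, or_false, exists_false, false_or,
    true_and] at h
  rcases h with h | ⟨q, hq, rfl | ⟨h, rfl⟩⟩
  · exact (hι.notMem_of_mem_image h (by simp : u ∈ {u, B.σ u}) (by simp)).elim
  · exact Or.inl ⟨q, hq, rfl⟩
  · exact Or.inr ⟨h.symm, q, hq, rfl⟩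

theorem IsSplit.adj_new_of_ne (hs : A.IsSplit B ι w u P Q)
    (hι : A.IsVertexExtension B ι {u, B.σ u}) (hu : B.σ u ≠ u) {b : W} (h : B.graph.Adj u b) :
    ∃ q ∈ Q, b = ι q := by
  rcases hs.adj_new hι h with h | h
  exacts [h, (hu h.1).elim]

/-- This bounds the common neighbours of w and u after the split by P ∩ Q. Edges at w come only from
P: the mirror-image clause contributes none to old neighbours of w if w is not fixed, and the same
ones again if w is fixed and P is invariant. -/
theorem IsSplit.mem_of_adj (hs : A.IsSplit B ι w u P Q)
    (hι : A.IsVertexExtension B ι {u, B.σ u}) (hw : ¬ A.graph.Adj w (A.σ w))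
    (hP' : A.σ w = w → ∀ p ∈ P, A.σ p ∈ P) {q : V} (hq : A.graph.Adj w q)
    (h : B.graph.Adj (ι w) (ι q)) : q ∈ P := by
  have hu : ∀ x, ι x ≠ u := fun x => hι.ne x (by simp)
  have hu' : ∀ x, ι x ≠ B.σ u := fun x => hι.ne x (by simp)
  have hinj : ∀ a b, ι a = ι b ↔ a = b := fun a b => hι.1.eq_iff
  have := hq.ne
  rw [hs.adj_iff, mk_mem_map_image hι.1, mem_edgesAvoiding] at h
  simp only [Sym2.eq_iff, hu, hu', hinj, false_and, and_false, or_false, exists_false] at h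
  grind

theorem IsSplit.noFixedEdge (hs : A.IsSplit B ι w u P Q)
    (hι : A.IsVertexExtension B ι {u, B.σ u})
    (hP : P ⊆ A.graph.neighborSet w) (hQ : Q ⊆ A.graph.neighborSet w)
    (hw : B.σ u = u → A.σ w = w) (hA : A.NoFixedEdge) : B.NoFixedEdge := by
  have hnew : ∀ b ∈ ({u, B.σ u} : Set W), ¬ B.graph.Adj u b := by
    intro b hb h
    rcases hs.adj_new hι h with ⟨q, -, rfl⟩ | ⟨-, q, -, rfl⟩
    · exact hι.ne _ hb rfl
    · exact hι.ne _ hb rfl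
  have hσ : ∀ v ∈ ({u, B.σ u} : Set W), B.σ v ∈ ({u, B.σ u} : Set W) := by
    rintro v (rfl | rfl) <;> simp [B.invol]
  refine noFixedEdge_of_extension hA hι hσ (fun x y => hs.adj_of_adj hι hP) ?_ ?_
  · rintro x v hv hxv ⟨h, hx⟩
    have hv : v = u := by
      rcases hv with rfl | rfl
      · rfl
      · rwa [B.invol, eq_comm] at h
    subst hv
    rcases hs.adj_new hι hxv.symm with ⟨q, hq, hxq⟩ | ⟨-, q, hq, hxq⟩
    · have := hι.1 hxq
      subst this
      exact (hA _ _ (hQ hq)).1 ⟨hw h, hx⟩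
    · have := hι.1 hxq
      subst this
      refine (hA _ _ (A.adj_σ _ _ (hQ hq))).1 ⟨by rw [hw h, hw h], hx⟩
  · rintro v (rfl | rfl) b hb h
    · exact (hnew b hb h).elim
    · have := B.adj_σ _ _ h
      rw [B.invol] at this
      exact (hnew _ (hσ _ hb) this).elim

theorem IsSplit.sparse_of_fixed [Finite W] (hs : A.IsSplit B ι w u P Q)
    (hι : A.IsVertexExtension B ι {u, B.σ u}) (hu : B.σ u = u)
    (hP : P ⊆ A.graph.neighborSet w) (hQ : Q ⊆ A.graph.neighborSet w)
    (hQσ : ∀ q ∈ Q, A.σ q ∈ Q) {v₁ v₂ : V}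
    (hPQ : ∀ q ∈ Q, B.graph.Adj (ι w) (ι q) → q = v₁ ∨ q = v₂)
    (hA : IsSparse A.graph.edgeSet) : IsSparse B.graph.edgeSet := by
  have hnb : ∀ b, B.graph.Adj u b → ∃ q ∈ Q, b = ι q := by
    intro b hb
    rcases hs.adj_new hι hb with h | ⟨-, q, hq, rfl⟩
    exacts [h, ⟨_, hQσ q hq, rfl⟩]
  refine (hA.image hι.1).split (u := u) (w := ι w) (v₁ := ι v₁) (v₂ := ι v₂) ?_ ?_ ?_ (by simp)
  · intro e he hue
    induction e using Sym2.ind with | _ a b => ?_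
    simp only [Sym2.mem_iff, not_or] at hue
    rcases hι.eq_or_mem a with ⟨x, rfl⟩ | ha
    · rcases hι.eq_or_mem b with ⟨y, rfl⟩ | hb
      · rw [mk_mem_map_image hι.1]; exact hs.adj_of_adj hι hP he
      · rw [hu] at hb; grind
    · rw [hu] at ha; grind
  · intro b hb
    obtain ⟨q, hq, rfl⟩ := hnb b hb
    rw [mk_mem_map_image hι.1]; exact hQ hq
  · intro b hb hb'
    obtain ⟨q, hq, rfl⟩ := hnb b hb
    rcases hPQ q hq hb' with h | h <;> simp [h]

/-- Two splits in succession, first u off w and then σ u off σ w. If w is fixed, both come off the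
same vertex, which in between is joined to the mirror image of Q as well as to P; `hQQ` then keeps
the common neighbours of u and w down to two. -/
theorem IsSplit.sparse_of_ne [Finite W] (hs : A.IsSplit B ι w u P Q)
    (hι : A.IsVertexExtension B ι {u, B.σ u}) (hu : B.σ u ≠ u)
    (hP : P ⊆ A.graph.neighborSet w) (hQ : Q ⊆ A.graph.neighborSet w)
    (hw : ¬ A.graph.Adj w (A.σ w)) {v₁ v₂ : V}
    (hPQ : ∀ q ∈ Q, B.graph.Adj (ι w) (ι q) → q = v₁ ∨ q = v₂)
    (hQQ : A.σ w = w → ∀ q ∈ Q, A.σ q ∈ Q → q = v₁ ∨ q = v₂)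
    (hA : IsSparse A.graph.edgeSet) : IsSparse B.graph.edgeSet := by
  have hnb : ∀ b, B.graph.Adj u b → ∃ q ∈ Q, b = ι q := fun b hb => hs.adj_new_of_ne hι hu hb
  have hnb' : ∀ b, B.graph.Adj (B.σ u) b → ∃ q ∈ Q, b = ι (A.σ q) := by
    intro b hb
    have h := B.adj_σ _ _ hb
    rw [B.invol] at h
    obtain ⟨q, hq, h⟩ := hnb _ h
    exact ⟨q, hq, by rw [hι.2.1, ← h, B.invol]⟩
  have hne : ∀ x, ι x ≠ u := fun x => hι.ne x (by simp)
  have hne' : ∀ x, ι x ≠ B.σ u := fun x => hι.ne x (by simp)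
  -- The intermediate stage: u is already split off, while the edges at σ u are still attached to σ
  -- w.
  set E₁ : Set (Sym2 W) := {e | e ∈ B.graph.edgeSet ∧ B.σ u ∉ e} ∪
    {e | ∃ q ∈ Q, e = s(ι (A.σ w), ι (A.σ q))} with hE₁
  have h1 : IsSparse E₁ := by
    refine (hA.image hι.1).split (u := u) (w := ι w) (v₁ := ι v₁) (v₂ := ι v₂) ?_ ?_ ?_ ?_
    · rintro e (⟨he, he'⟩ | ⟨q, hq, rfl⟩) hue
      · induction e using Sym2.ind with | _ a b => ?_
        simp only [Sym2.mem_iff, not_or] at hue he'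
        rcases hι.eq_or_mem a with ⟨x, rfl⟩ | ha
        · rcases hι.eq_or_mem b with ⟨y, rfl⟩ | hb
          · rw [mk_mem_map_image hι.1]; exact hs.adj_of_adj hι hP he
          · simp at hb; grind
        · simp at ha; grind
      · rw [mk_mem_map_image hι.1]; exact A.adj_σ _ _ (hQ hq)
    · rintro b (⟨hb, -⟩ | ⟨q, hq, h⟩)
      · obtain ⟨q, hq, rfl⟩ := hnb b hb
        rw [mk_mem_map_image hι.1]; exact hQ hq
      · exfalso; rcases Sym2.eq_iff.1 h with h | h
        exacts [hne _ h.1.symm, hne _ h.1.symm]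
    · rintro b (⟨hb, -⟩ | ⟨q, hq, h⟩) hb'
      · obtain ⟨q, hq, rfl⟩ := hnb b hb
        rcases hb' with hb' | ⟨q', hq', h⟩
        · rcases hPQ q hq hb'.1 with h | h <;> simp [h]
        · rcases Sym2.eq_iff.1 h with h | h
          · have h2 := hι.1 h.2
            have : A.σ q ∈ Q := by rw [h2, A.invol]; exact hq'
            rcases hQQ (hι.1 h.1).symm q hq this with h | h <;> simp [h]
          · exact (hw (hι.1 h.2 ▸ hQ hq)).elim
      · exfalso; rcases Sym2.eq_iff.1 h with h | h
        exacts [hne _ h.1.symm, hne _ h.1.symm]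
    · rintro (⟨h, -⟩ | ⟨q, hq, h⟩)
      · simp at h
      · rcases Sym2.eq_iff.1 h with h | h
        exacts [hne _ h.1.symm, hne _ h.1.symm]
  refine h1.split (u := B.σ u) (w := ι (A.σ w)) (v₁ := ι (A.σ v₁)) (v₂ := ι (A.σ v₂))
    ?_ ?_ ?_ (by simp)
  · exact fun e he hue => Or.inl ⟨he, hue⟩
  · intro b hb
    obtain ⟨q, hq, rfl⟩ := hnb' b hb
    exact Or.inr ⟨q, hq, rfl⟩
  · intro b hb hb'
    obtain ⟨q, hq, rfl⟩ := hnb' b hb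
    rw [SimpleGraph.mem_edgeSet, hι.2.1, hι.2.1, adj_σ_iff] at hb'
    rcases hPQ q hq hb' with h | h <;> simp [h]

/-- The edges at the vertices that a split creates are counted by `P` and `Q`. -/
theorem IsSplit.ncard_edgeSet [Finite W] (hs : A.IsSplit B ι w u P Q)
    (hι : A.IsVertexExtension B ι {u, B.σ u}) {k l : ℕ}
    (hk : {e | ∃ p ∈ P, e = s(ι w, ι p) ∨ e = s(ι (A.σ w), ι (A.σ p))}.ncard = k)
    (hl : {e | ∃ q ∈ Q, e = s(u, ι q) ∨ e = s(B.σ u, ι (A.σ q))}.ncard = l) :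
    B.graph.edgeSet.ncard = (A.edgesAvoiding w).ncard + k + l := by
  rw [hs, ncard_union_eq, ncard_union_eq, ncard_image_of_injective _ (Sym2.map.injective hι.1),
    hk, hl]
  · rw [Set.disjoint_left]
    rintro _ ⟨e, he, rfl⟩ ⟨p, hp, h⟩
    induction e using Sym2.ind with | _ a b => ?_
    rw [mem_edgesAvoiding] at he
    simp only [Sym2.map_mk, Sym2.eq_iff, hι.1.eq_iff] at h
    tauto
  · rw [Set.disjoint_left]
    have hne : ∀ x, ι x ≠ u := fun x => hι.ne x (by simp)
    have hne' : ∀ x, ι x ≠ B.σ u := fun x => hι.ne x (by simp)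
    rintro e (h' | ⟨p, hp, h'⟩) ⟨q, hq, h⟩
    · rcases h with rfl | rfl
      · exact hι.notMem_of_mem_image h' (by simp : u ∈ {u, B.σ u}) (by simp)
      · exact hι.notMem_of_mem_image h' (by simp : B.σ u ∈ {u, B.σ u}) (by simp)
    · rcases h' with rfl | rfl <;> simp only [Sym2.eq_iff] at h <;> grind

/-- At a fixed centre with an invariant leaf set the mirror-image clause repeats edges already
listed. -/
theorem ncard_star_fixed {ι : V → W} (hι : InjOn ι Q) {c : W} (hc : ∀ x ∈ Q, c ≠ ι x)
    {τ : V → V} (hτ : ∀ q ∈ Q, τ q ∈ Q) :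
    {e | ∃ q ∈ Q, e = s(c, ι q) ∨ e = s(c, ι (τ q))}.ncard = Q.ncard := by
  have hinj : InjOn (fun x => s(c, ι x)) Q := injOn_mk (f := fun _ => c) hι fun _ _ y hy => hc y hy
  rw [← hinj.ncard_image]
  congr 1
  ext e
  constructor
  · rintro ⟨q, hq, rfl | rfl⟩
    exacts [⟨q, hq, rfl⟩, ⟨τ q, hτ q hq, rfl⟩]
  · rintro ⟨q, hq, rfl⟩
    exact ⟨q, hq, Or.inl rfl⟩

theorem ncard_star_pair {α β : Type*} [Finite β] {Q : Set α} {f g f' g' : α → β} (hg : InjOn g Q)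
    (hg' : InjOn g' Q)
    (hc : ∀ x ∈ Q, ∀ y ∈ Q, f x ≠ g y) (hd : ∀ x ∈ Q, ∀ y ∈ Q, f' x ≠ g' y)
    (hcd : ∀ x ∈ Q, ∀ y ∈ Q, f x ≠ f' y) (hcg : ∀ x ∈ Q, ∀ y ∈ Q, f x ≠ g' y) :
    {e | ∃ q ∈ Q, e = s(f q, g q) ∨ e = s(f' q, g' q)}.ncard = 2 * Q.ncard := by
  rw [setOf_exists_eq_or_eq, ncard_union_eq,
    (injOn_mk hg hc).ncard_image, (injOn_mk hg' hd).ncard_image, two_mul]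
  rw [Set.disjoint_left]
  rintro _ ⟨x, hx, rfl⟩ ⟨y, hy, h⟩
  rcases Sym2.eq_iff.1 h with h | h
  · exact hcd _ hx _ hy h.1.symm
  · exact hcg _ hx _ hy h.2.symm

end Split

theorem VertexToC4Pair.preserves {A : CsGraph V} {B : CsGraph W} (h : A.VertexToC4Pair B) :
    Preserves A B := by
  obtain ⟨ι, w, u, v₁, v₂, P, Q, hw, hu, hι, hv, hPQ, hPQ', hs⟩ := h
  have hW : Finite V → Finite W := fun _ => hι.finite (by simp)
  have hP : P ⊆ A.graph.neighborSet w := hPQ ▸ subset_union_left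
  have hQ : Q ⊆ A.graph.neighborSet w := hPQ ▸ subset_union_right
  have hne : ∀ x, u ≠ ι x := fun x => (hι.ne x (by simp)).symm
  have hne' : ∀ x, B.σ u ≠ ι x := fun x => (hι.ne x (by simp)).symm
  refine ⟨hW, fun hV hA => ?_, hs.noFixedEdge hι hP hQ (fun h => (hu h).elim),
    fun hV hA => ?_⟩
  · have := hW hV
    have hww : ¬ A.graph.Adj w (A.σ w) := fun h => (hA _ _ h).2 rfl
    have hk : {e | ∃ p ∈ P, e = s(ι w, ι p) ∨ e = s(ι (A.σ w), ι (A.σ p))}.ncard =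
        2 * P.ncard := by
      refine ncard_star_pair (f := fun _ => ι w) (f' := fun _ => ι (A.σ w)) hι.1.injOn
        (hι.1.comp A.σ_injective).injOn ?_ ?_ ?_ ?_
      · exact fun x _ y hy => hι.1.ne (hP hy).ne
      · exact fun x _ y hy => hι.1.ne (A.σ_injective.ne (hP hy).ne)
      · exact fun x _ y hy => hι.1.ne hw.symm
      · intro x _ y hy h
        have : A.σ w = y := by rw [hι.1 h, A.invol]
        exact hww (this ▸ hP hy)
    have hl : {e | ∃ q ∈ Q, e = s(u, ι q) ∨ e = s(B.σ u, ι (A.σ q))}.ncard = 2 * Q.ncard :=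
      ncard_star_pair (f := fun _ => u) (f' := fun _ => B.σ u) hι.1.injOn
        (hι.1.comp A.σ_injective).injOn (fun _ _ _ _ => hne _) (fun _ _ _ _ => hne' _)
        (fun _ _ _ _ => hu.symm) (fun _ _ _ _ => hne _)
    rw [hs.ncard_edgeSet hι hk hl, ncard_edgeSet_of_not_fixed hw hA, hι.card,
      ncard_pair hu.symm]
    have h3 := ncard_union_add_ncard_inter P Q
    rw [hPQ, hPQ', ncard_pair hv] at h3
    omega
  · have := hW hV
    have hww : ¬ A.graph.Adj w (A.σ w) := fun h => (hA _ _ h).2 rfl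
    refine hs.sparse_of_ne hι hu hP hQ hww (v₁ := v₁) (v₂ := v₂) (fun q hq hq' => ?_)
      (fun h => (hw h).elim)
    have : q ∈ P ∩ Q := ⟨hs.mem_of_adj hι hww (fun h => (hw h).elim) (hQ hq) hq', hq⟩
    rw [hPQ'] at this
    simpa using this

theorem VertexToC4Fixed.preserves {A : CsGraph V} {B : CsGraph W} (h : A.VertexToC4Fixed B) :
    Preserves A B := by
  obtain ⟨ι, w, u, v₁, P, Q, hw, hu, hι, hv, hPQ, hPQ', hPσ, hQσ, hs⟩ := h
  have hι' : A.IsVertexExtension B ι {u, B.σ u} := by simpa [hu] using hι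
  have hW : Finite V → Finite W := fun _ => hι.finite (by simp)
  have hP : P ⊆ A.graph.neighborSet w := hPQ ▸ subset_union_left
  have hQ : Q ⊆ A.graph.neighborSet w := hPQ ▸ subset_union_right
  have hne : ∀ x, u ≠ ι x := fun x => (hι.ne x (by simp)).symm
  refine ⟨hW, fun hV hA => ?_, hs.noFixedEdge hι' hP hQ (fun _ => hw), fun hV hA => ?_⟩
  · have := hW hV
    have hk : {e | ∃ p ∈ P, e = s(ι w, ι p) ∨ e = s(ι (A.σ w), ι (A.σ p))}.ncard =
        P.ncard := by
      rw [hw]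
      exact ncard_star_fixed hι.1.injOn (fun x hx => hι.1.ne (hP hx).ne) hPσ
    have hl : {e | ∃ q ∈ Q, e = s(u, ι q) ∨ e = s(B.σ u, ι (A.σ q))}.ncard = Q.ncard := by
      rw [hu]
      exact ncard_star_fixed hι.1.injOn (fun x hx => hne x) hQσ
    rw [hs.ncard_edgeSet hι' hk hl, ncard_edgeSet_of_fixed hw, hι.card, ncard_singleton]
    have h3 := ncard_union_add_ncard_inter P Q
    rw [hPQ, hPQ', ncard_pair hv.symm] at h3
    omega
  · have := hW hV
    have hww : ¬ A.graph.Adj w (A.σ w) := fun h => (hA _ _ h).2 rfl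
    refine hs.sparse_of_fixed hι' hu hP hQ hQσ (v₁ := v₁) (v₂ := A.σ v₁) (fun q hq hq' => ?_)
    have : q ∈ P ∩ Q := ⟨hs.mem_of_adj hι' hww (fun _ => hPσ) (hQ hq) hq', hq⟩
    rw [hPQ'] at this
    simpa using this

theorem VertexToC4FixedPair.preserves {A : CsGraph V} {B : CsGraph W}
    (h : A.VertexToC4FixedPair B) : Preserves A B := by
  obtain ⟨ι, w, u, v₁, v₂, P, Q, hw, hu, hι, hv, hPQ, hPQ', hPσ, hQQ, hs⟩ := h
  have hW : Finite V → Finite W := fun _ => hι.finite (by simp)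
  have hP : P ⊆ A.graph.neighborSet w := hPQ ▸ subset_union_left.trans subset_union_left
  have hQ : Q ⊆ A.graph.neighborSet w := hPQ ▸ subset_union_right.trans subset_union_left
  have hne : ∀ x, u ≠ ι x := fun x => (hι.ne x (by simp)).symm
  have hne' : ∀ x, B.σ u ≠ ι x := fun x => (hι.ne x (by simp)).symm
  refine ⟨hW, fun hV hA => ?_, hs.noFixedEdge hι hP hQ (fun h => (hu h).elim), fun hV hA => ?_⟩
  · have := hW hV
    have hk : {e | ∃ p ∈ P, e = s(ι w, ι p) ∨ e = s(ι (A.σ w), ι (A.σ p))}.ncard =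
        P.ncard := by
      rw [hw]
      exact ncard_star_fixed hι.1.injOn (fun x hx => hι.1.ne (hP hx).ne) hPσ
    have hl : {e | ∃ q ∈ Q, e = s(u, ι q) ∨ e = s(B.σ u, ι (A.σ q))}.ncard = 2 * Q.ncard :=
      ncard_star_pair (f := fun _ => u) (f' := fun _ => B.σ u) hι.1.injOn
        (hι.1.comp A.σ_injective).injOn (fun _ _ _ _ => hne _) (fun _ _ _ _ => hne' _)
        (fun _ _ _ _ => hu.symm) (fun _ _ _ _ => hne _)
    rw [hs.ncard_edgeSet hι hk hl, ncard_edgeSet_of_fixed hw, hι.card, ncard_pair hu.symm]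
    have h3 := ncard_union_add_ncard_inter P Q
    have h4 := ncard_union_add_ncard_inter (P ∪ Q) (A.σ '' Q)
    -- The overlaps in covering the neighbours of w by P, Q and σ Q are P ∩ Q and its mirror image,
    -- two vertices each. The degree of w is therefore |P| + 2|Q| − 4, so the split adds four edges
    -- along with its two vertices.
    have h5 : (P ∪ Q) ∩ A.σ '' Q = A.σ '' (P ∩ Q) := by
      ext x
      constructor
      · rintro ⟨hx, q, hq, rfl⟩
        have : A.σ q ∈ P := by
          rcases hx with hx | hx
          exacts [hx, hQQ ⟨hx, q, hq, rfl⟩]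
        exact ⟨q, ⟨by simpa [A.invol] using hPσ _ this, hq⟩, rfl⟩
      · rintro ⟨q, hq, rfl⟩
        exact ⟨Or.inl (hPσ q hq.1), q, hq.2, rfl⟩
    rw [hPQ, h5, ncard_image_of_injective _ A.σ_injective,
      ncard_image_of_injective _ A.σ_injective] at h4
    rw [hPQ', ncard_pair hv] at h3 h4
    omega
  · have := hW hV
    have hww : ¬ A.graph.Adj w (A.σ w) := fun h => (hA _ _ h).2 rfl
    refine hs.sparse_of_ne hι hu hP hQ hww (v₁ := v₁) (v₂ := v₂) (fun q hq hq' => ?_)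
      (fun _ q hq hq' => ?_)
    · have : q ∈ P ∩ Q := ⟨hs.mem_of_adj hι hww (fun _ => hPσ) (hQ hq) hq', hq⟩
      rw [hPQ'] at this
      simpa using this
    · have : q ∈ P ∩ Q := ⟨hQQ ⟨hq, A.σ q, hq', A.invol q⟩, hq⟩
      rw [hPQ'] at this
      simpa using this

end CsGraph

/-! ### The substitution moves preserve tightness -/

theorem ncard_edgesWithin_le_choose {V : Type*} [Finite V] {E : Set (Sym2 V)}
    (hl : ∀ v, s(v, v) ∉ E) (X : Set V) : (edgesWithin E X).ncard ≤ X.ncard.choose 2 := by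
  induction X, X.toFinite using Set.Finite.induction_on with
  | empty =>
    have : edgesWithin E ∅ = ∅ := by
      ext e
      induction e using Sym2.ind with | _ a b => simp
    simp [this]
  | @insert v X hv _ ih =>
    rw [ncard_edgesWithin_insert hv (hl v), ncard_insert_of_notMem hv, Nat.choose_succ_succ' _ 1,
      Nat.choose_one_right, add_comm]
    exact Nat.add_le_add (ncard_le_ncard fun x hx => hx.1) ih

/-- For 1 ≤ n ≤ 4 one has n(n − 1)/2 ≤ 2n − 2, with equality at 1 and at 4. Thus sparsity of a set
with at most four vertices needs no information about its edges. -/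
theorem ncard_edgesWithin_add_two_le {V : Type*} [Finite V] {E : Set (Sym2 V)}
    (hl : ∀ v, s(v, v) ∉ E) {X : Set V} (hX : X.Nonempty) (h4 : X.ncard ≤ 4) :
    (edgesWithin E X).ncard + 2 ≤ 2 * X.ncard := by
  have h1 := ncard_edgesWithin_le_choose hl X
  have h2 := (ncard_pos).2 hX
  generalize X.ncard = n at *
  interval_cases n <;> simp only [Nat.choose] at h1 <;> omega

namespace CsGraph

variable {U V W : Type u}

theorem ncard_pairs {α : Type*} (K : Set α) (hK : K.Finite) :
    {e | ∃ p ∈ K, ∃ q ∈ K, p ≠ q ∧ e = s(p, q)}.ncard = K.ncard.choose 2 := by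
  classical
  have := Sym2.card_image_offDiag hK.toFinset
  rw [ncard_eq_toFinset_card K hK, ← this, ← ncard_coe_finset]
  congr 1
  ext e
  simp only [mem_ofPred_eq, Finset.coe_image, mem_image, Finset.mem_coe, Finset.mem_offDiag,
    Finite.mem_toFinset, Prod.exists]
  constructor
  · rintro ⟨p, hp, q, hq, hpq, rfl⟩
    exact ⟨p, q, ⟨hp, hq, hpq⟩, rfl⟩
  · rintro ⟨p, q, ⟨hp, hq, hpq⟩, rfl⟩
    exact ⟨p, hp, q, hq, hpq, rfl⟩

theorem VertexToK4.preserves {A : CsGraph V} {B : CsGraph W} (h : A.VertexToK4 B) :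
    Preserves A B := by
  classical
  obtain ⟨ι, w, a, b, c, d, hw, hnd, hι, hd, hE⟩ := h
  set N : Set W := {a, b, c, B.σ a, B.σ b, B.σ c} with hN
  set K : Set W := {ι w, a, b, c} with hK
  have hW : Finite V → Finite W := fun _ => hι.finite (by simp [hN])
  have hNσ : ∀ v ∈ N, B.σ v ∈ N := by
    rintro v (rfl | rfl | rfl | rfl | rfl | rfl) <;> simp [hN, B.invol]
  have hna : ∀ x, ι x ≠ a := fun x => hι.ne x (by simp [hN])
  have hnb : ∀ x, ι x ≠ b := fun x => hι.ne x (by simp [hN])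
  have hnc : ∀ x, ι x ≠ c := fun x => hι.ne x (by simp [hN])
  have hna' : ∀ x, ι x ≠ B.σ a := fun x => hι.ne x (by simp [hN])
  have hnb' : ∀ x, ι x ≠ B.σ b := fun x => hι.ne x (by simp [hN])
  have hnc' : ∀ x, ι x ≠ B.σ c := fun x => hι.ne x (by simp [hN])
  have hσι := hι.2.1
  have hinj := hι.1
  have hww' : ι (A.σ w) ≠ ι w := hinj.ne hw
  have hKσ : ∀ p ∈ K, B.σ p ∉ K := by
    have h1 := hσι w
    have h2 := hna (A.σ w)
    have h3 := hnb (A.σ w)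
    have h4 := hnc (A.σ w)
    have h5 := hna' w
    have h6 := hnb' w
    have h7 := hnc' w
    simp only [hK, mem_insert_iff, mem_singleton_iff]
    simp only [List.nodup_cons, List.mem_cons, List.not_mem_nil, or_false, not_or] at hnd
    rintro p (rfl | rfl | rfl | rfl) <;> grind
  have hKι : ∀ x, x ≠ w → ι x ∉ K := by
    intro x hx
    simp [hK, hna, hnb, hnc, hinj.eq_iff, hx]
  have hKN : ∀ p ∈ N, p ∉ K → B.σ p ∈ K := by
    simp only [hK, hN, mem_insert_iff, mem_singleton_iff]
    rintro p (rfl | rfl | rfl | rfl | rfl | rfl) <;> simp [B.invol]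
  have hadj : ∀ p q, B.graph.Adj p q ↔ s(p, q) ∈ Sym2.map ι '' A.edgesAvoiding w ∨
      (∃ x, A.graph.Adj w x ∧ (s(p, q) = s(d x, ι x) ∨ s(p, q) = s(B.σ (d x), ι (A.σ x)))) ∨
      (p ≠ q ∧ (p ∈ K ∧ q ∈ K ∨ B.σ p ∈ K ∧ B.σ q ∈ K)) := by
    intro p q
    rw [← SimpleGraph.mem_edgeSet, hE, mem_union, mem_union, or_assoc]
    refine or_congr_right (or_congr_right ?_)
    constructor
    · rintro ⟨r, hr, t, ht, hrt, h | h⟩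
      · rcases Sym2.eq_iff.1 h with ⟨rfl, rfl⟩ | ⟨rfl, rfl⟩
        exacts [⟨hrt, Or.inl ⟨hr, ht⟩⟩, ⟨hrt.symm, Or.inl ⟨ht, hr⟩⟩]
      · rcases Sym2.eq_iff.1 h with ⟨rfl, rfl⟩ | ⟨rfl, rfl⟩ <;> simp only [B.invol]
        exacts [⟨B.σ_injective.ne hrt, Or.inr ⟨hr, ht⟩⟩,
          ⟨B.σ_injective.ne hrt.symm, Or.inr ⟨ht, hr⟩⟩]
    · rintro ⟨hpq, h | h⟩
      · exact ⟨p, h.1, q, h.2, hpq, Or.inl rfl⟩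
      · exact ⟨_, h.1, _, h.2, B.σ_injective.ne hpq, Or.inr (by simp only [B.invol])⟩
  refine ⟨hW, fun hV hA => ?_, fun hA => ?_, fun hV hA hsp => ?_⟩
  · have := hW hV
    have hww : ¬ A.graph.Adj w (A.σ w) := fun h => (hA _ _ h).2 rfl
    have hK4 : K.ncard = 4 := by
      have := hna w
      have := hnb w
      have := hnc w
      simp only [List.nodup_cons, List.mem_cons, List.not_mem_nil, or_false, not_or] at hnd
      rw [ncard_eq_four]
      exact ⟨_, _, _, _, by grind, by grind, by grind, by grind, by grind, by grind, hK⟩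
    have hN6 : N.ncard = 6 := by
      have h1 : N = ((([a, b, c, B.σ a, B.σ b, B.σ c] : List W).toFinset : Finset W) : Set W) := by
        simp [hN]
      rw [h1, ncard_coe_finset, List.toFinset_card_of_nodup hnd]
      rfl
    have h2 : {e | ∃ x, A.graph.Adj w x ∧
        (e = s(d x, ι x) ∨ e = s(B.σ (d x), ι (A.σ x)))}.ncard =
        2 * (A.graph.neighborSet w).ncard := by
      refine ncard_star_pair (Q := A.graph.neighborSet w) (f := d) (f' := fun x => B.σ (d x))
        (g := ι) (g' := fun x => ι (A.σ x)) hinj.injOn (hinj.comp A.σ_injective).injOn ?_ ?_ ?_ ?_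
      · intro x hx y hy h
        exact hKι y (hy : A.graph.Adj w y).ne' (h ▸ hd x hx)
      · intro x hx y hy h
        rw [hσι] at h
        exact hKι y (hy : A.graph.Adj w y).ne' (B.σ_injective h ▸ hd x hx)
      · intro x hx y hy h
        exact hKσ _ (hd y hy) (h ▸ hd x hx)
      · intro x hx y hy h
        refine hKι (A.σ y) (fun h => hww ?_) (h ▸ hd x hx)
        have hy' : y = A.σ w := by rw [← h, A.invol]
        exact hy' ▸ hy
    have h3 : {e | ∃ p ∈ K, ∃ q ∈ K, p ≠ q ∧ (e = s(p, q) ∨ e = s(B.σ p, B.σ q))}.ncard = 12 := by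
      have h4 : {e | ∃ p ∈ K, ∃ q ∈ K, p ≠ q ∧ (e = s(p, q) ∨ e = s(B.σ p, B.σ q))} =
          {e | ∃ p ∈ K, ∃ q ∈ K, p ≠ q ∧ e = s(p, q)} ∪
          Sym2.map B.σ '' {e | ∃ p ∈ K, ∃ q ∈ K, p ≠ q ∧ e = s(p, q)} := by
        ext e
        constructor
        · rintro ⟨p, hp, q, hq, hpq, rfl | rfl⟩
          exacts [Or.inl ⟨p, hp, q, hq, hpq, rfl⟩, Or.inr ⟨_, ⟨p, hp, q, hq, hpq, rfl⟩, rfl⟩]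
        · rintro (⟨p, hp, q, hq, hpq, rfl⟩ | ⟨_, ⟨p, hp, q, hq, hpq, rfl⟩, rfl⟩)
          exacts [⟨p, hp, q, hq, hpq, Or.inl rfl⟩, ⟨p, hp, q, hq, hpq, Or.inr rfl⟩]
      rw [h4, ncard_union_eq, ncard_image_of_injective _ (Sym2.map.injective B.σ_injective),
        ncard_pairs _ (toFinite _), hK4]
      · rfl
      · rw [Set.disjoint_left]
        rintro _ ⟨p, hp, q, hq, hpq, rfl⟩ ⟨_, ⟨p', hp', q', hq', hpq', rfl⟩, h⟩
        rcases Sym2.eq_iff.1 h with h | h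
        · exact hKσ _ hp' (h.1 ▸ hp)
        · exact hKσ _ hp' (h.1 ▸ hq)
    rw [hE, ncard_union_eq, ncard_union_eq, h2, h3,
      ncard_image_of_injective _ (Sym2.map.injective hinj), hι.card, hN6,
      ncard_edgeSet_of_not_fixed hw hA]
    · omega
    · rw [Set.disjoint_left]
      rintro _ ⟨e, he, rfl⟩ ⟨x, hx, h⟩
      induction e using Sym2.ind with | _ p q => ?_
      rw [mem_edgesAvoiding] at he
      obtain ⟨he, hp, hq, hp', hq'⟩ := he
      rcases h with h | h
      · rcases Sym2.eq_iff.1 h with h | h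
        · exact hKι p hp (h.1 ▸ hd x hx)
        · exact hKι q hq (h.2 ▸ hd x hx)
      · rcases Sym2.eq_iff.1 h with h | h
        · refine hKι (A.σ p) (fun h => hp' (by rw [← h, A.invol])) ?_
          rw [hσι, h.1, B.invol]; exact hd x hx
        · refine hKι (A.σ q) (fun h => hq' (by rw [← h, A.invol])) ?_
          rw [hσι, h.2, B.invol]; exact hd x hx
    · rw [Set.disjoint_left]
      have hout : ∀ x, x ≠ w → x ≠ A.σ w → ι x ∉ K ∧ B.σ (ι x) ∉ K := by
        intro x hx hx'
        refine ⟨hKι x hx, ?_⟩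
        rw [← hσι]
        exact hKι _ fun h => hx' (by rw [← h, A.invol])
      have key : ∀ e, (∃ p ∈ K, ∃ q ∈ K, p ≠ q ∧ (e = s(p, q) ∨ e = s(B.σ p, B.σ q))) →
          ∀ x, ι x ∈ e → x = w ∨ x = A.σ w := by
        rintro e ⟨p, hp, q, hq, hpq, h⟩ x hx
        by_contra! hcon
        have := hout x hcon.1 hcon.2
        rcases h with rfl | rfl
        · rcases Sym2.mem_iff.1 hx with h | h <;> rw [h] at this
          exacts [this.1 hp, this.1 hq]
        · rcases Sym2.mem_iff.1 hx with h | h <;> rw [h, B.invol] at this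
          exacts [this.2 hp, this.2 hq]
      rintro e (⟨e, he, rfl⟩ | ⟨x, hx, h⟩) he'
      · induction e using Sym2.ind with | _ p q => ?_
        rw [mem_edgesAvoiding] at he
        rcases key _ he' p (by simp) with h | h
        exacts [he.2.1 h, he.2.2.2.1 h]
      · have h1 : x ≠ w := hx.ne'
        have h2 : x ≠ A.σ w := fun h => hww (h ▸ hx)
        rcases h with rfl | rfl
        · rcases key _ he' x (by simp) with h | h
          exacts [h1 h, h2 h]
        · rcases key _ he' (A.σ x) (by simp) with h | h
          · exact h2 (by rw [← h, A.invol])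
          · exact h1 (A.σ_injective h)
  · have hww : ¬ A.graph.Adj w (A.σ w) := fun h => (hA _ _ h).2 rfl
    have hdN : ∀ x, A.graph.Adj w x → ∀ y, d x = ι y → y = w := by
      intro x hx y h
      by_contra hy
      exact hKι y hy (h ▸ hd x hx)
    have hnf : ∀ v ∈ N, B.σ v ≠ v := by
      intro v hv h
      by_cases h' : v ∈ K
      · exact hKσ v h' (h.symm ▸ h')
      · exact h' (h ▸ hKN v hv h')
    refine noFixedEdge_of_extension hA hι hNσ ?_ (fun x v hv _ h => hnf v hv h.1) ?_
    · intro x y h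
      rw [hadj, mk_mem_map_image hinj, mem_edgesAvoiding] at h
      rcases h with h | ⟨z, hz, h | h⟩ | ⟨hne, h | h⟩
      · exact h.1
      · rcases Sym2.eq_iff.1 h with h | h
        · rw [hdN z hz x h.1.symm, hinj h.2]; exact hz
        · rw [hdN z hz y h.2.symm, hinj h.1]; exact hz.symm
      · have h' : ∀ t, ι t = B.σ (d z) → t = A.σ w := by
          intro t ht
          rw [← hdN z hz (A.σ t) (by rw [hσι, ht, B.invol]), A.invol]
        rcases Sym2.eq_iff.1 h with h | h
        · rw [h' x h.1, hinj h.2]; exact A.adj_σ _ _ hz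
        · rw [h' y h.2, hinj h.1]; exact (A.adj_σ _ _ hz).symm
      · exfalso
        apply hne
        have h1 : x = w := by by_contra hx; exact hKι x hx h.1
        have h2 : y = w := by by_contra hx; exact hKι y hx h.2
        rw [h1, h2]
      · exfalso
        apply hne
        rw [← hσι, ← hσι] at h
        have h1 : A.σ x = w := by by_contra hx; exact hKι _ hx h.1
        have h2 : A.σ y = w := by by_contra hx; exact hKι _ hx h.2
        rw [A.σ_injective (h1.trans h2.symm)]
    · intro v hv v' hv' h
      refine ⟨hnf v hv, fun hvv => ?_⟩
      subst hvv
      rw [hadj] at h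
      rcases h with h | ⟨z, hz, h | h⟩ | ⟨hne, h | h⟩
      · exact hι.notMem_of_mem_image h hv (by simp)
      · rcases Sym2.eq_iff.1 h with h | h
        · exact hι.ne _ hv' h.2.symm
        · exact hι.ne _ hv h.1.symm
      · rcases Sym2.eq_iff.1 h with h | h
        · exact hι.ne _ hv' h.2.symm
        · exact hι.ne _ hv h.1.symm
      · exact hKσ v h.1 h.2
      · rw [B.invol] at h
        exact hKσ _ h.2 h.1
  · have := hW hV
    have hww : ¬ A.graph.Adj w (A.σ w) := fun h => (hA _ _ h).2 rfl
    -- Collapse each new `K₄` to the vertex it replaces. All fibres have at most four vertices, so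
    -- they satisfy the fibre bound automatically.
    let π : W → V := Function.extend ι id (fun p => if p ∈ K then w else A.σ w)
    have hπι : ∀ x, π (ι x) = x := fun x => hinj.extend_apply _ _ x
    have hπN : ∀ p ∈ N, π p = if p ∈ K then w else A.σ w := by
      intro p hp
      exact Function.extend_apply' _ _ _ fun ⟨x, hx⟩ => hι.ne x hp hx
    have hπK : ∀ p ∈ K, π p = w := by
      intro p hp
      rcases hι.eq_or_mem p with ⟨x, rfl⟩ | hpN
      · rw [hπι]; by_contra hx; exact hKι x hx hp
      · rw [hπN p hpN, if_pos hp]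
    have hπσ : ∀ p, π (B.σ p) = A.σ (π p) := by
      intro p
      rcases hι.eq_or_mem p with ⟨x, rfl⟩ | hpN
      · rw [← hσι, hπι, hπι]
      · rw [hπN p hpN, hπN _ (hNσ p hpN)]
        by_cases hp : p ∈ K
        · rw [if_pos hp, if_neg (hKσ p hp)]
        · rw [if_neg hp, if_pos (hKN p hpN hp), A.invol]
    have hfib : ∀ x, (π ⁻¹' {x}).ncard ≤ 4 := by
      have h1 : π ⁻¹' {w} ⊆ K := by
        intro p hp
        rcases hι.eq_or_mem p with ⟨x, rfl⟩ | hpN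
        · rw [mem_preimage, hπι] at hp
          rw [hp]; simp [hK]
        · by_contra hpK
          rw [mem_preimage, hπN p hpN, if_neg hpK] at hp
          exact hw hp
      have h4 : K.ncard ≤ 4 := by
        rw [hK]
        refine (ncard_insert_le _ _).trans ?_
        have := ncard_insert_le a {b, c}
        have := ncard_insert_le b {c}
        rw [ncard_singleton] at this
        omega
      have h2 : (π ⁻¹' {w}).ncard ≤ 4 := (ncard_le_ncard h1).trans h4
      intro x
      by_cases hx : x = w
      · rwa [hx]
      by_cases hx' : x = A.σ w
      · refine le_trans ?_ h2
        rw [← ncard_image_of_injective _ B.σ_injective]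
        refine ncard_le_ncard ?_
        rintro _ ⟨p, hp, rfl⟩
        have hp : π p = x := hp
        change π (B.σ p) = w
        rw [hπσ, hp, hx', A.invol]
      · have h3 : π ⁻¹' {x} ⊆ {ι x} := by
          intro p hp
          have hp : π p = x := hp
          rcases hι.eq_or_mem p with ⟨y, rfl⟩ | hpN
          · rw [hπι] at hp; rw [hp]; rfl
          · rw [hπN p hpN] at hp; grind
        have := ncard_le_ncard h3
        rw [ncard_singleton] at this
        omega
    -- The end above x of an edge lying above xy. It depends only on x and y, which gives the
    -- injectivity on edges between different fibres.
    let lift : V → V → W := fun x y =>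
      if x = w then d y else if x = A.σ w then B.σ (d (A.σ y)) else ι x
    have key : ∀ p q, B.graph.Adj p q → π p ≠ π q →
        A.graph.Adj (π p) (π q) ∧ p = lift (π p) (π q) := by
      intro p q hpq hne
      have hl1 : ∀ x, A.graph.Adj w x → lift w x = d x := fun x _ => if_pos rfl
      have hl2 : ∀ x, A.graph.Adj w x → lift x w = ι x := by
        intro x hx
        have : x ≠ A.σ w := fun h => hww (h ▸ hx)
        simp [lift, hx.ne', this]
      have hl3 : ∀ x, A.graph.Adj w x → lift (A.σ w) (A.σ x) = B.σ (d x) := by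
        intro x hx
        simp [lift, hw, A.invol]
      have hl4 : ∀ x, A.graph.Adj w x → lift (A.σ x) (A.σ w) = ι (A.σ x) := by
        intro x hx
        have h1 : A.σ x ≠ A.σ w := A.σ_injective.ne hx.ne'
        have h2 : A.σ x ≠ w := fun h => hww ((by rw [← h, A.invol] : x = A.σ w) ▸ hx)
        simp [lift, h1, h2]
      rw [hadj] at hpq
      rcases hpq with ⟨e, he, h⟩ | ⟨x, hx, h | h⟩ | ⟨-, h | h⟩
      · induction e using Sym2.ind with | _ x y => ?_
        rw [mem_edgesAvoiding] at he
        obtain ⟨h1, h2, h3, h4, h5⟩ := he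
        rcases Sym2.eq_iff.1 h with ⟨rfl, rfl⟩ | ⟨rfl, rfl⟩
        · simp only [hπι, lift, h2, h4, if_false]; exact ⟨h1, trivial⟩
        · simp only [hπι, lift, h3, h5, if_false]; exact ⟨h1.symm, trivial⟩
      · rcases Sym2.eq_iff.1 h with ⟨rfl, rfl⟩ | ⟨rfl, rfl⟩
        · rw [hπι, hπK _ (hd x hx), hl1 x hx]; exact ⟨hx, rfl⟩
        · rw [hπι, hπK _ (hd x hx), hl2 x hx]; exact ⟨hx.symm, rfl⟩
      · rcases Sym2.eq_iff.1 h with ⟨rfl, rfl⟩ | ⟨rfl, rfl⟩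
        · rw [hπι, hπσ, hπK _ (hd x hx), hl3 x hx]; exact ⟨A.adj_σ _ _ hx, rfl⟩
        · rw [hπι, hπσ, hπK _ (hd x hx), hl4 x hx]; exact ⟨(A.adj_σ _ _ hx).symm, rfl⟩
      · exact (hne (by rw [hπK _ h.1, hπK _ h.2])).elim
      · refine (hne (A.σ_injective ?_)).elim
        rw [← hπσ, ← hπσ, hπK _ h.1, hπK _ h.2]
    refine hsp.of_fibers π ?_ ?_ ?_
    · intro x X hX hne
      exact ncard_edgesWithin_add_two_le (by simp) hne ((ncard_le_ncard hX).trans (hfib x))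
    · exact fun p q hpq hne => (key p q hpq hne).1
    · intro p q p' q' h h' hne h1 h2
      have k1 := (key p q h hne).2
      have k2 := (key q p h.symm hne.symm).2
      have k3 := (key p' q' h' (by rwa [← h1, ← h2])).2
      have k4 := (key q' p' h'.symm (by rw [← h1, ← h2]; exact hne.symm)).2
      exact ⟨k1.trans (by rw [h1, h2, ← k3]), k2.trans (by rw [h1, h2, ← k4])⟩

theorem VertexToTight.preserves {A : CsGraph V} {B : CsGraph W} (h : A.VertexToTight B) :
    Preserves A B := by
  classical
  obtain ⟨U, H, w, κ, ι, y, hH, hw, hκ, hι, hισ, hy, hE⟩ := h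
  have hUfin := hH.1.finite
  rw [isTight_iff] at hH
  have hW : Finite V → Finite W := fun _ => hκ.finite (toFinite _)
  have hκι : ∀ u x, x ≠ w → κ u ≠ ι x := fun u x hx => hκ.ne u ⟨x, hx, rfl⟩
  have hcov : ∀ p, (∃ u, p = κ u) ∨ ∃ x, x ≠ w ∧ p = ι x := by
    intro p
    rcases hκ.eq_or_mem p with h | ⟨x, hx, rfl⟩
    exacts [Or.inl h, Or.inr ⟨x, hx, rfl⟩]
  have hadj : ∀ p q, B.graph.Adj p q ↔ s(p, q) ∈ Sym2.map κ '' H.graph.edgeSet ∨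
      s(p, q) ∈ Sym2.map ι '' A.edgesAvoiding w ∨
      ∃ x, A.graph.Adj w x ∧ s(p, q) = s(κ (y x), ι x) := by
    intro p q
    rw [← SimpleGraph.mem_edgeSet, hE, mem_union, mem_union, or_assoc]; rfl
  refine ⟨hW, fun hV hA => ?_, fun hA => ?_, fun hV hA hsp => ?_⟩
  · have := hW hV
    have h1 : {e | ∃ x, A.graph.Adj w x ∧ e = s(κ (y x), ι x)} =
        (fun x => s(κ (y x), ι x)) '' A.graph.neighborSet w := by
      ext e
      simp only [mem_ofPred_eq, mem_image, SimpleGraph.mem_neighborSet, eq_comm (a := e)]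
    have hN : A.graph.neighborSet w ⊆ {w}ᶜ := fun x hx => (hx : A.graph.Adj w x).ne'
    have h2 : InjOn (Sym2.map ι) (A.edgesAvoiding w) := by
      intro e he e' he' h
      induction e using Sym2.ind with | _ a b => ?_
      induction e' using Sym2.ind with | _ a' b' => ?_
      rw [mem_edgesAvoiding] at he he'
      rcases Sym2.eq_iff.1 h with h | h
      · rw [hι he.2.1 he'.2.1 h.1, hι he.2.2.1 he'.2.2.1 h.2]
      · rw [hι he.2.1 he'.2.2.1 h.1, hι he.2.2.1 he'.2.1 h.2, Sym2.eq_swap]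
    rw [hE, ncard_union_eq, ncard_union_eq, h1, (injOn_mk (hι.mono hN) ?_).ncard_image,
      h2.ncard_image, ncard_image_of_injective _ (Sym2.map.injective hκ.1), hκ.card,
      hι.ncard_image, ncard_edgeSet_of_fixed hw]
    · have := ncard_add_ncard_compl {w}
      rw [ncard_singleton] at this
      have := hH.2.2
      omega
    · exact fun x _ z hz => hκι _ z (hN hz)
    · rw [Set.disjoint_left]
      rintro _ h ⟨e, he, rfl⟩
      induction e using Sym2.ind with | _ a b => ?_
      rw [mem_edgesAvoiding] at he
      exact hκ.notMem_of_mem_image h ⟨a, he.2.1, rfl⟩ (by simp)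
    · rw [Set.disjoint_left]
      rintro e (h | ⟨e, he, rfl⟩) ⟨x, hx, h'⟩
      · subst h'
        exact hκ.notMem_of_mem_image h ⟨x, hx.ne', rfl⟩ (by simp)
      · induction e using Sym2.ind with | _ a b => ?_
        rw [mem_edgesAvoiding] at he
        rcases Sym2.eq_iff.1 h' with h | h
        · exact hκι _ _ he.2.1 h.1.symm
        · exact hκι _ _ he.2.2.1 h.2.symm
  · intro p q h
    have hι1 : ∀ x, x ≠ w → A.σ x ≠ w := fun x hx h => hx (by rw [← A.invol x, h, hw])
    rw [hadj] at h
    have hH' : ∀ a b, H.graph.Adj a b → ¬ (B.σ (κ a) = κ a ∧ B.σ (κ b) = κ b) ∧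
        B.σ (κ a) ≠ κ b := by
      intro a b h
      rw [← hκ.2.1, ← hκ.2.1, hκ.1.eq_iff, hκ.1.eq_iff, hκ.1.ne_iff]
      exact hH.2.1 a b h
    have hA' : ∀ a b, A.graph.Adj a b → a ≠ w → b ≠ w →
        ¬ (B.σ (ι a) = ι a ∧ B.σ (ι b) = ι b) ∧ B.σ (ι a) ≠ ι b := by
      intro a b h ha hb
      rw [← hισ a ha, ← hισ b hb, hι.eq_iff (hι1 a ha) ha, hι.eq_iff (hι1 b hb) hb, Ne,
        hι.eq_iff (hι1 a ha) hb]
      exact hA a b h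
    rcases h with ⟨e, he, h⟩ | ⟨e, he, h⟩ | ⟨x, hx, h⟩
    · induction e using Sym2.ind with | _ a b => ?_
      rcases Sym2.eq_iff.1 h with ⟨rfl, rfl⟩ | ⟨rfl, rfl⟩
      exacts [hH' a b he, hH' b a he.symm]
    · induction e using Sym2.ind with | _ a b => ?_
      rw [mem_edgesAvoiding] at he
      rcases Sym2.eq_iff.1 h with ⟨rfl, rfl⟩ | ⟨rfl, rfl⟩
      exacts [hA' a b he.1 he.2.1 he.2.2.1, hA' b a he.1.symm he.2.2.1 he.2.1]
    · have hxw := hx.ne'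
      have h1 : ¬ (B.σ (ι x) = ι x) := by
        rw [← hισ x hxw, hι.eq_iff (hι1 x hxw) hxw]
        exact fun h => (hA _ _ hx).1 ⟨hw, h⟩
      rcases Sym2.eq_iff.1 h with ⟨rfl, rfl⟩ | ⟨rfl, rfl⟩
      · refine ⟨fun h => h1 h.2, ?_⟩
        rw [← hκ.2.1]
        exact hκι _ _ hxw
      · refine ⟨fun h => h1 h.1, ?_⟩
        rw [← hισ x hxw]
        exact (hκι _ _ (hι1 x hxw)).symm
  · have := hW hV
    have : Nonempty V := ⟨w⟩
    -- The copy of H goes to w; elsewhere ι is inverted on the complement of w, its value at w being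
    -- arbitrary.
    let π : W → V := fun p => if p ∈ range κ then w else Function.invFunOn ι {w}ᶜ p
    have hπκ : ∀ u, π (κ u) = w := fun u => if_pos ⟨u, rfl⟩
    have hπι : ∀ x, x ≠ w → π (ι x) = x := by
      intro x hx
      have h1 : ι x ∉ range κ := fun ⟨u, hu⟩ => hκι u x hx hu
      have h2 : ∃ z ∈ ({w}ᶜ : Set V), ι z = ι x := ⟨x, hx, rfl⟩
      simp only [π, h1, if_false]
      exact hι (Function.invFunOn_mem h2) hx (Function.invFunOn_eq h2)
    let lift : V → V → W := fun x z => if x = w then κ (y z) else ι x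
    have key : ∀ p q, B.graph.Adj p q → π p ≠ π q →
        A.graph.Adj (π p) (π q) ∧ p = lift (π p) (π q) := by
      intro p q hpq hne
      rw [hadj] at hpq
      rcases hpq with ⟨e, he, h⟩ | ⟨e, he, h⟩ | ⟨x, hx, h⟩
      · induction e using Sym2.ind with | _ a b => ?_
        rcases Sym2.eq_iff.1 h with ⟨rfl, rfl⟩ | ⟨rfl, rfl⟩ <;> simp [hπκ] at hne
      · induction e using Sym2.ind with | _ a b => ?_
        rw [mem_edgesAvoiding] at he
        rcases Sym2.eq_iff.1 h with ⟨rfl, rfl⟩ | ⟨rfl, rfl⟩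
        · rw [hπι a he.2.1, hπι b he.2.2.1]; simp [lift, he]
        · rw [hπι a he.2.1, hπι b he.2.2.1]; simp [lift, he, he.1.symm]
      · rcases Sym2.eq_iff.1 h with ⟨rfl, rfl⟩ | ⟨rfl, rfl⟩
        · rw [hπκ, hπι x hx.ne']; simp [lift, hx]
        · rw [hπκ, hπι x hx.ne']; simp [lift, hx.symm, hx.ne']
    refine hsp.of_fibers π ?_ ?_ ?_
    · intro x X hX hne
      by_cases hx : x = w
      · subst hx
        refine (Nat.add_le_add_right (ncard_le_ncard ?_) 2).trans (hH.1.image hκ.1 X hne)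
        intro e he
        refine ⟨?_, he.2⟩
        induction e using Sym2.ind with | _ p q => ?_
        rw [mk_mem_edgesWithin] at he
        have hp : ∀ p ∈ X, ∃ u, p = κ u := by
          intro p hp
          rcases hcov p with h | ⟨z, hz, rfl⟩
          · exact h
          · have := hX hp
            rw [mem_preimage, hπι z hz] at this
            exact (hz this).elim
        obtain ⟨a, rfl⟩ := hp p he.2.1
        obtain ⟨b, rfl⟩ := hp q he.2.2
        have := (hadj _ _).1 he.1
        rcases this with h | ⟨e, he, h⟩ | ⟨x, hx, h⟩
        · exact h
        · induction e using Sym2.ind with | _ c d => ?_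
          rw [mem_edgesAvoiding] at he
          rcases Sym2.eq_iff.1 h with h | h
          · exact (hκι _ _ he.2.1 h.1.symm).elim
          · exact (hκι _ _ he.2.1 h.1.symm).elim
        · rcases Sym2.eq_iff.1 h with h | h
          · exact (hκι _ _ hx.ne' h.2).elim
          · exact (hκι _ _ hx.ne' h.1).elim
      · refine ncard_edgesWithin_add_two_le (by simp) hne ?_
        have h1 : X ⊆ {ι x} := by
          intro p hp
          have hp : π p = x := hX hp
          rcases hcov p with ⟨u, rfl⟩ | ⟨z, hz, rfl⟩
          · rw [hπκ] at hp; exact (hx hp.symm).elim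
          · rw [hπι z hz] at hp; rw [hp]; rfl
        have := ncard_le_ncard h1
        rw [ncard_singleton] at this
        omega
    · exact fun p q hpq hne => (key p q hpq hne).1
    · intro p q p' q' h h' hne h1 h2
      have k1 := (key p q h hne).2
      have k2 := (key q p h.symm hne.symm).2
      have k3 := (key p' q' h' (by rwa [← h1, ← h2])).2
      have k4 := (key q' p' h'.symm (by rw [← h1, ← h2]; exact hne.symm)).2
      exact ⟨k1.trans (by rw [h1, h2, ← k3]), k2.trans (by rw [h1, h2, ← k4])⟩

theorem Move.preserves {A : CsGraph V} {B : CsGraph W} (h : A.Move B) : Preserves A B := by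
  rcases h with h | h | h | h | h | h | h | h
  exacts [h.preserves, h.preserves, h.preserves, h.preserves, h.preserves, h.preserves,
    h.preserves, h.preserves]

end CsGraph

/-! ### Generated graphs are tight -/

namespace CsGraph

theorem Isomorphic.isTight {V : Type u} {W : Type v} {A : CsGraph V} {B : CsGraph W}
    (h : A.Isomorphic B) (hB : B.IsTight) : A.IsTight := by
  obtain ⟨f, hf⟩ := h
  have hW := hB.1.finite
  have hV : Finite V := Finite.of_injective f f.injective
  have hE : B.graph.edgeSet = Sym2.map f '' A.graph.edgeSet := by
    ext e
    induction e using Sym2.ind with | _ a b => ?_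
    obtain ⟨x, rfl⟩ := f.surjective a
    obtain ⟨y, rfl⟩ := f.surjective b
    rw [← Sym2.map_mk, (Sym2.map.injective f.injective).mem_set_image, Sym2.map_mk]
    exact f.map_adj_iff
  rw [isTight_iff] at hB ⊢
  refine ⟨(hE ▸ hB.1).of_image f.injective, fun a b hab => ?_, ?_⟩
  · have := hB.2.1 _ _ (f.map_adj_iff.2 hab)
    rwa [← hf, ← hf, f.injective.eq_iff, f.injective.eq_iff, f.injective.ne_iff] at this
  · have := hB.2.2
    rwa [hE, ncard_image_of_injective _ (Sym2.map.injective f.injective),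
      ← Nat.card_congr f.toEquiv] at this

theorem edgeSet_of_list {n : ℕ} {G : SimpleGraph (Fin n)} {L : List (Fin n × Fin n)}
    (hG : G = SimpleGraph.fromRel fun i j => (i, j) ∈ L) (hL : ∀ p ∈ L, p.1 ≠ p.2) :
    G.edgeSet = ((L.map fun p => s(p.1, p.2)).toFinset : Set (Sym2 (Fin n))) := by
  subst hG
  ext e
  induction e using Sym2.ind with | _ a b => ?_
  simp only [SimpleGraph.mem_edgeSet, SimpleGraph.fromRel_adj, List.coe_toFinset, List.mem_map,
    mem_ofPred_eq, Prod.exists]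
  constructor
  · rintro ⟨-, h | h⟩
    exacts [⟨a, b, h, rfl⟩, ⟨b, a, h, Sym2.eq_swap⟩]
  · rintro ⟨x, y, h, h'⟩
    have := hL _ h
    rcases Sym2.eq_iff.1 h' with ⟨rfl, rfl⟩ | ⟨rfl, rfl⟩
    exacts [⟨this, Or.inl h⟩, ⟨this.symm, Or.inr h⟩]

/-- This turns tightness into finite checks by evaluation. In `hsparse` entries of the list are
counted instead of edges, which can only overestimate. -/
theorem isTight_of_list {n : ℕ} {B : CsGraph (Fin n)} {L : List (Fin n × Fin n)}
    (hG : B.graph = SimpleGraph.fromRel fun i j => (i, j) ∈ L) (hL : ∀ p ∈ L, p.1 ≠ p.2)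
    (hfix : ∀ p ∈ L, Sym2.map B.σ s(p.1, p.2) ≠ s(p.1, p.2))
    (hcount : (L.map fun p => s(p.1, p.2)).toFinset.card + 2 = 2 * n)
    (hsparse : ∀ X : Finset (Fin n), X.Nonempty →
      (L.filter fun p => p.1 ∈ X ∧ p.2 ∈ X).length + 2 ≤ 2 * X.card) : B.IsTight := by
  classical
  have hE := edgeSet_of_list hG hL
  rw [isTight_iff, noFixedEdge_iff]
  refine ⟨fun X hX => ?_, ?_, ?_⟩
  · have h1 := hsparse X.toFinset (by simpa using hX)
    rw [← ncard_eq_toFinset_card'] at h1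
    refine le_trans (Nat.add_le_add_right ?_ 2) h1
    have h2 : edgesWithin B.graph.edgeSet X ⊆
        (((L.filter fun p => p.1 ∈ X.toFinset ∧ p.2 ∈ X.toFinset).map
          fun p => s(p.1, p.2)).toFinset : Set (Sym2 (Fin n))) := by
      intro e he
      rw [hE] at he
      obtain ⟨he, he'⟩ := he
      simp only [List.coe_toFinset, List.mem_map, mem_ofPred_eq] at he
      obtain ⟨p, hp, rfl⟩ := he
      simp only [List.coe_toFinset, List.mem_map, mem_ofPred_eq]
      exact ⟨p, by simp [hp, he' p.1, he' p.2], rfl⟩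
    have h3 := ncard_le_ncard h2
    rw [ncard_coe_finset] at h3
    exact h3.trans ((List.toFinset_card_le _).trans (by rw [List.length_map]))
  · intro e he
    rw [hE] at he
    simp only [List.coe_toFinset, List.mem_map, mem_ofPred_eq] at he
    obtain ⟨p, hp, rfl⟩ := he
    exact hfix p hp
  · rw [hE, ncard_coe_finset, hcount, Nat.card_eq_fintype_card, Fintype.card_fin]

theorem baseF2_isTight : baseF2.IsTight :=
  isTight_of_list rfl (by decide) (by decide) (by decide) (by decide +kernel)

theorem baseW5_isTight : baseW5.IsTight :=
  isTight_of_list rfl (by decide) (by decide) (by decide) (by decide +kernel)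

theorem baseWd42_isTight : baseWd42.IsTight :=
  isTight_of_list rfl (by decide) (by decide) (by decide) (by decide +kernel)

theorem baseF1_isTight : baseF1.IsTight :=
  isTight_of_list rfl (by decide) (by decide) (by decide) (by decide +kernel)

theorem baseF1'_isTight : baseF1'.IsTight :=
  isTight_of_list rfl (by decide) (by decide) (by decide) (by decide +kernel)

theorem baseK34_isTight : baseK34.IsTight :=
  isTight_of_list rfl (by decide) (by decide) (by decide) (by decide +kernel)

theorem IsBase.isTight {V : Type u} {A : CsGraph V} (h : A.IsBase) : A.IsTight := by
  rcases h with h | h | h | h | h | h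
  exacts [h.isTight baseF2_isTight, h.isTight baseW5_isTight, h.isTight baseWd42_isTight,
    h.isTight baseF1_isTight, h.isTight baseF1'_isTight, h.isTight baseK34_isTight]

theorem Generated.isTight {V : Type u} {A : CsGraph V} (h : A.Generated) : A.IsTight := by
  induction h with
  | base A h => exact h.isTight
  | step A B _ h ih => exact h.preserves.isTight ih

end CsGraph

/-! ### Tight sets in a tight graph -/

namespace CsGraph

variable {V : Type u}

/-- The vertex set `X` induces a `(2,2)`-tight subgraph. -/
def TightSet (A : CsGraph V) (X : Set V) : Prop :=
  (edgesWithin A.graph.edgeSet X).ncard + 2 = 2 * X.ncard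

theorem map_σ_image_edgeSet (A : CsGraph V) :
    Sym2.map A.σ '' A.graph.edgeSet = A.graph.edgeSet := by
  ext e
  induction e using Sym2.ind with | _ a b => ?_
  have : s(a, b) = s(A.σ (A.σ a), A.σ (A.σ b)) := by rw [A.invol, A.invol]
  rw [this, mk_mem_map_image A.σ_injective, SimpleGraph.mem_edgeSet, SimpleGraph.mem_edgeSet,
    A.adj_σ_iff, A.adj_σ_iff, A.adj_σ_iff]

theorem preimage_σ (A : CsGraph V) (X : Set V) : A.σ ⁻¹' X = A.σ '' X := by
  ext x
  exact ⟨fun h => ⟨_, h, A.invol x⟩, fun ⟨y, hy, h⟩ => by rw [mem_preimage, ← h, A.invol]; exact hy⟩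

theorem ncard_preimage_σ (A : CsGraph V) (X : Set V) : (A.σ ⁻¹' X).ncard = X.ncard := by
  rw [preimage_σ, ncard_image_of_injective _ A.σ_injective]

theorem ncard_edgesWithin_preimage_σ (A : CsGraph V) (X : Set V) :
    (edgesWithin A.graph.edgeSet (A.σ ⁻¹' X)).ncard = (edgesWithin A.graph.edgeSet X).ncard := by
  rw [preimage_σ]
  conv_lhs => rw [← A.map_σ_image_edgeSet]
  rw [edgesWithin_image A.σ_injective,
    ncard_image_of_injective _ (Sym2.map.injective A.σ_injective)]

theorem TightSet.preimage_σ {A : CsGraph V} {X : Set V} (h : A.TightSet X) :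
    A.TightSet (A.σ ⁻¹' X) := by
  rwa [TightSet, ncard_edgesWithin_preimage_σ, ncard_preimage_σ]

/-- The reflection acts on the edges inside an invariant set, and it has no fixed point there. -/
theorem even_ncard_edgesWithin [Finite V] {A : CsGraph V} (hA : A.NoFixedEdge) {X : Set V}
    (hX : ∀ x ∈ X, A.σ x ∈ X) : Even (edgesWithin A.graph.edgeSet X).ncard := by
  rw [noFixedEdge_iff] at hA
  refine even_ncard_of_involution (toFinite _) (Sym2.map A.σ) ?_ ?_ fun e he => hA e he.1
  · intro e he
    induction e using Sym2.ind with | _ a b => ?_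
    rw [mk_mem_edgesWithin] at he
    rw [Sym2.map_mk, mk_mem_edgesWithin]
    exact ⟨A.adj_σ _ _ he.1, hX _ he.2.1, hX _ he.2.2⟩
  · intro e _
    induction e using Sym2.ind with | _ a b => simp [A.invol]

/-- The reflection permutes the neighbours of a fixed vertex, and a fixed neighbour would give an
edge with both ends fixed. -/
theorem even_ncard_neighborSet [Finite V] {A : CsGraph V} (hA : A.NoFixedEdge) {v : V}
    (hv : A.σ v = v) : Even (A.graph.neighborSet v).ncard := by
  refine even_ncard_of_involution (toFinite _) A.σ ?_ (fun x _ => A.invol x) ?_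
  · intro x hx
    have := A.adj_σ _ _ hx
    rwa [hv] at this
  · exact fun x hx h => (hA _ _ hx).1 ⟨hv, h⟩

section TightSets

variable [Finite V] {A : CsGraph V}

theorem ncard_edgesWithin_insert_vertex {X : Set V} {v : V} (hv : v ∉ X) :
    (edgesWithin A.graph.edgeSet (insert v X)).ncard =
      (edgesWithin A.graph.edgeSet X).ncard + {x | x ∈ X ∧ A.graph.Adj v x}.ncard :=
  ncard_edgesWithin_insert hv (by simp)

/-- Deleting v from T lowers the bound by two; if fewer than two edges disappeared with it, the
remaining non-empty set would have too many. -/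
theorem TightSet.two_le_ncard {T : Set V} (hT : A.TightSet T)
    (hA : IsSparse A.graph.edgeSet) {v a : V} (hv : v ∈ T) (ha : a ∈ T)
    (hav : a ≠ v) : 2 ≤ {x | x ∈ T ∧ A.graph.Adj v x}.ncard := by
  have hv' : v ∉ T \ {v} := by simp
  have h1 := ncard_edgesWithin_insert_vertex (A := A) hv'
  rw [insert_sdiff_singleton, insert_eq_of_mem hv] at h1
  have h2 := hA (T \ {v}) ⟨a, ha, hav⟩
  have h3 := ncard_sdiff_singleton_add_one hv
  have h4 : {x | x ∈ T \ {v} ∧ A.graph.Adj v x}.ncard ≤ {x | x ∈ T ∧ A.graph.Adj v x}.ncard :=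
    ncard_le_ncard fun x hx => ⟨hx.1.1, hx.2⟩
  rw [TightSet] at hT
  omega

/-- T has no room left, so adding v raises the bound by two and permits only two further edges. -/
theorem TightSet.ncard_le_two {T : Set V} (hT : A.TightSet T)
    (hA : IsSparse A.graph.edgeSet) {v : V} (hv : v ∉ T) :
    {x | x ∈ T ∧ A.graph.Adj v x}.ncard ≤ 2 := by
  have h1 := ncard_edgesWithin_insert_vertex (A := A) hv
  have h2 := hA (insert v T) (insert_nonempty _ _)
  rw [ncard_insert_of_notMem hv] at h2
  rw [TightSet] at hT
  omega

theorem TightSet.insert {T : Set V} (hT : A.TightSet T)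
    (hA : IsSparse A.graph.edgeSet) {v a b : V} (hv : v ∉ T) (ha : a ∈ T)
    (hb : b ∈ T) (hab : a ≠ b) (hva : A.graph.Adj v a) (hvb : A.graph.Adj v b) :
    A.TightSet (insert v T) := by
  have h1 := ncard_edgesWithin_insert_vertex (A := A) hv
  have h2 := hA (Insert.insert v T) (insert_nonempty _ _)
  have h3 : ({a, b} : Set V) ⊆ {x | x ∈ T ∧ A.graph.Adj v x} := by
    rintro x (rfl | rfl)
    exacts [⟨ha, hva⟩, ⟨hb, hvb⟩]
  have h4 := ncard_le_ncard h3
  rw [ncard_pair hab] at h4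
  rw [ncard_insert_of_notMem hv] at h2
  rw [TightSet] at hT ⊢
  rw [ncard_insert_of_notMem hv]
  omega

theorem TightSet.not_three {T : Set V} (hT : A.TightSet T)
    (hA : IsSparse A.graph.edgeSet) {v a b c : V} (hv : v ∉ T) (ha : a ∈ T)
    (hb : b ∈ T) (hc : c ∈ T) (hab : a ≠ b) (hac : a ≠ c) (hbc : b ≠ c) (hva : A.graph.Adj v a)
    (hvb : A.graph.Adj v b) (hvc : A.graph.Adj v c) : False := by
  have h1 := hT.ncard_le_two hA hv
  have h2 : ({a, b, c} : Set V) ⊆ {x | x ∈ T ∧ A.graph.Adj v x} := by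
    rintro x (rfl | rfl | rfl)
    exacts [⟨ha, hva⟩, ⟨hb, hvb⟩, ⟨hc, hvc⟩]
  have h3 := ncard_le_ncard h2
  rw [ncard_eq_three.2 ⟨a, b, c, hab, hac, hbc, rfl⟩] at h3
  omega

theorem two_le_ncard_neighborSet (hA : IsSparse A.graph.edgeSet)
    (hE : A.graph.edgeSet.ncard + 2 = 2 * Nat.card V) [Nontrivial V]
    (v : V) : 2 ≤ (A.graph.neighborSet v).ncard := by
  obtain ⟨a, ha⟩ := exists_ne v
  have hT : A.TightSet univ := by rw [TightSet, edgesWithin_univ, ncard_univ]; exact hE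
  have := hT.two_le_ncard hA (mem_univ v) (mem_univ a) ha
  simpa [SimpleGraph.neighborSet] using this

end TightSets

/-- The degrees sum to 4|V| − 4, so the average degree is below four. -/
theorem exists_ncard_neighborSet_lt_four [Finite V] (A : CsGraph V)
    (hE : A.graph.edgeSet.ncard + 2 = 2 * Nat.card V) :
    ∃ v, (A.graph.neighborSet v).ncard < 4 := by
  classical
  have := Fintype.ofFinite V
  by_contra! hcon
  have h1 := A.graph.sum_degrees_eq_twice_card_edges
  have h2 : ∀ v, A.graph.degree v = (A.graph.neighborSet v).ncard := by
    intro v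
    rw [← SimpleGraph.card_neighborSet_eq_degree, ← Nat.card_eq_fintype_card]; rfl
  have h3 : ∑ _v : V, 4 ≤ ∑ v, A.graph.degree v :=
    Finset.sum_le_sum fun v _ => (h2 v).symm ▸ hcon v
  rw [Finset.sum_const, Finset.card_univ, smul_eq_mul, h1,
    SimpleGraph.edgeFinset_card, ← Nat.card_eq_fintype_card, ← Nat.card_eq_fintype_card] at h3
  change _ ≤ 2 * A.graph.edgeSet.ncard at h3
  omega

/-- A tight graph without vertices of degree two and without proper non-trivial tight subgraphs
that are invariant under the reflection. -/
structure Irreducible (A : CsGraph V) : Prop where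
  sparse : IsSparse A.graph.edgeSet
  noFixedEdge : A.NoFixedEdge
  count : A.graph.edgeSet.ncard + 2 = 2 * Nat.card V
  three_le : ∀ v, 3 ≤ (A.graph.neighborSet v).ncard
  eq_univ : ∀ X : Set V, (∀ x ∈ X, A.σ x ∈ X) → 2 ≤ X.ncard → A.TightSet X → X = univ

namespace Irreducible

variable [Finite V] {A : CsGraph V}

theorem isTight (h : A.Irreducible) : A.IsTight :=
  A.isTight_iff.2 ⟨h.sparse, h.noFixedEdge, h.count⟩

/-- A set with at most one degree of freedom that meets its mirror image in two vertices covers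
the graph together with its mirror image. -/
theorem mem_or_mem (h : A.Irreducible) {Y : Set V}
    (hY : 2 * Y.ncard ≤ (edgesWithin A.graph.edgeSet Y).ncard + 3) {a b : V} (hab : a ≠ b)
    (ha : a ∈ Y) (ha' : A.σ a ∈ Y) (hb : b ∈ Y) (hb' : A.σ b ∈ Y) (v : V) :
    v ∈ Y ∨ A.σ v ∈ Y := by
  have h1 := ncard_edgesWithin_add_le A.graph.edgeSet Y (A.σ ⁻¹' Y)
  have h2 := ncard_union_add_ncard_inter Y (A.σ ⁻¹' Y)
  rw [ncard_edgesWithin_preimage_σ] at h1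
  rw [ncard_preimage_σ] at h2
  have hi : ∀ x ∈ Y ∩ A.σ ⁻¹' Y, A.σ x ∈ Y ∩ A.σ ⁻¹' Y := by
    rintro x ⟨hx, hx'⟩
    exact ⟨hx', by rw [mem_preimage, A.invol]; exact hx⟩
  have hu : ∀ x ∈ Y ∪ A.σ ⁻¹' Y, A.σ x ∈ Y ∪ A.σ ⁻¹' Y := by
    rintro x (hx | hx)
    exacts [Or.inr (by rw [mem_preimage, A.invol]; exact hx), Or.inl hx]
  have hsub : ({a, b} : Set V) ⊆ Y ∩ A.σ ⁻¹' Y := by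
    rintro x (rfl | rfl)
    exacts [⟨ha, ha'⟩, ⟨hb, hb'⟩]
  have h2i := ncard_le_ncard hsub
  rw [ncard_pair hab] at h2i
  have h2u : 2 ≤ (Y ∪ A.σ ⁻¹' Y).ncard :=
    h2i.trans (ncard_le_ncard (inter_subset_left.trans subset_union_left))
  -- The deficiencies of Y ∩ σ Y and Y ∪ σ Y add up to at most twice that of Y, hence to at most 2.
  -- Both are even because the sets are invariant, so one of them is 0.
  obtain ⟨k, hk⟩ := even_ncard_edgesWithin h.noFixedEdge hi
  obtain ⟨l, hl⟩ := even_ncard_edgesWithin h.noFixedEdge hu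
  have h5 := h.sparse (Y ∩ A.σ ⁻¹' Y) ⟨a, ha, ha'⟩
  have h6 := h.sparse (Y ∪ A.σ ⁻¹' Y) ⟨a, Or.inl ha⟩
  by_cases ht : A.TightSet (Y ∩ A.σ ⁻¹' Y)
  · have := h.eq_univ _ hi h2i ht
    exact Or.inl ((this.symm ▸ mem_univ v : v ∈ Y ∩ A.σ ⁻¹' Y)).1
  · have : A.TightSet (Y ∪ A.σ ⁻¹' Y) := by
      rw [TightSet] at ht ⊢
      omega
    have := h.eq_univ _ hu h2u this
    exact (this.symm ▸ mem_univ v : v ∈ Y ∪ A.σ ⁻¹' Y)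

/-- Y ∩ σ Y is tight and invariant and contains a and b, so it is already the whole vertex set. -/
theorem mem_of_tightSet (h : A.Irreducible) {Y : Set V} (hY : A.TightSet Y) {a b : V}
    (hab : a ≠ b) (ha : a ∈ Y) (ha' : A.σ a ∈ Y) (hb : b ∈ Y) (hb' : A.σ b ∈ Y) (v : V) :
    v ∈ Y := by
  have ht := (h.sparse.union_inter_tight hY hY.preimage_σ ⟨a, ha, ha'⟩).2
  have hi : ∀ x ∈ Y ∩ A.σ ⁻¹' Y, A.σ x ∈ Y ∩ A.σ ⁻¹' Y := by
    rintro x ⟨hx, hx'⟩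
    exact ⟨hx', by rw [mem_preimage, A.invol]; exact hx⟩
  have hsub : ({a, b} : Set V) ⊆ Y ∩ A.σ ⁻¹' Y := by
    rintro x (rfl | rfl)
    exacts [⟨ha, ha'⟩, ⟨hb, hb'⟩]
  have h2i := ncard_le_ncard hsub
  rw [ncard_pair hab] at h2i
  have := h.eq_univ _ hi h2i ht
  exact ((this.symm ▸ mem_univ v : v ∈ Y ∩ A.σ ⁻¹' Y)).1

/-- A tight set meeting its mirror image covers the graph together with its mirror image. -/
theorem mem_or_mem_of_tightSet (h : A.Irreducible) {Y : Set V} (hY : A.TightSet Y) {a b : V}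
    (hab : a ≠ b) (ha : a ∈ Y) (ha' : A.σ a ∈ Y) (hb : b ∈ Y) (v : V) :
    v ∈ Y ∨ A.σ v ∈ Y := by
  have ht := (h.sparse.union_inter_tight hY hY.preimage_σ ⟨a, ha, ha'⟩).1
  have hu : ∀ x ∈ Y ∪ A.σ ⁻¹' Y, A.σ x ∈ Y ∪ A.σ ⁻¹' Y := by
    rintro x (hx | hx)
    exacts [Or.inr (by rw [mem_preimage, A.invol]; exact hx), Or.inl hx]
  have hsub : ({a, b} : Set V) ⊆ Y ∪ A.σ ⁻¹' Y := by
    rintro x (rfl | rfl)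
    exacts [Or.inl ha, Or.inl hb]
  have h2i := ncard_le_ncard hsub
  rw [ncard_pair hab] at h2i
  have := h.eq_univ _ hu h2i ht
  exact (this.symm ▸ mem_univ v : v ∈ Y ∪ A.σ ⁻¹' Y)

/-- An injective equivariant homomorphism from a base graph with the right number of edges is an
isomorphism. -/
theorem isomorphic_of_hom (h : A.Irreducible) {n : ℕ} (hn : 2 ≤ n) {B : CsGraph (Fin n)}
    (hB : B.IsTight) (f : Fin n → V) (hf : Function.Injective f)
    (hσ : ∀ i, f (B.σ i) = A.σ (f i)) (hadj : ∀ i j, B.graph.Adj i j → A.graph.Adj (f i) (f j)) :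
    A.Isomorphic B := by
  have hB := hB.1.2
  rw [Nat.card_eq_fintype_card, Fintype.card_fin] at hB
  have hc : (range f).ncard = n := by
    rw [ncard_range_of_injective hf, Nat.card_eq_fintype_card, Fintype.card_fin]
  have hsub : Sym2.map f '' B.graph.edgeSet ⊆ edgesWithin A.graph.edgeSet (range f) := by
    rintro _ ⟨e, he, rfl⟩
    induction e using Sym2.ind with | _ i j => ?_
    rw [Sym2.map_mk, mk_mem_edgesWithin]
    exact ⟨hadj i j he, ⟨i, rfl⟩, ⟨j, rfl⟩⟩
  have h1 := ncard_le_ncard hsub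
  have h2 := h.sparse (range f) ⟨f ⟨0, by omega⟩, mem_range_self _⟩
  rw [ncard_image_of_injective _ (Sym2.map.injective hf)] at h1
  -- The edges of the base graph alone exhaust the sparsity bound on the image. Hence the image is
  -- tight, and by `hEq` below it carries no other edges.
  have ht : A.TightSet (range f) := by rw [TightSet]; omega
  have hu := h.eq_univ _ (by rintro _ ⟨i, rfl⟩; exact ⟨B.σ i, hσ i⟩) (by omega) ht
  have hEq := eq_of_subset_of_ncard_le hsub
    (by rw [ncard_image_of_injective _ (Sym2.map.injective hf)]; omega)
  have hbij : Function.Bijective f := ⟨hf, range_eq_univ.1 hu⟩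
  let e : B.graph ≃g A.graph :=
    { Equiv.ofBijective f hbij with
      map_rel_iff' := by
        intro i j
        change A.graph.Adj (f i) (f j) ↔ B.graph.Adj i j
        refine ⟨fun hij => ?_, hadj i j⟩
        have : s(f i, f j) ∈ edgesWithin A.graph.edgeSet (range f) :=
          mk_mem_edgesWithin.2 ⟨hij, ⟨i, rfl⟩, ⟨j, rfl⟩⟩
        rw [← hEq, ← Sym2.map_mk, (Sym2.map.injective hf).mem_set_image] at this
        exact this }
  refine ⟨e.symm, fun v => ?_⟩
  obtain ⟨i, rfl⟩ := e.surjective v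
  have : A.σ (e i) = e (B.σ i) := (hσ i).symm
  rw [this, e.symm_apply_apply, e.symm_apply_apply]

end Irreducible

end CsGraph

/-! ### Reductions -/

namespace CsGraph

variable {V : Type u}

/-- The symmetric graph on a vertex subset `S` with a given reflection `τ` and edge set `F`. -/
def onSet (S : Set V) (τ : V → V) (hτ : ∀ v ∈ S, τ v ∈ S) (hττ : ∀ v ∈ S, τ (τ v) = v)
    (F : Set (Sym2 V)) (hF : ∀ a ∈ S, ∀ b ∈ S, s(a, b) ∈ F → s(τ a, τ b) ∈ F) : CsGraph S where
  graph := SimpleGraph.fromEdgeSet (Sym2.map Subtype.val ⁻¹' F)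
  σ v := ⟨τ v, hτ v v.2⟩
  invol v := Subtype.ext (hττ v v.2)
  adj_σ v w := by
    simp only [SimpleGraph.fromEdgeSet_adj, mem_preimage, Sym2.map_mk]
    rintro ⟨h, h'⟩
    refine ⟨hF _ v.2 _ w.2 h, fun h'' => h' (Subtype.ext ?_)⟩
    rw [← hττ v v.2, ← hττ w w.2]
    exact congrArg τ (Subtype.ext_iff.1 h'')

section OnSet

variable {S : Set V} {τ : V → V} {hτ : ∀ v ∈ S, τ v ∈ S} {hττ : ∀ v ∈ S, τ (τ v) = v}
    {F : Set (Sym2 V)} {hF : ∀ a ∈ S, ∀ b ∈ S, s(a, b) ∈ F → s(τ a, τ b) ∈ F}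

theorem onSet_adj {a b : S} : (onSet S τ hτ hττ F hF).graph.Adj a b ↔
    s((a : V), (b : V)) ∈ F ∧ (a : V) ≠ b := by
  simp only [onSet, SimpleGraph.fromEdgeSet_adj, mem_preimage, Sym2.map_mk, ne_eq,
    Subtype.ext_iff]

theorem onSet_σ (a : S) : ((onSet S τ hτ hττ F hF).σ a : V) = τ a := rfl

theorem mk_mem_image_onSet {a b : V} :
    s(a, b) ∈ Sym2.map Subtype.val '' (onSet S τ hτ hττ F hF).graph.edgeSet ↔
      a ∈ S ∧ b ∈ S ∧ s(a, b) ∈ F ∧ a ≠ b := by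
  constructor
  · rintro ⟨e, he, h⟩
    induction e using Sym2.ind with | _ x y => ?_
    rw [SimpleGraph.mem_edgeSet, onSet_adj] at he
    rcases Sym2.eq_iff.1 h with ⟨rfl, rfl⟩ | ⟨rfl, rfl⟩
    · exact ⟨x.2, y.2, he⟩
    · exact ⟨y.2, x.2, by rw [Sym2.eq_swap]; exact he.1, he.2.symm⟩
  · rintro ⟨ha, hb, h⟩
    exact ⟨s(⟨a, ha⟩, ⟨b, hb⟩), (onSet_adj (hτ := hτ) (hττ := hττ) (hF := hF)).2 h, rfl⟩

theorem mk_mem_image_edgesAvoiding {w : S} {a b : V} :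
    s(a, b) ∈ Sym2.map Subtype.val '' (onSet S τ hτ hττ F hF).edgesAvoiding w ↔
      a ∈ S ∧ b ∈ S ∧ (s(a, b) ∈ F ∧ a ≠ b) ∧
        a ≠ w ∧ b ≠ w ∧ a ≠ τ w ∧ b ≠ τ w := by
  constructor
  · rintro ⟨e, he, h⟩
    induction e using Sym2.ind with | _ x y => ?_
    simp only [mem_edgesAvoiding, onSet_adj, ne_eq, Subtype.ext_iff, onSet_σ] at he
    rcases Sym2.eq_iff.1 h with ⟨rfl, rfl⟩ | ⟨rfl, rfl⟩
    · exact ⟨x.2, y.2, he⟩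
    · obtain ⟨⟨h1, h2⟩, h3, h4, h5, h6⟩ := he
      exact ⟨y.2, x.2, ⟨by rw [Sym2.eq_swap]; exact h1, Ne.symm h2⟩, h4, h3, h6, h5⟩
  · rintro ⟨ha, hb, h⟩
    refine ⟨s(⟨a, ha⟩, ⟨b, hb⟩), ?_, rfl⟩
    simpa only [mem_edgesAvoiding, onSet_adj, ne_eq, Subtype.ext_iff, onSet_σ] using h

theorem onSet_sparse [Finite V] (h : ∀ Y ⊆ S, Y.Nonempty →
    (edgesWithin F Y).ncard + 2 ≤ 2 * Y.ncard) :
    IsSparse (onSet S τ hτ hττ F hF).graph.edgeSet := by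
  intro X hX
  have h1 := h (Subtype.val '' X) (by rintro _ ⟨x, -, rfl⟩; exact x.2) (hX.image _)
  rw [ncard_image_of_injective _ Subtype.val_injective] at h1
  refine le_trans (Nat.add_le_add_right ?_ 2) h1
  rw [← ncard_image_of_injective _ (Sym2.map.injective Subtype.val_injective),
    ← edgesWithin_image Subtype.val_injective]
  refine ncard_le_ncard (edgesWithin_mono (fun e he => ?_) subset_rfl)
  induction e using Sym2.ind with | _ a b => ?_
  exact (mk_mem_image_onSet.1 he).2.2.1

theorem onSet_isVertexExtension {A : CsGraph V} (h : ∀ v ∈ S, τ v = A.σ v) {N : Set V}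
    (hN : Sᶜ = N) :
    (onSet S τ hτ hττ F hF).IsVertexExtension A Subtype.val N :=
  ⟨Subtype.val_injective, fun v => h v v.2, by rw [Subtype.range_coe, hN]⟩

theorem onSet_noFixedEdge (h : ∀ a ∈ S, ∀ b ∈ S, s(a, b) ∈ F → a ≠ b →
    ¬ (τ a = a ∧ τ b = b) ∧ τ a ≠ b) : (onSet S τ hτ hττ F hF).NoFixedEdge := by
  intro a b hab
  rw [onSet_adj] at hab
  have := h a a.2 b b.2 hab.1 hab.2
  simpa only [ne_eq, Subtype.ext_iff, onSet_σ] using this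

end OnSet

/-- `A` arises by a move from a smaller non-trivial tight graph. -/
def Reducible (A : CsGraph V) : Prop :=
  ∃ (S : Set V) (A' : CsGraph S), A'.IsTight ∧ S.Nontrivial ∧ S ≠ univ ∧ A'.Move A

theorem reducible_of_move [Finite V] {A : CsGraph V} (hA : A.IsTight) {S : Set V}
    {A' : CsGraph S} (hsp : IsSparse A'.graph.edgeSet) (hnf : A'.NoFixedEdge)
    (hS : S.Nontrivial) (hS' : S ≠ univ) (hm : A'.Move A) : A.Reducible :=
  ⟨S, A', hm.preserves.isTight_of_sparse hA hsp hnf, hS, hS', hm⟩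

/-- A subset closed under the reflection, with the induced graph. -/
def restrict (A : CsGraph V) (S : Set V) (hS : ∀ v ∈ S, A.σ v ∈ S) : CsGraph S :=
  onSet S A.σ hS (fun v _ => A.invol v) A.graph.edgeSet fun a _ b _ h => A.adj_σ a b h

variable {A : CsGraph V}

theorem restrict_sparse [Finite V] (hA : IsSparse A.graph.edgeSet) {S : Set V}
    (hS : ∀ v ∈ S, A.σ v ∈ S) : IsSparse (A.restrict S hS).graph.edgeSet :=
  onSet_sparse fun Y _ hY => hA Y hY

theorem restrict_noFixedEdge (hA : A.NoFixedEdge) {S : Set V}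
    (hS : ∀ v ∈ S, A.σ v ∈ S) : (A.restrict S hS).NoFixedEdge :=
  onSet_noFixedEdge fun a _ b _ h _ => hA a b h

theorem mk_mem_image_restrict {S : Set V} {hS : ∀ v ∈ S, A.σ v ∈ S} {a b : V} :
    s(a, b) ∈ Sym2.map Subtype.val '' (A.restrict S hS).graph.edgeSet ↔
      a ∈ S ∧ b ∈ S ∧ A.graph.Adj a b := by
  refine mk_mem_image_onSet.trans ?_
  rw [SimpleGraph.mem_edgeSet]
  have : A.graph.Adj a b → a ≠ b := fun h => h.ne
  tauto

/-- The two neighbours are exchanged by the reflection, since an edge from v to a fixed neighbour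
would be fixed. Deleting v therefore undoes a fixed-vertex 0-extension. -/
theorem reducible_of_fixed_degree_two [Finite V] (hA : A.IsTight) {v : V} (hv : A.σ v = v)
    (hd : (A.graph.neighborSet v).ncard = 2) : A.Reducible := by
  have hA' := A.isTight_iff.1 hA
  obtain ⟨x, y, hxy, hN⟩ := ncard_eq_two.1 hd
  have hN' : ∀ b, A.graph.Adj v b ↔ b = x ∨ b = y := fun b => by
    rw [← SimpleGraph.mem_neighborSet, hN]; simp
  have hx := (hN' x).2 (Or.inl rfl)
  have hσx : A.σ x = y := by
    have h1 := (hN' (A.σ x)).1 (by have := A.adj_σ _ _ hx; rwa [hv] at this)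
    rcases h1 with h1 | h1
    · exact ((hA'.2.1 _ _ hx).1 ⟨hv, h1⟩).elim
    · exact h1
  subst hσx
  have hS : ∀ u ∈ ({v}ᶜ : Set V), A.σ u ∈ ({v}ᶜ : Set V) := by
    intro u hu h
    exact hu (A.σ_injective (h.trans hv.symm))
  refine reducible_of_move hA (restrict_sparse hA'.1 hS) (restrict_noFixedEdge hA'.2.1 hS)
    ⟨x, hx.ne', A.σ x, ((hN' _).2 (Or.inr rfl)).ne', hxy⟩ (by simp) (Or.inl ?_)
  refine ⟨Subtype.val, v, ⟨x, hx.ne'⟩, hv, onSet_isVertexExtension (fun _ _ => rfl) (by simp), ?_,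
    ?_⟩
  · exact fun h => hxy (Subtype.ext_iff.1 h).symm
  · ext e
    induction e using Sym2.ind with | _ a b => ?_
    rw [mem_union, mk_mem_image_restrict]
    have h1 := hN' a
    have h2 := hN' b
    have h3 := A.graph.adj_comm v a
    have h4 : ¬ A.graph.Adj v v := A.graph.irrefl
    simp only [SimpleGraph.mem_edgeSet, mem_compl_iff, mem_singleton_iff, mem_insert_iff,
      Sym2.eq_iff]
    change _ ↔ _ ∨ ((_ ∨ _) ∨ (a = v ∧ b = A.σ x ∨ a = A.σ x ∧ b = v))
    grind

theorem neighborSet_of_not_fixed (hA : A.NoFixedEdge) {v : V} {N : V → Prop}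
    (hN : ∀ b, A.graph.Adj v b ↔ N b) : (∀ b, A.graph.Adj (A.σ v) b ↔ N (A.σ b)) ∧
      ¬ N (A.σ v) ∧ ¬ N v := by
  refine ⟨fun b => ?_, fun h => ?_, fun h => ?_⟩
  · rw [← hN, ← A.adj_σ_iff, A.invol]
  · exact (hA _ _ ((hN _).2 h)).2 rfl
  · exact A.graph.irrefl ((hN _).2 h)

theorem mem_compl_pair_σ (A : CsGraph V) (v : V) :
    ∀ u ∈ ({v, A.σ v}ᶜ : Set V), A.σ u ∈ ({v, A.σ v}ᶜ : Set V) := by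
  intro u hu h
  apply hu
  rcases h with h | h
  · right; rw [mem_singleton_iff, ← h, A.invol]
  · left; exact A.σ_injective h

/-- Compare an edge set with that of `A` away from `v`, `σ v` and at these two vertices. -/
theorem edgeSet_eq_of_pair (v : V) {F : Set (Sym2 V)}
    (h₁ : ∀ a b, a ≠ v → a ≠ A.σ v → b ≠ v → b ≠ A.σ v → (A.graph.Adj a b ↔ s(a, b) ∈ F))
    (h₂ : ∀ b, A.graph.Adj v b ↔ s(v, b) ∈ F)
    (h₃ : ∀ b, A.graph.Adj (A.σ v) b ↔ s(A.σ v, b) ∈ F) : A.graph.edgeSet = F := by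
  ext e
  induction e using Sym2.ind with | _ a b => ?_
  rw [SimpleGraph.mem_edgeSet]
  by_cases ha : a = v
  · rw [ha]; exact h₂ b
  by_cases ha' : a = A.σ v
  · rw [ha']; exact h₃ b
  by_cases hb : b = v
  · rw [hb, SimpleGraph.adj_comm, Sym2.eq_swap]; exact h₂ a
  by_cases hb' : b = A.σ v
  · rw [hb', SimpleGraph.adj_comm, Sym2.eq_swap]; exact h₃ a
  exact h₁ a b ha ha' hb hb'

theorem reducible_of_degree_two [Finite V] (hA : A.IsTight) {v : V} (hv : A.σ v ≠ v)
    (hd : (A.graph.neighborSet v).ncard = 2) : A.Reducible := by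
  have hA' := A.isTight_iff.1 hA
  obtain ⟨x, y, hxy, hN⟩ := ncard_eq_two.1 hd
  have hN' : ∀ b, A.graph.Adj v b ↔ b = x ∨ b = y := fun b => by
    rw [← SimpleGraph.mem_neighborSet, hN]; simp
  obtain ⟨hN'', hσv, hvv⟩ := neighborSet_of_not_fixed hA'.2.1 hN'
  have hS := A.mem_compl_pair_σ v
  have hxS : x ∈ ({v, A.σ v}ᶜ : Set V) := by simp; grind
  have hyS : y ∈ ({v, A.σ v}ᶜ : Set V) := by simp; grind
  refine reducible_of_move hA (restrict_sparse hA'.1 hS) (restrict_noFixedEdge hA'.2.1 hS)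
    ⟨x, hxS, y, hyS, hxy⟩ (fun h => (h.symm ▸ mem_univ v : v ∈ ({v, A.σ v}ᶜ : Set V)) (by simp))
    (Or.inr (Or.inl ?_))
  refine ⟨Subtype.val, v, ⟨x, hxS⟩, ⟨y, hyS⟩, hv,
    onSet_isVertexExtension (fun _ _ => rfl) (by simp), ?_, ?_⟩
  · exact fun h => hxy (Subtype.ext_iff.1 h)
  · change A.graph.edgeSet = _ ∪ {s(v, x), s(v, y), s(A.σ v, A.σ x), s(A.σ v, A.σ y)}
    have hvx : v ≠ A.σ x := fun h => hσv (Or.inl (by rw [h, A.invol]))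
    have hvy : v ≠ A.σ y := fun h => hσv (Or.inr (by rw [h, A.invol]))
    refine edgeSet_eq_of_pair v (fun a b h1 h2 h3 h4 => ?_) (fun b => ?_) (fun b => ?_)
    · rw [mem_union, mk_mem_image_restrict]; simp [*]
    · rw [hN', mem_union, mk_mem_image_restrict]
      simp only [mem_insert_iff, mem_singleton_iff, Sym2.eq_iff]
      simp
      grind
    · rw [hN'', mem_union, mk_mem_image_restrict]
      have h5 : ∀ z, A.σ b = z ↔ b = A.σ z := fun z =>
        ⟨fun h => by rw [← h, A.invol], fun h => by rw [h, A.invol]⟩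
      simp only [mem_insert_iff, mem_singleton_iff, Sym2.eq_iff, h5]
      simp
      grind

end CsGraph

/-! ### Reductions at a vertex of degree three -/

namespace CsGraph

variable {V : Type u} {A : CsGraph V}

/-- Delete `v` and `σ v` and add the edge `pq` and its mirror image. -/
def exchange (A : CsGraph V) (v p q : V) : CsGraph ({v, A.σ v}ᶜ : Set V) :=
  onSet {v, A.σ v}ᶜ A.σ (A.mem_compl_pair_σ v) (fun v _ => A.invol v)
    (A.graph.edgeSet ∪ {s(p, q), s(A.σ p, A.σ q)}) (by
      rintro a - b - (h | h | h)
      · exact Or.inl (A.adj_σ a b h)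
      · refine Or.inr (Or.inr ?_)
        rw [← Sym2.map_mk A.σ a b, h, Sym2.map_mk, mem_singleton_iff]
      · refine Or.inr (Or.inl ?_)
        rw [← Sym2.map_mk A.σ a b, h, Sym2.map_mk, A.invol, A.invol])

theorem mk_mem_image_exchange {v p q a b : V} :
    s(a, b) ∈ Sym2.map Subtype.val '' (A.exchange v p q).graph.edgeSet ↔
      a ∈ ({v, A.σ v}ᶜ : Set V) ∧ b ∈ ({v, A.σ v}ᶜ : Set V) ∧
        (A.graph.Adj a b ∨ s(a, b) = s(p, q) ∨ s(a, b) = s(A.σ p, A.σ q)) ∧ a ≠ b :=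
  mk_mem_image_onSet

theorem mk_mem_image_exchange_avoiding {v p q : V} {w : ({v, A.σ v}ᶜ : Set V)} {a b : V} :
    s(a, b) ∈ Sym2.map Subtype.val '' (A.exchange v p q).edgesAvoiding w ↔
      a ∈ ({v, A.σ v}ᶜ : Set V) ∧ b ∈ ({v, A.σ v}ᶜ : Set V) ∧
        ((A.graph.Adj a b ∨ s(a, b) = s(p, q) ∨ s(a, b) = s(A.σ p, A.σ q)) ∧ a ≠ b) ∧
        a ≠ w ∧ b ≠ w ∧ a ≠ A.σ w ∧ b ≠ A.σ w :=
  mk_mem_image_edgesAvoiding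

theorem exchange_adj {v p q : V} {a b : ({v, A.σ v}ᶜ : Set V)} :
    (A.exchange v p q).graph.Adj a b ↔ (A.graph.Adj a b ∨ s((a : V), (b : V)) = s(p, q) ∨
      s((a : V), (b : V)) = s(A.σ p, A.σ q)) ∧ (a : V) ≠ b :=
  onSet_adj

/-- Consider a set Y avoiding v and σ v. If it contains the ends of just one of the two new edges,
it must have deficiency at least 1, which is `hno` or its mirror image. If it contains the ends of
both, deficiency at least 2 is needed; with deficiency at most 1, `Irreducible.mem_or_mem` would put
v or σ v into Y. -/
theorem exchange_sparse [Finite V] (h : A.Irreducible) {v p q : V} (hpq : p ≠ q)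
    (hno : ∀ Y, A.TightSet Y → p ∈ Y → q ∈ Y → v ∉ Y → A.σ v ∉ Y → False) :
    IsSparse (A.exchange v p q).graph.edgeSet := by
  refine onSet_sparse fun Y hYS hY => ?_
  have hv : v ∉ Y := fun hv => hYS hv (by simp)
  have hv' : A.σ v ∉ Y := fun hv => hYS hv (by simp)
  have hsp := h.sparse Y hY
  have hle : ∀ D : Set (Sym2 V), (s(p, q) ∈ edgesWithin (A.graph.edgeSet ∪
        {s(p, q), s(A.σ p, A.σ q)}) Y → s(p, q) ∈ D) →
      (s(A.σ p, A.σ q) ∈ edgesWithin (A.graph.edgeSet ∪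
        {s(p, q), s(A.σ p, A.σ q)}) Y → s(A.σ p, A.σ q) ∈ D) →
      (edgesWithin (A.graph.edgeSet ∪ {s(p, q), s(A.σ p, A.σ q)}) Y).ncard ≤
        (edgesWithin A.graph.edgeSet Y).ncard + D.ncard := by
    intro D h1 h2
    refine (ncard_le_ncard ?_).trans (ncard_union_le _ _)
    intro e he
    obtain ⟨he' | rfl | rfl, hY⟩ := id he
    · exact Or.inl ⟨he', hY⟩
    · exact Or.inr (h1 he)
    · exact Or.inr (h2 he)
  simp only [mk_mem_edgesWithin] at hle
  by_cases h1 : p ∈ Y ∧ q ∈ Y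
  · have hnt : ¬ A.TightSet Y := fun ht => hno Y ht h1.1 h1.2 hv hv'
    rw [TightSet] at hnt
    by_cases h2 : A.σ p ∈ Y ∧ A.σ q ∈ Y
    · have h3 := hle {s(p, q), s(A.σ p, A.σ q)} (by simp) (by simp)
      have h4 := ncard_insert_le s(p, q) {s(A.σ p, A.σ q)}
      rw [ncard_singleton] at h4
      by_contra hcon
      rcases h.mem_or_mem (by omega) hpq h1.1 h2.1 h1.2 h2.2 v with h5 | h5
      exacts [hv h5, hv' h5]
    · have h3 := hle {s(p, q)} (by simp) (by tauto)
      rw [ncard_singleton] at h3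
      omega
  · by_cases h2 : A.σ p ∈ Y ∧ A.σ q ∈ Y
    · have hnt : ¬ A.TightSet Y := fun ht => hno _ ht.preimage_σ h2.1 h2.2 hv' (by
        rw [mem_preimage, A.invol]; exact hv)
      rw [TightSet] at hnt
      have h3 := hle {s(A.σ p, A.σ q)} (by tauto) (by simp)
      rw [ncard_singleton] at h3
      omega
    · have h3 := hle ∅ (by tauto) (by tauto)
      rw [ncard_empty] at h3
      omega

theorem exchange_noFixedEdge (h : A.NoFixedEdge) {v p q : V}
    (hpq : ¬ (A.σ p = p ∧ A.σ q = q)) (hpq' : A.σ p ≠ q) :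
    (A.exchange v p q).NoFixedEdge := by
  have hq : A.σ q ≠ p := fun h => hpq' (by rw [← h, A.invol])
  refine onSet_noFixedEdge ?_
  rintro a - b - (hab | hab | hab) -
  · exact h a b hab
  · rcases Sym2.eq_iff.1 hab with ⟨rfl, rfl⟩ | ⟨rfl, rfl⟩
    · exact ⟨hpq, hpq'⟩
    · exact ⟨fun h => hpq h.symm, hq⟩
  · rcases Sym2.eq_iff.1 hab with ⟨rfl, rfl⟩ | ⟨rfl, rfl⟩ <;> simp only [A.invol] <;> grind

theorem compl_pair_ne_univ (A : CsGraph V) (v : V) : ({v, A.σ v}ᶜ : Set V) ≠ univ :=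
  fun h => (h.symm ▸ mem_univ v : v ∈ ({v, A.σ v}ᶜ : Set V)) (by simp)

/-- Inverse 1-extension. -/
theorem Irreducible.reducible_of_oneExtension [Finite V] (h : A.Irreducible) {v x y z : V}
    (hv : A.σ v ≠ v) (hN : ∀ b, A.graph.Adj v b ↔ b = x ∨ b = y ∨ b = z) (hxy : x ≠ y)
    (hxz : x ≠ z) (hyz : y ≠ z) (hadj : ¬ A.graph.Adj x y)
    (hfix : ¬ (A.σ x = x ∧ A.σ y = y)) (hfix' : A.σ x ≠ y)
    (hno : ∀ Y, A.TightSet Y → x ∈ Y → y ∈ Y → v ∉ Y → A.σ v ∉ Y → False) : A.Reducible := by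
  obtain ⟨hN', hσv, hvv⟩ := neighborSet_of_not_fixed h.noFixedEdge hN
  have hxS : x ∈ ({v, A.σ v}ᶜ : Set V) := by simp; grind
  have hyS : y ∈ ({v, A.σ v}ᶜ : Set V) := by simp; grind
  have hzS : z ∈ ({v, A.σ v}ᶜ : Set V) := by simp; grind
  have hsxy : s(A.σ x, A.σ y) ≠ s(x, y) := by
    rw [Ne, Sym2.eq_iff]
    rintro (h | h)
    exacts [hfix h, hfix' h.1]
  refine reducible_of_move h.isTight (exchange_sparse h hxy hno)
    (exchange_noFixedEdge h.noFixedEdge hfix hfix') ⟨x, hxS, y, hyS, hxy⟩ (A.compl_pair_ne_univ v)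
    (Or.inr (Or.inr (Or.inl ?_)))
  refine ⟨Subtype.val, v, ⟨x, hxS⟩, ⟨y, hyS⟩, ⟨z, hzS⟩, hv,
    onSet_isVertexExtension (fun _ _ => rfl) (by simp), onSet_adj.2 ⟨by simp, hxy⟩, ?_, ?_, ?_, ?_⟩
  · intro h
    apply hsxy
    have := congrArg (Sym2.map Subtype.val) h
    exact this
  · exact fun h => hxz (Subtype.ext_iff.1 h).symm
  · exact fun h => hyz (Subtype.ext_iff.1 h).symm
  · rw [image_sdiff (Sym2.map.injective Subtype.val_injective), image_pair]
    change A.graph.edgeSet = _ \ {s(x, y), s(A.σ x, A.σ y)} ∪ {s(v, x), s(v, y), s(v, z),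
      s(A.σ v, A.σ x), s(A.σ v, A.σ y), s(A.σ v, A.σ z)}
    have hvx : v ≠ A.σ x := fun h => hσv (Or.inl (by rw [h, A.invol]))
    have hvy : v ≠ A.σ y := fun h => hσv (Or.inr (Or.inl (by rw [h, A.invol])))
    have hvz : v ≠ A.σ z := fun h => hσv (Or.inr (Or.inr (by rw [h, A.invol])))
    have hadj' : ¬ A.graph.Adj (A.σ x) (A.σ y) := by rwa [A.adj_σ_iff]
    refine edgeSet_eq_of_pair v (fun a b h1 h2 h3 h4 => ?_) (fun b => ?_) (fun b => ?_)
    · rw [mem_union, mem_sdiff, mk_mem_image_exchange]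
      simp only [mem_insert_iff, mem_singleton_iff, mem_compl_iff, h1, h2, h3, h4, or_self,
        not_false_eq_true, true_and, not_or]
      constructor
      · intro hab
        refine Or.inl ⟨⟨Or.inl hab, hab.ne⟩, fun he => hadj ?_, fun he => hadj' ?_⟩
        · rw [← SimpleGraph.mem_edgeSet, ← he]; exact hab
        · rw [← SimpleGraph.mem_edgeSet, ← he]; exact hab
      · rintro (⟨⟨hab | hab, -⟩, hab'⟩ | hab)
        · exact hab
        · tauto
        · simp only [Sym2.eq_iff] at hab
          grind
    · rw [hN, mem_union, mem_sdiff, mk_mem_image_exchange]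
      simp only [mem_insert_iff, mem_singleton_iff, Sym2.eq_iff, mem_compl_iff, true_or,
        not_true_eq_false, false_and, false_or, true_and]
      simp only [hvx, hvy, hvz, hv.symm, false_and, or_false]
      grind
    · rw [hN', mem_union, mem_sdiff, mk_mem_image_exchange]
      have h5 : ∀ z, A.σ b = z ↔ b = A.σ z := fun z =>
        ⟨fun h => by rw [← h, A.invol], fun h => by rw [h, A.invol]⟩
      simp only [mem_insert_iff, mem_singleton_iff, Sym2.eq_iff, mem_compl_iff, or_true,
        not_true_eq_false, false_and, false_or, true_and, h5]
      simp only [hv, false_and, false_or]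
      grind

section Split

variable {v p a b d : V}

/-- Deleting a vertex `v` of degree three and joining one of its neighbours to `p`, where `p` is
adjacent to the other two, is the inverse of splitting `v` off `p`. -/
theorem exchange_isSplit (hA : A.NoFixedEdge) (hv : A.σ v ≠ v)
    (hpS : p ∈ ({v, A.σ v}ᶜ : Set V)) (hpv : ¬ A.graph.Adj v p) (hpv' : ¬ A.graph.Adj v (A.σ p)) :
    (A.exchange v p d).IsSplit A Subtype.val ⟨p, hpS⟩ v {t | A.graph.Adj p t}
      {t | A.graph.Adj v t} := by
  have hpv1 : ¬ A.graph.Adj p v := fun h => hpv h.symm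
  have hpv2 : ¬ A.graph.Adj p (A.σ v) := fun h => hpv' (by
    have := A.adj_σ _ _ h; rw [A.invol] at this; exact this.symm)
  have hvv : ∀ t, A.graph.Adj v t → t ∈ ({v, A.σ v}ᶜ : Set V) := by
    rintro t ht (h | h)
    · exact ht.ne h.symm
    · exact (hA _ _ ht).2 h.symm
  have hpp : ∀ t, A.graph.Adj p t → t ∈ ({v, A.σ v}ᶜ : Set V) := by
    rintro t ht (rfl | rfl)
    exacts [hpv1 ht, hpv2 ht]
  have hσ : ∀ s t, A.graph.Adj (A.σ s) t ↔ A.graph.Adj s (A.σ t) := fun s t => by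
    rw [← A.adj_σ_iff, A.invol]
  have hvS : v ∉ ({v, A.σ v}ᶜ : Set V) := by simp
  have hvS' : A.σ v ∉ ({v, A.σ v}ᶜ : Set V) := by simp
  have hne : ∀ r ∈ ({v, A.σ v}ᶜ : Set V), v ≠ r := fun r hr h => hr (Or.inl h.symm)
  have hne' : ∀ r ∈ ({v, A.σ v}ᶜ : Set V), A.σ v ≠ r := fun r hr h => hr (Or.inr h.symm)
  have hσS : ∀ t : ({v, A.σ v}ᶜ : Set V), A.σ t ∈ ({v, A.σ v}ᶜ : Set V) :=
    fun t => A.mem_compl_pair_σ v t t.2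
  have hσp := A.mem_compl_pair_σ v p hpS
  rw [IsSplit]
  change _ = _ ∪ {e | ∃ t : ({v, A.σ v}ᶜ : Set V), A.graph.Adj p t ∧
    (e = s(p, (t : V)) ∨ e = s(A.σ p, A.σ t))} ∪ {e | ∃ t : ({v, A.σ v}ᶜ : Set V),
    A.graph.Adj v t ∧ (e = s(v, (t : V)) ∨ e = s(A.σ v, A.σ t))}
  refine edgeSet_eq_of_pair v (fun s t h1 h2 h3 h4 => ?_) (fun t => ?_) (fun t => ?_)
  · have hs : s ∈ ({v, A.σ v}ᶜ : Set V) := by simp [h1, h2]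
    have ht : t ∈ ({v, A.σ v}ᶜ : Set V) := by simp [h3, h4]
    rw [mem_union, mem_union, mk_mem_image_exchange_avoiding]
    constructor
    · intro hst
      refine Or.inl ?_
      by_cases hs1 : s = p
      · subst hs1; exact Or.inr ⟨⟨t, ht⟩, hst, Or.inl rfl⟩
      by_cases ht1 : t = p
      · subst ht1; exact Or.inr ⟨⟨s, hs⟩, hst.symm, Or.inl Sym2.eq_swap⟩
      by_cases hs2 : s = A.σ p
      · subst hs2
        exact Or.inr ⟨⟨A.σ t, hσS ⟨t, ht⟩⟩, (hσ _ _).1 hst, Or.inr (by simp only [A.invol])⟩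
      by_cases ht2 : t = A.σ p
      · subst ht2
        exact Or.inr ⟨⟨A.σ s, hσS ⟨s, hs⟩⟩, (hσ _ _).1 hst.symm,
          Or.inr (by simp only [A.invol, Sym2.eq_swap])⟩
      exact Or.inl ⟨hs, ht, ⟨Or.inl hst, hst.ne⟩, hs1, ht1, hs2, ht2⟩
    · rintro ((⟨-, -, ⟨hst | hst | hst, -⟩, hs1, ht1, hs2, ht2⟩ | ⟨r, hr, hst | hst⟩) |
        ⟨r, hr, hst | hst⟩)
      · exact hst
      · simp only [Sym2.eq_iff] at hst; grind
      · simp only [Sym2.eq_iff] at hst; grind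
      · rw [← SimpleGraph.mem_edgeSet, hst]; exact hr
      · rw [← SimpleGraph.mem_edgeSet, hst]; exact A.adj_σ _ _ hr
      · simp only [Sym2.eq_iff] at hst; grind
      · simp only [Sym2.eq_iff] at hst; grind
  · rw [mem_union, mem_union, mk_mem_image_exchange_avoiding]
    constructor
    · exact fun ht => Or.inr ⟨⟨t, hvv t ht⟩, ht, Or.inl rfl⟩
    · rintro ((⟨h, -⟩ | ⟨r, hr, hst | hst⟩) | ⟨r, hr, hst | hst⟩)
      · exact (hvS h).elim
      · rcases Sym2.eq_iff.1 hst with h | h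
        exacts [(hne _ hpS h.1).elim, (hne _ r.2 h.1).elim]
      · rcases Sym2.eq_iff.1 hst with h | h
        exacts [(hne _ hσp h.1).elim, (hne _ (hσS r) h.1).elim]
      · rw [← SimpleGraph.mem_edgeSet, hst]; exact hr
      · rcases Sym2.eq_iff.1 hst with h | h
        exacts [(hv h.1.symm).elim, (hne _ (hσS r) h.1).elim]
  · rw [mem_union, mem_union, mk_mem_image_exchange_avoiding]
    constructor
    · intro ht
      exact Or.inr ⟨⟨A.σ t, hvv _ ((hσ _ _).1 ht)⟩, (hσ _ _).1 ht,
        Or.inr (by simp only [A.invol])⟩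
    · rintro ((⟨h, -⟩ | ⟨r, hr, hst | hst⟩) | ⟨r, hr, hst | hst⟩)
      · exact (hvS' h).elim
      · rcases Sym2.eq_iff.1 hst with h | h
        exacts [(hne' _ hpS h.1).elim, (hne' _ r.2 h.1).elim]
      · rcases Sym2.eq_iff.1 hst with h | h
        exacts [(hne' _ hσp h.1).elim, (hne' _ (hσS r) h.1).elim]
      · rcases Sym2.eq_iff.1 hst with h | h
        exacts [(hv h.1).elim, (hne' _ r.2 h.1).elim]
      · rw [← SimpleGraph.mem_edgeSet, hst]; exact A.adj_σ _ _ hr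

/-- Inverse vertex-to-`C₄` move: merge a vertex `v` of degree three with a vertex `p` that has
exactly two neighbours in common with `v`. -/
theorem Irreducible.reducible_of_merge [Finite V] (h : A.Irreducible) (hv : A.σ v ≠ v)
    (hN : ∀ t, A.graph.Adj v t ↔ t = a ∨ t = b ∨ t = d) (hab : a ≠ b) (hpv0 : p ≠ v)
    (hpv0' : p ≠ A.σ v) (hpv : ¬ A.graph.Adj v p) (hpv' : ¬ A.graph.Adj v (A.σ p))
    (hpa : A.graph.Adj p a) (hpb : A.graph.Adj p b) (hpd : ¬ A.graph.Adj p d)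
    (hfix : A.σ p = p → A.σ d ≠ d ∧ ∀ t, A.graph.Adj v t → A.graph.Adj v (A.σ t) → A.graph.Adj p t)
    (hno : ∀ Y, A.TightSet Y → p ∈ Y → d ∈ Y → v ∉ Y → A.σ v ∉ Y → False) : A.Reducible := by
  have hpS : p ∈ ({v, A.σ v}ᶜ : Set V) := by simp [hpv0, hpv0']
  have hvv : ∀ t, A.graph.Adj v t → t ∈ ({v, A.σ v}ᶜ : Set V) := by
    rintro t ht (h' | h')
    · exact ht.ne h'.symm
    · exact (h.noFixedEdge _ _ ht).2 h'.symm
  have ha : A.graph.Adj v a := (hN a).2 (by simp)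
  have hb : A.graph.Adj v b := (hN b).2 (by simp)
  have hd : A.graph.Adj v d := (hN d).2 (by simp)
  have hpd0 : p ≠ d := by rintro rfl; exact hpv hd
  have hpd1 : A.σ p ≠ d := by rintro rfl; exact hpv' hd
  -- The split condition only sees edges avoiding p and σ p, so the new edge pd matters only for the
  -- neighbourhood of p, compared with P and Q below.
  have hs := exchange_isSplit (d := d) h.noFixedEdge hv hpS hpv hpv'
  have hι : (A.exchange v p d).IsVertexExtension A Subtype.val {v, A.σ v} :=
    onSet_isVertexExtension (fun _ _ => rfl) (by simp)
  have hinter : ({t | A.graph.Adj p t} : Set ({v, A.σ v}ᶜ : Set V)) ∩ {t | A.graph.Adj v t} =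
      {⟨a, hvv a ha⟩, ⟨b, hvv b hb⟩} := by
    ext t
    simp only [mem_inter_iff, mem_ofPred_eq, hN, mem_insert_iff, mem_singleton_iff,
      Subtype.ext_iff]
    grind
  refine reducible_of_move h.isTight (exchange_sparse h hpd0 hno)
    (exchange_noFixedEdge h.noFixedEdge (fun h' => (hfix h'.1).1 h'.2) hpd1)
    ⟨p, hpS, d, hvv d hd, hpd0⟩ (A.compl_pair_ne_univ v) ?_
  have hσd : ∀ t : V, s(p, t) = s(A.σ p, A.σ d) ↔ A.σ p = p ∧ t = A.σ d := by
    intro t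
    rw [Sym2.eq_iff]
    constructor
    · rintro (h | h)
      · exact ⟨h.1.symm, h.2⟩
      · exact (hpd1 (by rw [h.1, A.invol])).elim
    · exact fun h => Or.inl ⟨h.1.symm, h.2⟩
  have hpd2 : ∀ t : V, s(p, t) = s(p, d) ↔ t = d := by
    intro t
    rw [Sym2.eq_iff]
    grind
  -- If p is fixed, both v and σ v are merged into p, which is the form with a pair of new vertices
  -- at a fixed vertex; otherwise v goes into p and σ v into σ p.
  by_cases hp : A.σ p = p
  · refine Or.inr (Or.inr (Or.inr (Or.inr (Or.inr (Or.inr (Or.inl ?_))))))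
    refine ⟨Subtype.val, ⟨p, hpS⟩, v, ⟨a, hvv a ha⟩, ⟨b, hvv b hb⟩, _, _, Subtype.ext hp, hv, hι,
      fun h => hab (Subtype.ext_iff.1 h), ?_, hinter, ?_, ?_, hs⟩
    · ext t
      rw [SimpleGraph.mem_neighborSet, exchange_adj, hσd, hpd2]
      simp only [mem_union, mem_ofPred_eq, mem_image]
      constructor
      · rintro ((ht | ht) | ⟨q, hq, rfl⟩)
        · exact ⟨Or.inl ht, ht.ne⟩
        · refine ⟨?_, fun h => hpv (h ▸ ht)⟩
          rcases (hN t).1 ht with h | h | h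
          · exact Or.inl (h ▸ hpa)
          · exact Or.inl (h ▸ hpb)
          · exact Or.inr (Or.inl h)
        · change (A.graph.Adj p (A.σ q) ∨ A.σ q = d ∨ A.σ p = p ∧ A.σ q = A.σ d) ∧ p ≠ A.σ q
          have key : ∀ t, A.graph.Adj p t → A.graph.Adj p (A.σ t) := by
            intro t ht
            have := A.adj_σ _ _ ht
            rwa [hp] at this
          refine ⟨?_, fun h => hpv' ?_⟩
          · rcases (hN q).1 hq with h | h | h
            · exact Or.inl (h ▸ key _ hpa)
            · exact Or.inl (h ▸ key _ hpb)
            · exact Or.inr (Or.inr ⟨hp, by rw [h]⟩)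
          · rw [h, A.invol]; exact hq
      · rintro ⟨ht | ht | ⟨-, ht⟩, -⟩
        · exact Or.inl (Or.inl ht)
        · exact Or.inl (Or.inr (by rw [ht]; exact hd))
        · exact Or.inr ⟨⟨d, hvv d hd⟩, hd, Subtype.ext ht.symm⟩
    · intro t ht
      have := A.adj_σ _ _ ht
      rw [hp] at this
      exact this
    · rintro t ⟨ht, q, hq, rfl⟩
      refine (hfix hp).2 _ ht ?_
      change A.graph.Adj v (A.σ (A.σ q))
      rw [A.invol]; exact hq
  · refine Or.inr (Or.inr (Or.inr (Or.inr (Or.inl ?_))))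
    refine ⟨Subtype.val, ⟨p, hpS⟩, v, ⟨a, hvv a ha⟩, ⟨b, hvv b hb⟩, _, _,
      fun h => hp (Subtype.ext_iff.1 h), hv, hι,
      fun h => hab (Subtype.ext_iff.1 h), ?_, hinter, hs⟩
    ext t
    rw [SimpleGraph.mem_neighborSet, exchange_adj, hσd, hpd2]
    simp only [mem_union, mem_ofPred_eq, hp, false_and, or_false]
    constructor
    · rintro (ht | ht)
      · exact ⟨Or.inl ht, ht.ne⟩
      · refine ⟨?_, fun h => hpv (h ▸ ht)⟩
        rcases (hN t).1 ht with h | h | h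
        · exact Or.inl (h ▸ hpa)
        · exact Or.inl (h ▸ hpb)
        · exact Or.inr h
    · rintro ⟨ht | ht, -⟩
      · exact Or.inl ht
      · exact Or.inr (by rw [ht]; exact hd)

end Split

end CsGraph

/-! ### Reductions by contraction -/

section Contract

variable {V : Type*}

/-- The image of an edge set under a map of the vertices, without loops. -/
def contractEdges (ρ : V → V) (E : Set (Sym2 V)) : Set (Sym2 V) :=
  {e | ∃ a b, s(a, b) ∈ E ∧ ρ a ≠ ρ b ∧ e = s(ρ a, ρ b)}

theorem mk_mem_contractEdges {ρ : V → V} {E : Set (Sym2 V)} {p q : V} :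
    s(p, q) ∈ contractEdges ρ E ↔ p ≠ q ∧ ∃ a b, s(a, b) ∈ E ∧ p = ρ a ∧ q = ρ b := by
  constructor
  · rintro ⟨a, b, hab, hne, h⟩
    rcases Sym2.eq_iff.1 h with ⟨rfl, rfl⟩ | ⟨rfl, rfl⟩
    · exact ⟨hne, a, b, hab, rfl, rfl⟩
    · exact ⟨hne.symm, b, a, by rwa [Sym2.eq_swap], rfl, rfl⟩
  · rintro ⟨hne, a, b, hab, rfl, rfl⟩
    exact ⟨a, b, hab, hne, rfl⟩

-- If Y contains w, every edge inside Y after the contraction comes from an edge inside X ∪ Y that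
-- is not inside X. By the density of X these number at most 2|X ∪ Y| − 2|X| = 2|Y| − 2|X ∩ Y|, and
-- w lies in X ∩ Y. If Y misses w, its edges are unchanged.
open Classical in
theorem IsSparse.contract [Finite V] {E : Set (Sym2 V)} (hE : IsSparse E) {X : Set V}
    (hX : 2 * X.ncard ≤ (edgesWithin E X).ncard + 2) {w : V} (hw : w ∈ X) :
    IsSparse (contractEdges (fun p => if p ∈ X then w else p) E) := by
  intro Y hY
  by_cases hwY : w ∈ Y
  · have hsub : edgesWithin (contractEdges (fun p => if p ∈ X then w else p) E) Y ⊆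
        Sym2.map (fun p => if p ∈ X then w else p) ''
          (edgesWithin E (Y ∪ X) \ edgesWithin E X) := by
      rintro _ ⟨⟨a, b, hab, hne, rfl⟩, h⟩
      refine ⟨s(a, b), ⟨mk_mem_edgesWithin.2 ⟨hab, ?_, ?_⟩, fun h' => ?_⟩, rfl⟩
      · by_cases ha : a ∈ X
        · exact Or.inr ha
        · left; simpa [ha] using h _ (Sym2.mem_mk_left _ _)
      · by_cases hb : b ∈ X
        · exact Or.inr hb
        · left; simpa [hb] using h _ (Sym2.mem_mk_right _ _)
      · rw [mk_mem_edgesWithin] at h'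
        simp [h'.2.1, h'.2.2] at hne
    have h1 := (ncard_le_ncard hsub).trans (ncard_image_le (toFinite _))
    have h2 := ncard_sdiff_add_ncard_of_subset
      (edgesWithin_mono (subset_refl E) (subset_union_right : X ⊆ Y ∪ X))
    have h3 := hE (Y ∪ X) ⟨w, Or.inl hwY⟩
    have h4 := ncard_union_add_ncard_inter Y X
    have h5 : 0 < (Y ∩ X).ncard := (ncard_pos).2 ⟨w, hwY, hw⟩
    omega
  · refine (Nat.add_le_add_right (ncard_le_ncard ?_) 2).trans (hE Y hY)
    rintro _ ⟨⟨a, b, hab, hne, rfl⟩, h⟩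
    have ha := h _ (Sym2.mem_mk_left _ _)
    have hb := h _ (Sym2.mem_mk_right _ _)
    have ha' : a ∉ X := fun h => hwY (by simpa [h] using ha)
    have hb' : b ∉ X := fun h => hwY (by simpa [h] using hb)
    simp only [ha', hb', if_false] at ha hb ⊢
    exact mk_mem_edgesWithin.2 ⟨hab, ha, hb⟩

end Contract

/-! ### Merging two fixed vertices and contracting an invariant tight set -/

namespace CsGraph

variable {V : Type u} {A : CsGraph V}

/-- Inverse vertex-to-`C₄` move: merge two fixed vertices with exactly two common neighbours. -/
theorem Irreducible.reducible_of_merge_fixed [Finite V] (h : A.Irreducible) {x y v : V}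
    (hx : A.σ x = x) (hy : A.σ y = y) (hxy : x ≠ y) (hv : A.σ v ≠ v)
    (hcommon : ∀ t, A.graph.Adj x t ∧ A.graph.Adj y t ↔ t = v ∨ t = A.σ v) : A.Reducible := by
  have hxv := (hcommon v).2 (Or.inl rfl)
  have hxv' := (hcommon (A.σ v)).2 (Or.inr rfl)
  have hxny : ¬ A.graph.Adj x y := fun h' => (h.noFixedEdge _ _ h').1 ⟨hx, hy⟩
  have hσx : ∀ t, A.graph.Adj x t → A.graph.Adj x (A.σ t) := fun t ht => by
    have := A.adj_σ _ _ ht; rwa [hx] at this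
  have hσy : ∀ t, A.graph.Adj y t → A.graph.Adj y (A.σ t) := fun t ht => by
    have := A.adj_σ _ _ ht; rwa [hy] at this
  have hS : ∀ u ∈ ({y}ᶜ : Set V), A.σ u ∈ ({y}ᶜ : Set V) := by
    intro u hu h
    exact hu (A.σ_injective (h.trans hy.symm))
  set F : Set (Sym2 V) := A.graph.edgeSet ∪ {e | ∃ t, A.graph.Adj y t ∧ e = s(x, t)} with hF
  have hFσ : ∀ a ∈ ({y}ᶜ : Set V), ∀ b ∈ ({y}ᶜ : Set V), s(a, b) ∈ F →
      s(A.σ a, A.σ b) ∈ F := by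
    rintro a - b - (hab | ⟨t, ht, hab⟩)
    · exact Or.inl (A.adj_σ _ _ hab)
    · refine Or.inr ⟨A.σ t, hσy t ht, ?_⟩
      rw [← Sym2.map_mk, hab, Sym2.map_mk, hx]
  let A' : CsGraph ({y}ᶜ : Set V) := onSet {y}ᶜ A.σ hS (fun u _ => A.invol u) F hFσ
  have hsp : IsSparse A'.graph.edgeSet := by
    refine onSet_sparse fun Y hYS hY => ?_
    have hyY : y ∉ Y := fun h => hYS h rfl
    by_cases hxY : x ∈ Y
    swap
    · refine (Nat.add_le_add_right (ncard_le_ncard ?_) 2).trans (h.sparse Y hY)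
      rintro e ⟨he | ⟨t, ht, rfl⟩, he'⟩
      · exact ⟨he, he'⟩
      · exact (hxY (he' x (by simp))).elim
    set M : Set V := {t | t ∈ Y ∧ A.graph.Adj y t} with hM
    have h1 : _ = _ + M.ncard := ncard_edgesWithin_insert_vertex (A := A) hyY
    have hsub : edgesWithin F Y ⊆ edgesWithin A.graph.edgeSet Y ∪
        (fun t => s(x, t)) '' (M \ {v, A.σ v}) := by
      rintro e ⟨he | ⟨t, ht, rfl⟩, he'⟩
      · exact Or.inl ⟨he, he'⟩
      · by_cases htv : t = v ∨ t = A.σ v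
        · exact Or.inl ⟨((hcommon t).2 htv).1, he'⟩
        · exact Or.inr ⟨t, ⟨⟨he' t (by simp), ht⟩, htv⟩, rfl⟩
    have h2 := (ncard_le_ncard hsub).trans (ncard_union_le _ _)
    have h3 : ((fun t => s(x, t)) '' (M \ {v, A.σ v})).ncard ≤ (M \ {v, A.σ v}).ncard :=
      ncard_image_le (toFinite _)
    have h4 := ncard_inter_add_ncard_sdiff_eq_ncard M {v, A.σ v}
    have h5 := ncard_insert_of_notMem hyY
    have h6 := h.sparse (insert y Y) (insert_nonempty _ _)
    have hxI : x ∈ insert y Y := Or.inr hxY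
    have hyI : y ∈ insert y Y := Or.inl rfl
    have hmem : ∀ t, A.graph.Adj y t → t ∈ insert y Y → t ∈ M := by
      rintro t ht (rfl | ht')
      · exact (A.graph.irrefl ht).elim
      · exact ⟨ht', ht⟩
    -- Shared neighbours are counted only once after merging, so Y satisfies the bound if the
    -- deficiency of Y ∪ {y} plus the number of vertices v, σ v in Y is at least 2. If one of v, σ v
    -- is missing, Y ∪ {y} cannot be tight, since it would be everything; if both are missing,
    -- deficiency at most 1 is excluded by `Irreducible.mem_or_mem`.
    by_cases hk2 : v ∈ M ∧ A.σ v ∈ M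
    · have h7 : ({v, A.σ v} : Set V) ⊆ M ∩ {v, A.σ v} := by
        rintro t (rfl | rfl)
        exacts [⟨hk2.1, by simp⟩, ⟨hk2.2, by simp⟩]
      have h8 := ncard_le_ncard h7
      rw [ncard_pair hv.symm] at h8
      omega
    have hnt : ¬ A.TightSet (insert y Y) := by
      intro ht
      have h7 := h.mem_of_tightSet ht hxy hxI (by rwa [hx]) hyI (by rwa [hy])
      exact hk2 ⟨hmem v hxv.2 (h7 v), hmem _ hxv'.2 (h7 _)⟩
    rw [TightSet] at hnt
    by_cases hk1 : v ∈ M ∨ A.σ v ∈ M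
    · have h7 : (M ∩ {v, A.σ v}).Nonempty := by
        rcases hk1 with hk | hk
        exacts [⟨v, hk, by simp⟩, ⟨_, hk, by simp⟩]
      have h8 := (ncard_pos).2 h7
      omega
    · by_contra hcon
      rcases h.mem_or_mem (Y := insert y Y) (by omega) hxy hxI (by rwa [hx]) hyI (by rwa [hy]) v
        with h7 | h7
      · exact hk1 (Or.inl (hmem v hxv.2 h7))
      · exact hk1 (Or.inr (hmem _ hxv'.2 h7))
  have hnf : A'.NoFixedEdge := by
    refine onSet_noFixedEdge ?_
    rintro a - b - (hab | ⟨t, ht, hab⟩) -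
    · exact h.noFixedEdge a b hab
    · have ht1 : A.σ t ≠ t := fun h' => (h.noFixedEdge _ _ ht).1 ⟨hy, h'⟩
      have ht2 : x ≠ t := by rintro rfl; exact hxny ht.symm
      have ht3 : A.σ t ≠ x := fun h' => ht2 (by rw [← A.invol t, h', hx])
      rcases Sym2.eq_iff.1 hab with ⟨rfl, rfl⟩ | ⟨rfl, rfl⟩ <;> grind
  refine reducible_of_move h.isTight hsp hnf
    ⟨v, hxv.2.ne', A.σ v, hxv'.2.ne', hv.symm⟩ (by simp)
    (Or.inr (Or.inr (Or.inr (Or.inr (Or.inr (Or.inl ?_))))))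
  have hyx : ∀ t, A.graph.Adj x t → t ∈ ({y}ᶜ : Set V) := by
    rintro t ht rfl; exact hxny ht
  refine ⟨Subtype.val, ⟨x, hxy⟩, y, ⟨v, hxv.2.ne'⟩, {t | A.graph.Adj x t}, {t | A.graph.Adj y t},
    Subtype.ext hx, hy, onSet_isVertexExtension (fun _ _ => rfl) (by simp),
    fun h => hv (Subtype.ext_iff.1 h), ?_, ?_, fun t ht => hσx t ht, fun t ht => hσy t ht, ?_⟩
  · ext t
    rw [SimpleGraph.mem_neighborSet, onSet_adj]
    constructor
    · rintro (ht | ht)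
      · exact ⟨Or.inl ht, ht.ne⟩
      · refine ⟨Or.inr ⟨t, ht, rfl⟩, fun h' => ?_⟩
        have h'' : x = t := h'
        exact hxny (h''.symm ▸ SimpleGraph.Adj.symm ht)
    · rintro ⟨ht | ⟨r, hr, ht⟩, hne⟩
      · exact Or.inl ht
      · right
        rcases Sym2.eq_iff.1 ht with h' | h'
        · rw [mem_ofPred_eq, h'.2]; exact hr
        · exact (hne h'.2.symm).elim
  · ext t
    simp only [mem_inter_iff, mem_ofPred_eq, hcommon, mem_insert_iff, mem_singleton_iff,
      Subtype.ext_iff]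
    rfl
  · rw [IsSplit]
    change _ = _ ∪ {e | ∃ t : ({y}ᶜ : Set V), A.graph.Adj x t ∧
      (e = s(x, (t : V)) ∨ e = s(A.σ x, A.σ t))} ∪ {e | ∃ t : ({y}ᶜ : Set V),
      A.graph.Adj y t ∧ (e = s(y, (t : V)) ∨ e = s(A.σ y, A.σ t))}
    have hnew : ∀ t, A.graph.Adj y t ↔ s(y, t) ∈ Sym2.map Subtype.val ''
        A'.edgesAvoiding ⟨x, hxy⟩ ∪ {e | ∃ t : ({y}ᶜ : Set V), A.graph.Adj x t ∧
        (e = s(x, (t : V)) ∨ e = s(A.σ x, A.σ t))} ∪ {e | ∃ t : ({y}ᶜ : Set V),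
        A.graph.Adj y t ∧ (e = s(y, (t : V)) ∨ e = s(A.σ y, A.σ t))} := by
      intro t
      rw [mem_union, mem_union, mk_mem_image_edgesAvoiding]
      constructor
      · exact fun ht => Or.inr ⟨⟨t, ht.ne'⟩, ht, Or.inl rfl⟩
      · rintro ((⟨h', -⟩ | ⟨r, hr, hst | hst⟩) | ⟨r, hr, hst | hst⟩)
        · exact (h' rfl).elim
        · rcases Sym2.eq_iff.1 hst with h' | h'
          exacts [(hxy h'.1.symm).elim, (r.2 h'.1.symm).elim]
        · rw [hx] at hst
          rcases Sym2.eq_iff.1 hst with h' | h'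
          exacts [(hxy h'.1.symm).elim, (hS _ r.2 h'.1.symm).elim]
        · rw [← SimpleGraph.mem_edgeSet, hst]; exact hr
        · rw [← SimpleGraph.mem_edgeSet, hst]; exact A.adj_σ _ _ hr
    have hfix : ∀ G : Set (Sym2 V), (∀ t, A.graph.Adj y t ↔ s(y, t) ∈ G) →
        ∀ t, A.graph.Adj (A.σ y) t ↔ s(A.σ y, t) ∈ G := fun G hG => by rwa [hy]
    refine edgeSet_eq_of_pair y (fun s t h1 _ h3 _ => ?_) hnew (hfix _ hnew)
    rw [mem_union, mem_union, mk_mem_image_edgesAvoiding]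
    simp only [hx]
    constructor
    · intro hst
      refine Or.inl ?_
      by_cases hs1 : s = x
      · subst hs1; exact Or.inr ⟨⟨t, h3⟩, hst, Or.inl rfl⟩
      by_cases ht1 : t = x
      · subst ht1; exact Or.inr ⟨⟨s, h1⟩, hst.symm, Or.inl Sym2.eq_swap⟩
      exact Or.inl ⟨h1, h3, ⟨Or.inl hst, hst.ne⟩, hs1, ht1, hs1, ht1⟩
    · rintro ((⟨-, -, ⟨hst | ⟨r, hr, hst⟩, -⟩, hs1, ht1, -, -⟩ | ⟨r, hr, hst | hst⟩) |
        ⟨r, hr, hst | hst⟩)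
      · exact hst
      · rcases Sym2.eq_iff.1 hst with h' | h'
        exacts [(hs1 h'.1).elim, (ht1 h'.2).elim]
      · rw [← SimpleGraph.mem_edgeSet, hst]; exact hr
      · rw [← SimpleGraph.mem_edgeSet, hst]; exact hσx _ hr
      · rcases Sym2.eq_iff.1 hst with h' | h'
        exacts [(h1 h'.1).elim, (h3 h'.2).elim]
      · rw [hy] at hst
        rcases Sym2.eq_iff.1 hst with h' | h'
        exacts [(h1 h'.1).elim, (h3 h'.2).elim]

/-- Inverse vertex-to-tight move: contract an invariant tight set to which every other vertex is
joined by at most one edge. -/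
theorem reducible_of_tightSet [Finite V] (hA : A.IsTight) {X : Set V} (hXσ : ∀ x ∈ X, A.σ x ∈ X)
    (hX : A.TightSet X) (hX2 : 2 ≤ X.ncard) (hXu : X ≠ univ)
    (hone : ∀ t, t ∉ X → ∀ a ∈ X, ∀ b ∈ X, A.graph.Adj a t → A.graph.Adj b t → a = b) :
    A.Reducible := by
  classical
  obtain ⟨hAs, hAn, hAc⟩ := A.isTight_iff.1 hA
  obtain ⟨w, hw, w', hw', hww'⟩ := (one_lt_ncard).1 (by omega : 1 < X.ncard)
  obtain ⟨z, hz⟩ := (ne_univ_iff_exists_notMem X).1 hXu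
  have hXσ' : ∀ x, x ∉ X → A.σ x ∉ X := fun x hx h => hx (by rw [← A.invol x]; exact hXσ _ h)
  set S : Set V := {t | t ∉ X ∨ t = w} with hS
  -- The representative w of X need not be fixed by the original reflection, so the reflection of
  -- the quotient is redefined to fix it.
  let τ : V → V := fun t => if t ∈ X then w else A.σ t
  let ρ : V → V := fun t => if t ∈ X then w else t
  have hτX : ∀ t ∈ X, τ t = w := fun t ht => if_pos ht
  have hτn : ∀ t, t ∉ X → τ t = A.σ t := fun t ht => if_neg ht
  have hρX : ∀ t ∈ X, ρ t = w := fun t ht => if_pos ht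
  have hρn : ∀ t, t ∉ X → ρ t = t := fun t ht => if_neg ht
  have hτS : ∀ t ∈ S, τ t ∈ S := by
    intro t _
    by_cases ht : t ∈ X
    · rw [hτX t ht]; exact Or.inr rfl
    · rw [hτn t ht]; exact Or.inl (hXσ' t ht)
  have hττ : ∀ t ∈ S, τ (τ t) = t := by
    rintro t (ht | rfl)
    · rw [hτn t ht, hτn _ (hXσ' t ht), A.invol]
    · rw [hτX t hw, hτX t hw]
  have hτρ : ∀ t, τ (ρ t) = ρ (A.σ t) := by
    intro t
    by_cases ht : t ∈ X
    · rw [hρX t ht, hτX w hw, hρX _ (hXσ t ht)]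
    · rw [hρn t ht, hτn t ht, hρn _ (hXσ' t ht)]
  have hF : ∀ a ∈ S, ∀ b ∈ S, s(a, b) ∈ contractEdges ρ A.graph.edgeSet →
      s(τ a, τ b) ∈ contractEdges ρ A.graph.edgeSet := by
    intro a ha b hb hab
    rw [mk_mem_contractEdges] at hab ⊢
    obtain ⟨hne, p, q, hpq, rfl, rfl⟩ := hab
    refine ⟨fun h => hne ?_, A.σ p, A.σ q, A.adj_σ _ _ hpq, hτρ p, hτρ q⟩
    rw [← hττ _ ha, ← hττ _ hb, h]
  have hFnn : ∀ a b, a ∉ X → b ∉ X →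
      (s(a, b) ∈ contractEdges ρ A.graph.edgeSet ↔ A.graph.Adj a b) := by
    intro a b ha hb
    rw [mk_mem_contractEdges]
    constructor
    · rintro ⟨-, p, q, hpq, h1, h2⟩
      have hp : p ∉ X := fun hp => ha (by rw [h1, hρX p hp]; exact hw)
      have hq : q ∉ X := fun hq => hb (by rw [h2, hρX q hq]; exact hw)
      rw [h1, h2, hρn p hp, hρn q hq]; exact hpq
    · exact fun hab => ⟨hab.ne, a, b, hab, (hρn a ha).symm, (hρn b hb).symm⟩
  have hFw : ∀ b, b ∉ X → (s(w, b) ∈ contractEdges ρ A.graph.edgeSet ↔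
      ∃ k ∈ X, A.graph.Adj k b) := by
    intro b hb
    rw [mk_mem_contractEdges]
    constructor
    · rintro ⟨-, p, q, hpq, h1, h2⟩
      have hp : p ∈ X := by
        by_contra hp
        rw [hρn p hp] at h1
        exact hp (h1 ▸ hw)
      have hq : q ∉ X := fun hq => hb (by rw [h2, hρX q hq]; exact hw)
      rw [hρn q hq] at h2
      exact ⟨p, hp, h2 ▸ hpq⟩
    · rintro ⟨k, hk, hkb⟩
      exact ⟨fun h => hb (h ▸ hw), k, b, hkb, (hρX k hk).symm, (hρn b hb).symm⟩
  let A' : CsGraph S := onSet S τ hτS hττ (contractEdges ρ A.graph.edgeSet) hF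
  have hwS : w ∈ S := Or.inr rfl
  have hAw : ∀ t : S, A'.graph.Adj ⟨w, hwS⟩ t ↔ (t : V) ∉ X ∧ ∃ k ∈ X, A.graph.Adj k t := by
    intro t
    rw [onSet_adj]
    constructor
    · rintro ⟨h1, h2⟩
      have ht : (t : V) ∉ X := by
        rcases t.2 with h | h
        · exact h
        · exact (h2 h.symm).elim
      exact ⟨ht, (hFw _ ht).1 h1⟩
    · rintro ⟨h1, h2⟩
      exact ⟨(hFw _ h1).2 h2, fun h => h1 (h ▸ hw)⟩
  have hsp : IsSparse A'.graph.edgeSet :=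
    onSet_sparse fun Y _ hY => hAs.contract hX.ge hw Y hY
  -- If b were fixed, σ k would be a neighbour of b in X too. By `hone` it would equal k, so that kb
  -- would be a fixed edge.
  have hfixn : ∀ k ∈ X, ∀ b, b ∉ X → A.graph.Adj k b → A.σ b ≠ b := by
    intro k hk b hb hkb h
    have h1 := A.adj_σ _ _ hkb
    rw [h] at h1
    exact (hAn _ _ hkb).1 ⟨hone b hb _ (hXσ k hk) _ hk h1 hkb, h⟩
  have hnf : A'.NoFixedEdge := by
    refine onSet_noFixedEdge ?_
    rintro a (ha | rfl) b (hb | rfl) hab hne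
    · rw [hτn a ha, hτn b hb]
      exact hAn a b ((hFnn a b ha hb).1 hab)
    · rw [Sym2.eq_swap, hFw a ha] at hab
      obtain ⟨k, hk, hka⟩ := hab
      rw [hτn a ha]
      exact ⟨fun h => hfixn k hk a ha hka h.1, fun h => hXσ' a ha (h ▸ hw)⟩
    · rw [hFw b hb] at hab
      obtain ⟨k, hk, hkb⟩ := hab
      rw [hτn b hb, hτX a hw]
      exact ⟨fun h => hfixn k hk b hb hkb h.2, hne⟩
    · exact (hne rfl).elim
  refine reducible_of_move hA hsp hnf ⟨w, hwS, z, Or.inl hz, fun h => hz (h ▸ hw)⟩ ?_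
    (Or.inr (Or.inr (Or.inr (Or.inr (Or.inr (Or.inr (Or.inr ?_)))))))
  · intro h
    have : w' ∈ S := h ▸ mem_univ w'
    rcases this with h | h
    exacts [h hw', hww' h.symm]
  have hHedge : Sym2.map Subtype.val '' (A.restrict X hXσ).graph.edgeSet =
      edgesWithin A.graph.edgeSet X := by
    ext e
    induction e using Sym2.ind with | _ a b => ?_
    rw [mk_mem_image_restrict, mk_mem_edgesWithin, SimpleGraph.mem_edgeSet]
    tauto
  -- The neighbour of t in X is unique by `hone`. The default w is irrelevant, since only neighbours
  -- of the contracted vertex are re-attached.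
  let y : S → X := fun t =>
    if h : ∃ k ∈ X, A.graph.Adj k t then ⟨h.choose, h.choose_spec.1⟩ else ⟨w, hw⟩
  have hy : ∀ t : S, ∀ k ∈ X, (t : V) ∉ X → A.graph.Adj k t → (y t : V) = k := by
    intro t k hk ht hkt
    have hex : ∃ k ∈ X, A.graph.Adj k t := ⟨k, hk, hkt⟩
    simp only [y, hex, dif_pos]
    exact hone t ht _ hex.choose_spec.1 _ hk hex.choose_spec.2 hkt
  refine ⟨X, A.restrict X hXσ, ⟨w, hwS⟩, Subtype.val, Subtype.val, y, ?_, ?_, ?_,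
    Subtype.val_injective.injOn, ?_, ?_, ?_⟩
  · rw [isTight_iff]
    refine ⟨restrict_sparse hAs hXσ, restrict_noFixedEdge hAn hXσ, ?_⟩
    rw [← ncard_image_of_injective _ (Sym2.map.injective Subtype.val_injective), hHedge]
    exact hX
  · exact Subtype.ext (hτX w hw)
  · refine onSet_isVertexExtension (fun _ _ => rfl) ?_
    ext t
    constructor
    · exact fun ht => ⟨⟨t, Or.inl ht⟩, fun h => ht (by rw [show t = w from Subtype.ext_iff.1 h]; exact hw), rfl⟩
    · rintro ⟨t, ht, rfl⟩
      rcases t.2 with h | h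
      · exact h
      · exact (ht (Subtype.ext h)).elim
  · intro t ht
    rcases t.2 with h | h
    · exact hτn _ h
    · exact (ht (Subtype.ext h)).elim
  · intro t ht
    obtain ⟨ht, k, hk, hkt⟩ := (hAw t).1 ht
    have h1 := hy t k hk ht hkt
    have h2 : ((A'.σ t : S) : V) = A.σ t := hτn _ ht
    have h3 := hy (A'.σ t) (A.σ k) (hXσ k hk) (by rw [h2]; exact hXσ' _ ht)
      (by rw [h2]; exact A.adj_σ _ _ hkt)
    apply Subtype.ext
    rw [h3, ← h1]; rfl
  · rw [hHedge]
    ext e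
    induction e using Sym2.ind with | _ a b => ?_
    rw [mem_union, mem_union, mk_mem_image_edgesAvoiding, mk_mem_edgesWithin,
      SimpleGraph.mem_edgeSet]
    have hmix : ∀ a b, A.graph.Adj a b → a ∈ X → b ∉ X →
        s(a, b) ∈ {e | ∃ x, A'.graph.Adj ⟨w, hwS⟩ x ∧ e = s((y x : V), (x : V))} := by
      intro a b hab ha hb
      refine ⟨⟨b, Or.inl hb⟩, (hAw _).2 ⟨hb, a, ha, hab⟩, ?_⟩
      rw [hy ⟨b, Or.inl hb⟩ a ha hb hab]
    constructor
    · intro hab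
      by_cases ha : a ∈ X <;> by_cases hb : b ∈ X
      · exact Or.inl (Or.inl ⟨hab, ha, hb⟩)
      · exact Or.inr (hmix a b hab ha hb)
      · rw [Sym2.eq_swap]
        exact Or.inr (hmix b a hab.symm hb ha)
      · have ha' : a ≠ w := fun h => ha (h ▸ hw)
        have hb' : b ≠ w := fun h => hb (h ▸ hw)
        refine Or.inl (Or.inr ⟨Or.inl ha, Or.inl hb, ⟨(hFnn a b ha hb).2 hab, hab.ne⟩, ha', hb', ?_⟩)
        rw [hτX w hw]; exact ⟨ha', hb'⟩
    · rintro ((h | ⟨ha, hb, ⟨h, -⟩, ha', hb', -⟩) | ⟨t, ht, h⟩)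
      · exact h.1
      · exact (hFnn a b (ha.resolve_right ha') (hb.resolve_right hb')).1 h
      · obtain ⟨ht, k, hk, hkt⟩ := (hAw t).1 ht
        rw [← SimpleGraph.mem_edgeSet, h, hy t k hk ht hkt]; exact hkt

end CsGraph

/-! ### Contracting a copy of `K₄` together with its mirror image -/

namespace CsGraph

variable {V : Type u} {A : CsGraph V}

theorem tightSet_of_complete [Finite V] {K : Set V} (hK4 : K.ncard = 4)
    (hK : ∀ p ∈ K, ∀ q ∈ K, p ≠ q → A.graph.Adj p q) : A.TightSet K := by
  have h : edgesWithin A.graph.edgeSet K = {e | ∃ p ∈ K, ∃ q ∈ K, p ≠ q ∧ e = s(p, q)} := by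
    ext e
    constructor
    · induction e using Sym2.ind with | _ p q => ?_
      intro he
      obtain ⟨h, hp, hq⟩ := mk_mem_edgesWithin.1 he
      exact ⟨p, hp, q, hq, SimpleGraph.Adj.ne h, rfl⟩
    · rintro ⟨p, hp, q, hq, hpq, rfl⟩
      exact mk_mem_edgesWithin.2 ⟨hK p hp q hq hpq, hp, hq⟩
  rw [TightSet, h, ncard_pairs K (toFinite K), hK4]
  rfl

open Classical in
/-- The map sending `K` to `w` and its mirror image to the mirror image of `w`. -/
noncomputable def collapse (A : CsGraph V) (K : Set V) (w : V) (t : V) : V :=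
  if t ∈ K then w else if A.σ t ∈ K then A.σ w else t

section Collapse

variable {K : Set V} {w t : V}

theorem collapse_of_mem (ht : t ∈ K) : A.collapse K w t = w := if_pos ht

theorem collapse_of_σ_mem (hd : ∀ p ∈ K, A.σ p ∉ K) (ht : A.σ t ∈ K) :
    A.collapse K w t = A.σ w := by
  have h1 : t ∉ K := fun h => hd t h ht
  rw [collapse, if_neg h1, if_pos ht]

theorem collapse_of_notMem (ht : t ∉ K) (ht' : A.σ t ∉ K) : A.collapse K w t = t := by
  rw [collapse, if_neg ht, if_neg ht']

theorem collapse_σ (hd : ∀ p ∈ K, A.σ p ∉ K) (t : V) :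
    A.σ (A.collapse K w t) = A.collapse K w (A.σ t) := by
  by_cases ht : t ∈ K
  · rw [collapse_of_mem ht, collapse_of_σ_mem hd (by rwa [A.invol])]
  by_cases ht' : A.σ t ∈ K
  · rw [collapse_of_σ_mem hd ht', collapse_of_mem ht', A.invol]
  · rw [collapse_of_notMem ht ht', collapse_of_notMem ht' (by rwa [A.invol])]

/-- Contract K first and its mirror image afterwards. Being disjoint from K, the mirror image keeps
all its edges in the first step and is still dense enough to be contracted. -/
theorem isSparse_collapse [Finite V] (hA : IsSparse A.graph.edgeSet) (hd : ∀ p ∈ K, A.σ p ∉ K)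
    (hK : A.TightSet K) (hw : w ∈ K) :
    IsSparse (contractEdges (A.collapse K w) A.graph.edgeSet) := by
  classical
  have h1 := hA.contract hK.ge hw
  have hsub : edgesWithin A.graph.edgeSet (A.σ ⁻¹' K) ⊆
      edgesWithin (contractEdges (fun p => if p ∈ K then w else p) A.graph.edgeSet)
        (A.σ ⁻¹' K) := by
    intro e
    induction e using Sym2.ind with | _ p q => ?_
    rw [mk_mem_edgesWithin, mk_mem_edgesWithin, mk_mem_contractEdges]
    rintro ⟨h, hp, hq⟩
    have hp' : p ∉ K := fun h => hd p h hp
    have hq' : q ∉ K := fun h => hd q h hq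
    exact ⟨⟨SimpleGraph.Adj.ne h, p, q, h, (if_neg hp').symm, (if_neg hq').symm⟩, hp, hq⟩
  have h2 := h1.contract (X := A.σ ⁻¹' K) (w := A.σ w)
    (hK.preimage_σ.ge.trans (Nat.add_le_add_right (ncard_le_ncard hsub) 2))
    (by rw [mem_preimage, A.invol]; exact hw)
  refine h2.mono ?_
  have key : ∀ t, A.collapse K w t = (fun p => if p ∈ A.σ ⁻¹' K then A.σ w else p)
      ((fun p => if p ∈ K then w else p) t) := by
    intro t
    by_cases ht : t ∈ K
    · simp [collapse, ht, hd w hw]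
    · simp [collapse, ht]
  intro e
  induction e using Sym2.ind with | _ p q => ?_
  rw [mk_mem_contractEdges, mk_mem_contractEdges]
  rintro ⟨hne, a, b, hab, hp, hq⟩
  rw [key] at hp hq
  refine ⟨hne, _, _, ?_, hp, hq⟩
  rw [mk_mem_contractEdges]
  refine ⟨fun h => hne ?_, a, b, hab, rfl, rfl⟩
  rw [hp, hq, h]

end Collapse

/-- Inverse vertex-to-`K₄` move: contract a copy of `K₄` and its mirror image, if they are far
apart and every other vertex is joined to the copy by at most one edge. -/
theorem reducible_of_complete [Finite V] (hA : A.IsTight) {w a b c : V}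
    (hnd : [w, a, b, c].Nodup)
    (hK : ∀ p ∈ ({w, a, b, c} : Set V), ∀ q ∈ ({w, a, b, c} : Set V), p ≠ q → A.graph.Adj p q)
    (hd : ∀ p ∈ ({w, a, b, c} : Set V), A.σ p ∉ ({w, a, b, c} : Set V))
    (hcross : ∀ p ∈ ({w, a, b, c} : Set V), ∀ q, A.σ q ∈ ({w, a, b, c} : Set V) →
      ¬ A.graph.Adj p q)
    (hone : ∀ t, t ∉ ({w, a, b, c} : Set V) → ∀ p ∈ ({w, a, b, c} : Set V),
      ∀ q ∈ ({w, a, b, c} : Set V), A.graph.Adj p t → A.graph.Adj q t → p = q) :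
    A.Reducible := by
  classical
  obtain ⟨hAs, hAn, hAc⟩ := A.isTight_iff.1 hA
  have hnd' : w ≠ a ∧ w ≠ b ∧ w ≠ c ∧ a ≠ b ∧ a ≠ c ∧ b ≠ c := by
    simp only [List.nodup_cons, List.mem_cons, List.not_mem_nil] at hnd; grind
  set K : Set V := {w, a, b, c} with hKdef
  have hw : w ∈ K := by simp [hKdef]
  have ha : a ∈ K := by simp [hKdef]
  have hb : b ∈ K := by simp [hKdef]
  have hc : c ∈ K := by simp [hKdef]
  have hKc : K.ncard = 4 := by
    rw [hKdef, ncard_insert_of_notMem (by simp; grind),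
      ncard_eq_three.2 ⟨a, b, c, hnd'.2.2.2.1, hnd'.2.2.2.2.1, hnd'.2.2.2.2.2, rfl⟩]
  have hKt : A.TightSet K := tightSet_of_complete hKc hK
  have hσK : ∀ t, t ∈ K → A.σ (A.σ t) ∈ K := fun t ht => by rwa [A.invol]
  have hwσ : A.σ w ≠ w := fun h => hd w hw (h.symm ▸ hw)
  -- Of K only w survives, and of the mirror image of K only σ w. This set is invariant, so the
  -- original reflection can be kept.
  set S : Set V := {t | (t ∉ K ∨ t = w) ∧ (A.σ t ∉ K ∨ t = A.σ w)} with hS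
  set ρ : V → V := A.collapse K w with hρ
  have hσS : ∀ t ∈ S, A.σ t ∈ S := by
    rintro t ⟨h1, h2⟩
    refine ⟨h2.imp_right fun h => by rw [h, A.invol], ?_⟩
    rw [A.invol]
    exact h1.imp_right fun h => by rw [h]
  have hSn : ∀ t, t ∉ K → A.σ t ∉ K → t ∈ S := fun t h1 h2 => ⟨Or.inl h1, Or.inl h2⟩
  have hSn' : ∀ t ∈ S, t ≠ w → t ≠ A.σ w → t ∉ K ∧ A.σ t ∉ K := fun t ht h1 h2 =>
    ⟨ht.1.resolve_right h1, ht.2.resolve_right h2⟩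
  have hwS : w ∈ S := ⟨Or.inr rfl, Or.inl (hd w hw)⟩
  have hρw : ∀ t, ρ t ∈ K → t ∈ K := by
    intro t h
    by_contra ht
    by_cases ht' : A.σ t ∈ K
    · rw [hρ, collapse_of_σ_mem hd ht'] at h; exact hd w hw h
    · rw [hρ, collapse_of_notMem ht ht'] at h; exact ht h
  have hρw' : ∀ t, A.σ (ρ t) ∈ K → A.σ t ∈ K := by
    intro t h
    rw [hρ, collapse_σ hd] at h
    exact hρw _ h
  have hF : ∀ p ∈ S, ∀ q ∈ S, s(p, q) ∈ contractEdges ρ A.graph.edgeSet →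
      s(A.σ p, A.σ q) ∈ contractEdges ρ A.graph.edgeSet := by
    intro p _ q _ hpq
    rw [mk_mem_contractEdges] at hpq ⊢
    obtain ⟨hne, x, y, hxy, rfl, rfl⟩ := hpq
    exact ⟨fun h => hne (A.σ_injective h), A.σ x, A.σ y, A.adj_σ _ _ hxy, collapse_σ hd x,
      collapse_σ hd y⟩
  have hFnn : ∀ p q, p ∉ K → A.σ p ∉ K → q ∉ K → A.σ q ∉ K →
      (s(p, q) ∈ contractEdges ρ A.graph.edgeSet ↔ A.graph.Adj p q) := by
    intro p q hp hp' hq hq'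
    rw [mk_mem_contractEdges]
    constructor
    · rintro ⟨-, x, y, hxy, rfl, rfl⟩
      have hx : x ∉ K := fun h => hp (by rw [hρ, collapse_of_mem h]; exact hw)
      have hx' : A.σ x ∉ K := fun h => hp' (by rw [hρ, collapse_of_σ_mem hd h, A.invol]; exact hw)
      have hy : y ∉ K := fun h => hq (by rw [hρ, collapse_of_mem h]; exact hw)
      have hy' : A.σ y ∉ K := fun h => hq' (by rw [hρ, collapse_of_σ_mem hd h, A.invol]; exact hw)
      rw [hρ, collapse_of_notMem hx hx', collapse_of_notMem hy hy']
      exact hxy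
    · exact fun h => ⟨h.ne, p, q, h, (collapse_of_notMem hp hp').symm,
        (collapse_of_notMem hq hq').symm⟩
  let A' : CsGraph S := onSet S A.σ hσS (fun t _ => A.invol t) (contractEdges ρ A.graph.edgeSet) hF
  have hAw : ∀ t : S, A'.graph.Adj ⟨w, hwS⟩ t ↔
      (t : V) ∉ K ∧ A.σ t ∉ K ∧ ∃ k ∈ K, A.graph.Adj k t := by
    intro t
    rw [onSet_adj, mk_mem_contractEdges]
    constructor
    · rintro ⟨⟨hne, x, y, hxy, h1, h2⟩, -⟩
      have hx : x ∈ K := hρw x (h1 ▸ hw)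
      have hy : y ∉ K := fun h => hne (by rw [h2, hρ, collapse_of_mem h])
      have hy' : A.σ y ∉ K := fun h => hcross x hx y h hxy
      rw [hρ, collapse_of_notMem hy hy'] at h2
      rw [h2]
      exact ⟨hy, hy', x, hx, hxy⟩
    · rintro ⟨h1, h2, k, hk, hkt⟩
      have hne : w ≠ t := fun h => h1 (h ▸ hw)
      exact ⟨⟨hne, k, t, hkt, (collapse_of_mem hk).symm, (collapse_of_notMem h1 h2).symm⟩, hne⟩
  have hsp : IsSparse A'.graph.edgeSet :=
    onSet_sparse fun Y _ hY => isSparse_collapse hAs hd hKt hw Y hY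
  have hnf : A'.NoFixedEdge := by
    refine onSet_noFixedEdge ?_
    rintro p - q - hpq -
    obtain ⟨hne, x, y, hxy, rfl, rfl⟩ := mk_mem_contractEdges.1 hpq
    have hfix : ∀ t, A.σ (ρ t) = ρ t → t ∉ K ∧ A.σ t ∉ K := by
      intro t ht
      have h1 : t ∉ K := fun h => by
        rw [hρ, collapse_of_mem h] at ht; exact hwσ ht
      refine ⟨h1, fun h => ?_⟩
      rw [hρ, collapse_of_σ_mem hd h, A.invol] at ht
      exact hwσ ht.symm
    constructor
    · rintro ⟨h1, h2⟩
      obtain ⟨hx, hx'⟩ := hfix x h1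
      obtain ⟨hy, hy'⟩ := hfix y h2
      rw [hρ, collapse_of_notMem hx hx'] at h1
      rw [hρ, collapse_of_notMem hy hy'] at h2
      exact (hAn _ _ hxy).1 ⟨h1, h2⟩
    -- An edge of the quotient between mirror images would come either from an edge joining K to its
    -- mirror image, excluded by `hcross`, or from such an edge of A away from both.
    · intro h1
      rw [hρ, collapse_σ hd] at h1
      by_cases hy : y ∈ K
      · rw [collapse_of_mem hy] at h1
        exact hcross y hy x (hρw _ (by rw [hρ, h1]; exact hw)) (SimpleGraph.Adj.symm hxy)
      by_cases hy' : A.σ y ∈ K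
      · rw [collapse_of_σ_mem hd hy', ← collapse_σ hd] at h1
        exact hcross x (hρw _ (by rw [hρ, A.σ_injective h1]; exact hw)) y hy' hxy
      rw [collapse_of_notMem hy hy'] at h1
      have hx : x ∉ K := fun h => hy' (by
        rw [← h1, collapse_of_σ_mem hd (hσK x h), A.invol]; exact hw)
      have hx' : A.σ x ∉ K := fun h => hy (by rw [← h1, collapse_of_mem h]; exact hw)
      rw [collapse_of_notMem hx' (by rwa [A.invol])] at h1
      exact (hAn _ _ hxy).2 h1
  refine reducible_of_move hA hsp hnf ⟨w, hwS, A.σ w, hσS w hwS, hwσ.symm⟩ ?_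
    (Or.inr (Or.inr (Or.inr (Or.inl ?_))))
  · intro h
    have : a ∈ S := h ▸ mem_univ a
    rcases this.1 with h | h
    exacts [h ha, hnd'.1 h.symm]
  -- The re-attachment point is the unique neighbour of t in K; the default w is irrelevant.
  let d : S → V := fun t => if h : ∃ k ∈ K, A.graph.Adj k t then h.choose else w
  have hdK : ∀ t : S, ∀ k ∈ K, (t : V) ∉ K → A.graph.Adj k t → d t = k := by
    intro t k hk ht hkt
    have hex : ∃ k ∈ K, A.graph.Adj k t := ⟨k, hk, hkt⟩
    simp only [d, hex, dif_pos]
    exact hone t ht _ hex.choose_spec.1 _ hk hex.choose_spec.2 hkt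
  refine ⟨Subtype.val, ⟨w, hwS⟩, a, b, c, d, fun h => hwσ (Subtype.ext_iff.1 h), ?_, ?_, ?_, ?_⟩
  · have h1 : ∀ p ∈ K, ∀ q ∈ K, p ≠ A.σ q := fun p hp q hq h => hd q hq (h ▸ hp)
    have h2 := h1 a ha
    have h3 := h1 b hb
    have h4 := h1 c hc
    have h5 : ∀ p q, p ≠ q → A.σ p ≠ A.σ q := fun p q h h' => h (A.σ_injective h')
    simp only [List.nodup_cons, List.mem_cons, List.not_mem_nil]
    grind
  · refine onSet_isVertexExtension (fun _ _ => rfl) ?_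
    have hσ : ∀ s t, A.σ s = t ↔ s = A.σ t := fun s t =>
      ⟨fun h => by rw [← h, A.invol], fun h => by rw [h, A.invol]⟩
    ext t
    simp only [hS, mem_compl_iff, mem_ofPred_eq, hKdef, mem_insert_iff, mem_singleton_iff, hσ]
    have h1 := hnd'.1
    have h2 := hnd'.2.1
    have h3 := hnd'.2.2.1
    have h5 : ∀ p q, p ≠ q → A.σ p ≠ A.σ q := fun p q h h' => h (A.σ_injective h')
    have h6 := h5 _ _ h1
    have h7 := h5 _ _ h2
    have h8 := h5 _ _ h3
    have e1 : a ≠ A.σ w := fun h => hd w hw (h ▸ ha)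
    have e2 : b ≠ A.σ w := fun h => hd w hw (h ▸ hb)
    have e3 : c ≠ A.σ w := fun h => hd w hw (h ▸ hc)
    grind
  · intro t ht
    obtain ⟨h1, -, k, hk, hkt⟩ := (hAw t).1 ht
    rw [hdK t k hk h1 hkt]; exact hk
  · ext e
    induction e using Sym2.ind with | _ p q => ?_
    rw [mem_union, mem_union, mk_mem_image_edgesAvoiding, SimpleGraph.mem_edgeSet]
    have hmix : ∀ p q, A.graph.Adj p q → p ∈ K → q ∉ K → ∃ x : S,
        A'.graph.Adj ⟨w, hwS⟩ x ∧ d x = p ∧ (x : V) = q := by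
      intro p q hpq hp hq
      have hq' : A.σ q ∉ K := fun h => hcross p hp q h hpq
      exact ⟨⟨q, hSn q hq hq'⟩, (hAw _).2 ⟨hq, hq', p, hp, hpq⟩,
        hdK ⟨q, hSn q hq hq'⟩ p hp hq hpq, rfl⟩
    have hin : ∀ p q, A.graph.Adj p q → p ∈ K →
        s(p, q) ∈ {e | ∃ x, A'.graph.Adj ⟨w, hwS⟩ x ∧
          (e = s(d x, (x : V)) ∨ e = s(A.σ (d x), ((A'.σ x : S) : V)))} ∨
        s(p, q) ∈ {e | ∃ p ∈ K, ∃ q ∈ K, p ≠ q ∧ (e = s(p, q) ∨ e = s(A.σ p, A.σ q))} := by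
      intro p q hpq hp
      by_cases hq : q ∈ K
      · exact Or.inr ⟨p, hp, q, hq, hpq.ne, Or.inl rfl⟩
      · obtain ⟨x, hx, h1, h2⟩ := hmix p q hpq hp hq
        exact Or.inl ⟨x, hx, Or.inl (by rw [h1, h2])⟩
    have hin' : ∀ p q, A.graph.Adj p q → A.σ p ∈ K →
        s(p, q) ∈ {e | ∃ x, A'.graph.Adj ⟨w, hwS⟩ x ∧
          (e = s(d x, (x : V)) ∨ e = s(A.σ (d x), ((A'.σ x : S) : V)))} ∨
        s(p, q) ∈ {e | ∃ p ∈ K, ∃ q ∈ K, p ≠ q ∧ (e = s(p, q) ∨ e = s(A.σ p, A.σ q))} := by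
      intro p q hpq hp
      by_cases hq : A.σ q ∈ K
      · exact Or.inr ⟨_, hp, _, hq, (A.adj_σ _ _ hpq).ne, Or.inr (by rw [A.invol, A.invol])⟩
      · obtain ⟨x, hx, h1, h2⟩ := hmix _ _ (A.adj_σ _ _ hpq) hp hq
        have h3 : ((A'.σ x : S) : V) = q := by
          change A.σ x = q; rw [h2, A.invol]
        exact Or.inl ⟨x, hx, Or.inr (by rw [h1, h3, A.invol])⟩
    constructor
    · intro hpq
      by_cases hp : p ∈ K
      · have := hin p q hpq hp; tauto
      by_cases hp' : A.σ p ∈ K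
      · have := hin' p q hpq hp'; tauto
      by_cases hq : q ∈ K
      · have := hin q p hpq.symm hq; rw [Sym2.eq_swap] at this; tauto
      by_cases hq' : A.σ q ∈ K
      · have := hin' q p hpq.symm hq'; rw [Sym2.eq_swap] at this; tauto
      refine Or.inl (Or.inl ⟨hSn p hp hp', hSn q hq hq', ⟨(hFnn p q hp hp' hq hq').2 hpq, hpq.ne⟩,
        fun h => hp (h ▸ hw), fun h => hq (h ▸ hw), fun h => hp' ?_, fun h => hq' ?_⟩)
      · rw [h]; exact hσK w hw
      · rw [h]; exact hσK w hw
    · rintro ((⟨hp, hq, ⟨h, -⟩, hp1, hq1, hp2, hq2⟩ | ⟨x, hx, h | h⟩) |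
        ⟨k, hk, l, hl, hkl, h | h⟩)
      · obtain ⟨hp, hp'⟩ := hSn' p hp hp1 hp2
        obtain ⟨hq, hq'⟩ := hSn' q hq hq1 hq2
        exact (hFnn p q hp hp' hq hq').1 h
      · obtain ⟨h1, -, k, hk, hkt⟩ := (hAw x).1 hx
        rw [← SimpleGraph.mem_edgeSet, h, hdK x k hk h1 hkt]; exact hkt
      · obtain ⟨h1, -, k, hk, hkt⟩ := (hAw x).1 hx
        rw [← SimpleGraph.mem_edgeSet, h, hdK x k hk h1 hkt]; exact A.adj_σ _ _ hkt
      · rw [← SimpleGraph.mem_edgeSet, h]; exact hK k hk l hl hkl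
      · rw [← SimpleGraph.mem_edgeSet, h]; exact A.adj_σ _ _ (hK k hk l hl hkl)

end CsGraph

/-! ### Irreducible graphs -/

namespace CsGraph

variable {V : Type u} {A : CsGraph V}

theorem adj_σ_comm {p q : V} (hpq : A.graph.Adj p (A.σ q)) : A.graph.Adj q (A.σ p) := by
  have := (A.adj_σ _ _ hpq).symm
  rwa [A.invol] at this

/-- Let X be a largest proper invariant tight set with at least two vertices. If an outside vertex t
had two neighbours in X, adding t and σ t to X would give a larger invariant tight set, hence the
whole vertex set. As t is adjacent neither to itself nor to σ t, all its neighbours would lie in X,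
where it has at most two, against minimum degree three. So X can be contracted. -/
theorem reducible_or_irreducible [Finite V] [Nontrivial V] (hA : A.IsTight) :
    A.Reducible ∨ A.Irreducible := by
  obtain ⟨hAs, hAn, hAc⟩ := A.isTight_iff.1 hA
  by_cases h3 : ∀ v, 3 ≤ (A.graph.neighborSet v).ncard
  swap
  · obtain ⟨v, hv⟩ := not_forall.1 h3
    have h2 := two_le_ncard_neighborSet hAs hAc v
    left
    by_cases hf : A.σ v = v
    · exact reducible_of_fixed_degree_two hA hf (by omega)
    · exact reducible_of_degree_two hA hf (by omega)
  by_cases hX : ∀ X : Set V, (∀ x ∈ X, A.σ x ∈ X) → 2 ≤ X.ncard → A.TightSet X → X = univ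
  · exact Or.inr ⟨hAs, hAn, hAc, h3, hX⟩
  left
  let 𝒳 : Set (Set V) := {X | (∀ x ∈ X, A.σ x ∈ X) ∧ 2 ≤ X.ncard ∧ A.TightSet X ∧ X ≠ univ}
  have h𝒳 : 𝒳.Nonempty := by
    push Not at hX
    exact hX
  obtain ⟨X, ⟨hXσ, hX2, hXt, hXu⟩, hmax⟩ := exists_max_image 𝒳 ncard (toFinite _) h𝒳
  refine reducible_of_tightSet hA hXσ hXt hX2 hXu fun t ht a ha b hb hat hbt => ?_
  by_contra hab
  have hT := hXt.insert hAs ht ha hb hab hat.symm hbt.symm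
  have hU := (hAs.union_inter_tight hT hT.preimage_σ
    ⟨a, Or.inr ha, (Or.inr (hXσ a ha) : A.σ a ∈ insert t X)⟩).1
  set U := insert t X ∪ A.σ ⁻¹' insert t X with hUdef
  have hUσ : ∀ x ∈ U, A.σ x ∈ U := by
    rintro x (hx | hx)
    exacts [Or.inr (by rw [mem_preimage, A.invol]; exact hx), Or.inl hx]
  have hXU : X ⊂ U := ⟨fun x hx => Or.inl (Or.inr hx), fun h' => ht (h' (Or.inl (Or.inl rfl)))⟩
  have hlt := ncard_lt_ncard hXU
  have hUu : U = univ := by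
    by_contra hne
    have := hmax U ⟨hUσ, by omega, hU, hne⟩
    omega
  have h2 := hXt.ncard_le_two hAs ht
  have hsub : A.graph.neighborSet t ⊆ {x | x ∈ X ∧ A.graph.Adj t x} := by
    intro s hs
    rw [SimpleGraph.mem_neighborSet] at hs
    refine ⟨?_, hs⟩
    have hsU : s ∈ U := hUu ▸ mem_univ s
    rcases hsU with (h' | h') | (h' | h')
    · exact (hs.ne h'.symm).elim
    · exact h'
    · exact ((hAn _ _ hs).2 (by rw [← h', A.invol])).elim
    · rw [← A.invol s]; exact hXσ _ h'
  have h4 := ncard_le_ncard hsub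
  have h5 := h3 t
  omega

/-! ### Recognising the six base graphs inside an irreducible graph -/

namespace Irreducible

variable [Finite V]

theorem isomorphic_of_list (h : A.Irreducible) {n : ℕ} (hn : 2 ≤ n) {B : CsGraph (Fin n)}
    {L : List (Fin n × Fin n)} (hBL : B.graph = SimpleGraph.fromRel fun i j => (i, j) ∈ L)
    (hB : B.IsTight) (f : Fin n → V) (hf : (List.ofFn f).Nodup)
    (hσ : ∀ i, f (B.σ i) = A.σ (f i)) (hadj : ∀ e ∈ L, A.graph.Adj (f e.1) (f e.2)) :
    A.Isomorphic B := by
  refine h.isomorphic_of_hom hn hB f (List.nodup_ofFn.1 hf) hσ fun i j hij => ?_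
  rw [hBL, SimpleGraph.fromRel_adj] at hij
  rcases hij.2 with h' | h'
  exacts [hadj _ h', (hadj _ h').symm]

theorem isomorphic_baseWd42 (h : A.Irreducible) {c p q r : V} (hc : A.σ c = c)
    (hcp : A.graph.Adj c p) (hcq : A.graph.Adj c q) (hcr : A.graph.Adj c r)
    (hpq : A.graph.Adj p q) (hpr : A.graph.Adj p r) (hqr : A.graph.Adj q r) :
    A.Isomorphic baseWd42 := by
  have h1 := fun a b hab => h.noFixedEdge a b hab
  have h2 := A.invol
  have h3 := fun a b (hab : A.graph.Adj a b) => hab.ne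
  have h4 := A.adj_σ
  have hs := fun a b (hab : A.graph.Adj a b) => hab.symm
  refine h.isomorphic_of_list (by norm_num) rfl baseWd42_isTight
    ![p, q, r, A.σ q, A.σ r, A.σ p, c] ?_ ?_ ?_
  -- Coincidences between p, q, r and their mirror images would produce fixed edges: σ p = p would
  -- fix cp, and σ p = q would fix pq. Distinctness in the other recognition lemmas is obtained in a
  -- similar way.
  · simp only [List.ofFn_succ, List.ofFn_zero, List.nodup_cons, List.mem_cons, List.not_mem_nil,
      Matrix.cons_val]
    simp
    grind
  · intro i
    fin_cases i <;> simp [baseWd42, A.invol, hc]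
  · simp
    grind

theorem isomorphic_baseF2 (h : A.Irreducible) {p q r s : V}
    (hpq : A.graph.Adj p q) (hpr : A.graph.Adj p r) (hps : A.graph.Adj p s)
    (hqr : A.graph.Adj q r) (hqs : A.graph.Adj q s) (hrs : A.graph.Adj r s)
    (hp : A.σ p ≠ p) (hq : A.σ q ≠ q) (hr : A.σ r ≠ r) (hs' : A.σ s ≠ s)
    (hpq' : A.graph.Adj p (A.σ q)) : A.Isomorphic baseF2 := by
  have h1 := fun a b hab => h.noFixedEdge a b hab
  have h2 := A.invol
  have h3 := fun a b (hab : A.graph.Adj a b) => hab.ne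
  have h4 := A.adj_σ
  have hs := fun a b (hab : A.graph.Adj a b) => hab.symm
  have h5 := adj_σ_comm hpq'
  refine h.isomorphic_of_list (by norm_num) rfl baseF2_isTight
    ![r, s, p, q, A.σ p, A.σ q, A.σ r, A.σ s] ?_ ?_ ?_
  · simp only [List.ofFn_succ, List.ofFn_zero, List.nodup_cons, List.mem_cons, List.not_mem_nil,
      Matrix.cons_val]
    simp
    grind
  · intro i
    fin_cases i <;> simp [baseF2, A.invol]
  · simp
    grind

theorem isomorphic_baseW5 (h : A.Irreducible) {v x y : V} (hx : A.σ x = x)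
    (hvx : A.graph.Adj v x) (hvy : A.graph.Adj v y) (hvy' : A.graph.Adj v (A.σ y))
    (hxy : A.graph.Adj x y) : A.Isomorphic baseW5 := by
  have h1 := fun a b hab => h.noFixedEdge a b hab
  have h2 := A.invol
  have h3 := fun a b (hab : A.graph.Adj a b) => hab.ne
  have h4 := A.adj_σ
  have hs := fun a b (hab : A.graph.Adj a b) => hab.symm
  have h5 := adj_σ_comm hvy'
  refine h.isomorphic_of_list (by norm_num) rfl baseW5_isTight
    ![v, y, x, A.σ v, A.σ y] ?_ ?_ ?_
  · simp only [List.ofFn_succ, List.ofFn_zero, List.nodup_cons, List.mem_cons, List.not_mem_nil,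
      Matrix.cons_val]
    simp
    grind
  · intro i
    fin_cases i <;> simp [baseW5, A.invol, hx]
  · simp
    grind

theorem isomorphic_baseF1 (h : A.Irreducible) {v x y : V} (hv : A.σ v ≠ v) (hx : A.σ x ≠ x)
    (hy : A.σ y ≠ y) (hvx : A.graph.Adj v x) (hvy : A.graph.Adj v y)
    (hvy' : A.graph.Adj v (A.σ y)) (hxy : A.graph.Adj x y) (hxy' : A.graph.Adj x (A.σ y)) :
    A.Isomorphic baseF1 := by
  have h1 := fun a b hab => h.noFixedEdge a b hab
  have h2 := A.invol
  have h3 := fun a b (hab : A.graph.Adj a b) => hab.ne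
  have h4 := A.adj_σ
  have hs := fun a b (hab : A.graph.Adj a b) => hab.symm
  have h5 := adj_σ_comm hvy'
  have h6 := adj_σ_comm hxy'
  refine h.isomorphic_of_list (by norm_num) rfl baseF1_isTight
    ![y, v, x, A.σ v, A.σ x, A.σ y] ?_ ?_ ?_
  · simp only [List.ofFn_succ, List.ofFn_zero, List.nodup_cons, List.mem_cons, List.not_mem_nil,
      Matrix.cons_val]
    simp
    grind
  · intro i
    fin_cases i <;> simp [baseF1, A.invol]
  · simp
    grind

theorem isomorphic_baseF1' (h : A.Irreducible) {v x y z : V} (hy : A.σ y = y) (hz : A.σ z = z)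
    (hyz : y ≠ z) (hvx : A.graph.Adj v x) (hvy : A.graph.Adj v y) (hvz : A.graph.Adj v z)
    (hxy : A.graph.Adj x y) (hxz : A.graph.Adj x z) : A.Isomorphic baseF1' := by
  have h1 := fun a b hab => h.noFixedEdge a b hab
  have h2 := A.invol
  have h3 := fun a b (hab : A.graph.Adj a b) => hab.ne
  have h4 := A.adj_σ
  have hs := fun a b (hab : A.graph.Adj a b) => hab.symm
  refine h.isomorphic_of_list (by norm_num) rfl baseF1'_isTight
    ![v, x, y, z, A.σ v, A.σ x] ?_ ?_ ?_
  · simp only [List.ofFn_succ, List.ofFn_zero, List.nodup_cons, List.mem_cons, List.not_mem_nil,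
      Matrix.cons_val]
    simp
    grind
  · intro i
    fin_cases i <;> simp [baseF1', A.invol, hy, hz]
  · simp
    grind

theorem isomorphic_baseK34 (h : A.Irreducible) {v w x y z : V} (hx : A.σ x = x) (hy : A.σ y = y)
    (hz : A.σ z = z) (hxy : x ≠ y) (hxz : x ≠ z) (hyz : y ≠ z) (hvw : w ≠ v) (hvw' : w ≠ A.σ v)
    (hvx : A.graph.Adj v x) (hvy : A.graph.Adj v y) (hvz : A.graph.Adj v z)
    (hwx : A.graph.Adj w x) (hwy : A.graph.Adj w y) (hwz : A.graph.Adj w z) :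
    A.Isomorphic baseK34 := by
  have h1 := fun a b hab => h.noFixedEdge a b hab
  have h2 := A.invol
  have h3 := fun a b (hab : A.graph.Adj a b) => hab.ne
  have h4 := A.adj_σ
  have hs := fun a b (hab : A.graph.Adj a b) => hab.symm
  refine h.isomorphic_of_list (by norm_num) rfl baseK34_isTight
    ![v, w, x, y, z, A.σ v, A.σ w] ?_ ?_ ?_
  · simp only [List.ofFn_succ, List.ofFn_zero, List.nodup_cons, List.mem_cons, List.not_mem_nil,
      Matrix.cons_val]
    simp
    grind
  · intro i
    fin_cases i <;> simp [baseK34, A.invol, hx, hy, hz]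
  · simp
    grind

end Irreducible

end CsGraph

/-! ### Case analysis at a vertex of degree three -/

namespace CsGraph

variable {V : Type u} {A : CsGraph V}

/-- The vertex `v` is not fixed and has exactly the three neighbours `x`, `y`, `z`. -/
structure HasNeighbors (A : CsGraph V) (v x y z : V) : Prop where
  ne_self : A.σ v ≠ v
  adj_iff : ∀ t, A.graph.Adj v t ↔ t = x ∨ t = y ∨ t = z
  ne₁₂ : x ≠ y
  ne₁₃ : x ≠ z
  ne₂₃ : y ≠ z

namespace HasNeighbors

variable {v x y z : V}

theorem swap (hn : A.HasNeighbors v x y z) : A.HasNeighbors v y x z :=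
  ⟨hn.1, fun t => by rw [hn.2]; tauto, hn.3.symm, hn.5, hn.4⟩

theorem swap' (hn : A.HasNeighbors v x y z) : A.HasNeighbors v x z y :=
  ⟨hn.1, fun t => by rw [hn.2]; tauto, hn.4, hn.3, hn.5.symm⟩

theorem rotate (hn : A.HasNeighbors v x y z) : A.HasNeighbors v y z x := hn.swap.swap'

theorem adj₁ (hn : A.HasNeighbors v x y z) : A.graph.Adj v x := (hn.adj_iff x).2 (Or.inl rfl)

theorem adj₂ (hn : A.HasNeighbors v x y z) : A.graph.Adj v y := hn.swap.adj₁

theorem adj₃ (hn : A.HasNeighbors v x y z) : A.graph.Adj v z := hn.rotate.adj₂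

end HasNeighbors

/-- `{x, y}` is the set of ends of an edge that would be fixed by the reflection. -/
def FixedPair (A : CsGraph V) (x y : V) : Prop :=
  A.σ x = y ∨ A.σ x = x ∧ A.σ y = y

theorem FixedPair.symm {x y : V} (h : A.FixedPair x y) : A.FixedPair y x := by
  rcases h with h | h
  · exact Or.inl (by rw [← h, A.invol])
  · exact Or.inr h.symm

/-- A tight set through `v`, `x`, `y` avoiding `z`. -/
def Blocked (A : CsGraph V) (v x y z : V) : Prop :=
  ∃ T, A.TightSet T ∧ v ∈ T ∧ x ∈ T ∧ y ∈ T ∧ z ∉ T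

theorem Blocked.symm {v x y z : V} (h : A.Blocked v x y z) : A.Blocked v y x z := by
  obtain ⟨T, h0, h1, h2, h3, h4⟩ := h
  exact ⟨T, h0, h1, h3, h2, h4⟩

namespace Irreducible

variable [Finite V] {v x y z : V}

/-- If all three alternatives fail, the inverse 1-extension adding the edge xy works. A tight set Y
through x and y avoiding v and σ v stays tight when v is added, and it misses z because v has at
most two neighbours in Y; so it would block the pair. -/
theorem pair_cases (h : A.Irreducible) (hr : ¬ A.Reducible) (hn : A.HasNeighbors v x y z) :
    A.graph.Adj x y ∨ A.FixedPair x y ∨ A.Blocked v x y z := by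
  by_contra! hcon
  obtain ⟨h1, h2, h3⟩ := hcon
  rw [FixedPair, not_or] at h2
  refine hr (h.reducible_of_oneExtension hn.ne_self hn.adj_iff hn.ne₁₂ hn.ne₁₃ hn.ne₂₃ h1 h2.2 h2.1
    fun Y hY hx hy hv hv' => h3 ?_)
  refine ⟨insert v Y, hY.insert h.sparse hv hx hy hn.ne₁₂ hn.adj₁ hn.adj₂, Or.inl rfl, Or.inr hx,
    Or.inr hy, ?_⟩
  rintro (hz | hz)
  · exact hn.adj₃.ne hz.symm
  · exact hY.not_three h.sparse hv hx hy hz hn.ne₁₂ hn.ne₁₃ hn.ne₂₃ hn.adj₁ hn.adj₂ hn.adj₃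

/-- The intersection of the two blocking sets is tight and contains v and x but neither y nor z. So
v would have degree one in a tight set with at least two vertices. -/
theorem not_blocked_and_blocked (h : A.Irreducible) (hn : A.HasNeighbors v x y z)
    (h₁ : A.Blocked v x y z) (h₂ : A.Blocked v x z y) : False := by
  obtain ⟨T, hT, hvT, hxT, -, hzT⟩ := h₁
  obtain ⟨S, hS, hvS, hxS, -, hyS⟩ := h₂
  have ht : A.TightSet (T ∩ S) := (h.sparse.union_inter_tight hT hS ⟨v, hvT, hvS⟩).2
  have h1 := ht.two_le_ncard h.sparse ⟨hvT, hvS⟩ ⟨hxT, hxS⟩ hn.adj₁.ne'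
  have h2 : {t | t ∈ T ∩ S ∧ A.graph.Adj v t} ⊆ {x} := by
    rintro t ⟨⟨ht1, ht2⟩, ht3⟩
    rcases (hn.adj_iff t).1 ht3 with rfl | rfl | rfl
    exacts [rfl, (hyS ht2).elim, (hzT ht1).elim]
  have h3 := ncard_le_ncard h2
  rw [ncard_singleton] at h3
  omega

/-- The blocking set T contains two neighbours v and z of x, so T ∪ {x} is tight. It contains x and
y together with their mirror images, hence is everything; but then all neighbours of x lie in T,
where there are at most two. -/
theorem not_adj_and_fixedPair_and_blocked (h : A.Irreducible) (hn : A.HasNeighbors v x y z)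
    (h₁ : A.graph.Adj x z) (h₂ : A.FixedPair x y) (h₃ : A.Blocked v y z x) : False := by
  obtain ⟨T, hT, hvT, hyT, hzT, hxT⟩ := h₃
  have hI := hT.insert h.sparse hxT hvT hzT hn.adj₃.ne hn.adj₁.symm h₁
  have hx : x ∈ insert x T := Or.inl rfl
  have hy : y ∈ insert x T := Or.inr hyT
  have hall : ∀ t, t ∈ insert x T := by
    rcases h₂ with h₂ | ⟨h₂, h₂'⟩
    · refine h.mem_of_tightSet hI hn.ne₁₂ hx (by rwa [h₂]) hy ?_
      rw [← h₂, A.invol]; exact hx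
    · exact h.mem_of_tightSet hI hn.ne₁₂ hx (by rwa [h₂]) hy (by rwa [h₂'])
  have h1 := hT.ncard_le_two h.sparse hxT
  have h2 : A.graph.neighborSet x ⊆ {t | t ∈ T ∧ A.graph.Adj x t} := fun t ht =>
    ⟨(hall t).resolve_left (SimpleGraph.Adj.ne ht).symm, ht⟩
  have h3 := ncard_le_ncard h2
  have h4 := h.three_le x
  omega

/-- The pair yz cannot be blocked, since x would have the three neighbours v, y, z in the blocking
set. So yz is a fixed pair: if y and z are exchanged the graph is `W₅` or the `F₁` without fixed
vertices, according as x is fixed or not, and if both are fixed it is the other `F₁`. -/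
theorem isBase_of_adj_of_adj (h : A.Irreducible) (hr : ¬ A.Reducible)
    (hn : A.HasNeighbors v x y z) (hxy : A.graph.Adj x y) (hxz : A.graph.Adj x z)
    (hyz : ¬ A.graph.Adj y z) : A.IsBase := by
  rcases h.pair_cases hr hn.rotate with h1 | (h1 | ⟨h1, h2⟩) | ⟨T, hT, hvT, hyT, hzT, hxT⟩
  · exact (hyz h1).elim
  · subst h1
    by_cases hx : A.σ x = x
    · exact Or.inr (Or.inl (h.isomorphic_baseW5 hx hn.adj₁ hn.adj₂ hn.adj₃ hxy))
    · exact Or.inr (Or.inr (Or.inr (Or.inl (h.isomorphic_baseF1 hn.ne_self hx hn.ne₂₃.symm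
        hn.adj₁ hn.adj₂ hn.adj₃ hxy hxz))))
  · exact Or.inr (Or.inr (Or.inr (Or.inr (Or.inl (h.isomorphic_baseF1' h1 h2 hn.ne₂₃
      hn.adj₁ hn.adj₂ hn.adj₃ hxy hxz)))))
  · exact (hT.not_three h.sparse hxT hvT hyT hzT hn.adj₂.ne hn.adj₃.ne hn.ne₂₃ hn.adj₁.symm
      hxy hxz).elim

/-- If v and σ v are the only common neighbours of x and y, these two fixed vertices can be merged.
Otherwise let w be a further one. If w is adjacent to z, the graph is `K_{3,4}`; if not, v can be
merged with w, because a tight set through w and the fixed vertex z covers everything together with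
its mirror image and so cannot avoid v and σ v. -/
theorem isBase_of_fixed (h : A.Irreducible) (hr : ¬ A.Reducible)
    (hn : A.HasNeighbors v x y z) (hx : A.σ x = x) (hy : A.σ y = y) (hz : A.σ z = z) :
    A.IsBase := by
  have hσ : ∀ p, A.σ p = p → A.graph.Adj v p → A.graph.Adj p v ∧ A.graph.Adj p (A.σ v) := by
    intro p hp hvp
    refine ⟨hvp.symm, ?_⟩
    have := A.adj_σ _ _ hvp.symm
    rwa [hp] at this
  obtain ⟨w, hxw, hyw, hwv⟩ : ∃ w, A.graph.Adj x w ∧ A.graph.Adj y w ∧ ¬ (w = v ∨ w = A.σ v) := by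
    by_contra! hcon
    refine hr (h.reducible_of_merge_fixed hx hy hn.ne₁₂ hn.ne_self fun t =>
      ⟨fun ht => hcon t ht.1 ht.2, ?_⟩)
    rintro (rfl | rfl)
    · exact ⟨hn.adj₁.symm, hn.adj₂.symm⟩
    · exact ⟨(hσ x hx hn.adj₁).2, (hσ y hy hn.adj₂).2⟩
  rw [not_or] at hwv
  have hw : A.σ w ≠ w := fun hw => (h.noFixedEdge _ _ hxw).1 ⟨hx, hw⟩
  have hfix : ∀ t, A.graph.Adj v t → A.σ t = t := by
    intro t ht
    rcases (hn.adj_iff t).1 ht with rfl | rfl | rfl <;> assumption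
  by_cases hwz : A.graph.Adj w z
  · exact Or.inr (Or.inr (Or.inr (Or.inr (Or.inr (h.isomorphic_baseK34 hx hy hz hn.ne₁₂ hn.ne₁₃
      hn.ne₂₃ hwv.1 hwv.2 hn.adj₁ hn.adj₂ hn.adj₃ hxw.symm hyw.symm hwz)))))
  · refine (hr (h.reducible_of_merge (p := w) hn.ne_self hn.adj_iff hn.ne₁₂ hwv.1 hwv.2
      (fun hvw => hw (hfix w hvw)) (fun hvw => hw (A.σ_injective (hfix _ hvw))) hxw.symm hyw.symm
      hwz (fun h' => (hw h').elim) fun Y hY hwY hzY hv hv' => ?_)).elim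
    have hne : z ≠ w := fun h' => hw (h' ▸ hz)
    rcases h.mem_or_mem_of_tightSet hY hne hzY (by rwa [hz]) hwY v with h' | h'
    exacts [hv h', hv' h']

/-- A vertex outside a copy of `K₄` with two neighbours in it can be merged with a vertex of
degree three of the copy. -/
theorem reducible_of_complete_of_adj (h : A.Irreducible) (hn : A.HasNeighbors v x y z)
    {K : Set V} (hK4 : K.ncard = 4) (hK : ∀ p ∈ K, ∀ q ∈ K, p ≠ q → A.graph.Adj p q)
    (hd : ∀ p ∈ K, A.σ p ∉ K) (hcross : ∀ p ∈ K, ∀ q, A.σ q ∈ K → ¬ A.graph.Adj p q)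
    (hv : v ∈ K) (hx : x ∈ K) (hy : y ∈ K) (hz : z ∈ K) {p : V} (hp : p ∉ K)
    (hpx : A.graph.Adj x p) (hpy : A.graph.Adj y p) : A.Reducible := by
  have hKt := tightSet_of_complete hK4 hK
  have hvK : ∀ t, A.graph.Adj v t → t ∈ K := by
    intro t ht
    rcases (hn.adj_iff t).1 ht with rfl | rfl | rfl <;> assumption
  have hσp : A.σ p ∉ K := fun h' => hcross x hx p h' hpx
  refine h.reducible_of_merge (p := p) hn.ne_self hn.adj_iff hn.ne₁₂ (fun h' => hp (h' ▸ hv))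
    (fun h' => hσp (by rw [h', A.invol]; exact hv)) (fun h' => hp (hvK _ h'))
    (fun h' => hσp (hvK _ h')) hpx.symm hpy.symm
    (fun h' => hKt.not_three h.sparse hp hx hy hz hn.ne₁₂ hn.ne₁₃ hn.ne₂₃ hpx.symm hpy.symm h')
    (fun _ => ⟨fun h' => hd z hz (h'.symm ▸ hz), fun t ht ht' => (hd t (hvK t ht) (hvK _ ht')).elim⟩)
    fun Y hY hpY hzY hvY _ => ?_
  have ht : A.TightSet (Y ∩ K) := (h.sparse.union_inter_tight hY hKt ⟨z, hzY, hz⟩).2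
  have h1 : (Y ∩ K).ncard < K.ncard :=
    ncard_lt_ncard ⟨inter_subset_right, fun h' => hvY (h' hv).1⟩
  have h2 := ncard_edgesWithin_le_choose (E := A.graph.edgeSet) (by simp) (Y ∩ K)
  -- Y ∩ K is tight with fewer than four vertices. Two or three vertices carry too few edges to be
  -- tight, so z is its only element.
  have hxY : x ∉ Y := by
    intro hxY
    have h3 : ({x, z} : Set V) ⊆ Y ∩ K := by
      rintro t (rfl | rfl)
      exacts [⟨hxY, hx⟩, ⟨hzY, hz⟩]
    have h4 := ncard_le_ncard h3
    rw [ncard_pair hn.ne₁₃] at h4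
    rw [TightSet] at ht
    rw [hK4] at h1
    generalize (Y ∩ K).ncard = n at *
    interval_cases n <;> simp only [Nat.choose] at h2 <;> omega
  -- The edge px runs between Y \ K and K \ Y, so the union of the tight sets Y and K would exceed
  -- the sparsity bound.
  have h3 := ncard_edgesWithin_add_lt (SimpleGraph.mem_edgeSet _ |>.2 hpx.symm) hpY hp hx hxY
  have h4 := h.sparse (Y ∪ K) ⟨z, Or.inl hzY⟩
  have h5 := ncard_union_add_ncard_inter Y K
  rw [TightSet] at hKt ht hY
  omega

/-- The vertex v and its neighbours form a `K₄`. A vertex of it whose mirror image is also in it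
must be fixed, which gives `Wd(4,2)`; if the copy is disjoint from its mirror image but joined to it
by an edge, the graph is `F₂`. Otherwise the copy can be contracted, unless an outside vertex has
two neighbours in it; these differ from v, and `reducible_of_complete_of_adj` applies. -/
theorem isBase_of_complete (h : A.Irreducible) (hr : ¬ A.Reducible)
    (hn : A.HasNeighbors v x y z) (hxy : A.graph.Adj x y) (hxz : A.graph.Adj x z)
    (hyz : A.graph.Adj y z) : A.IsBase := by
  have hvx := hn.adj₁
  have hvy := hn.adj₂
  have hvz := hn.adj₃
  have hnd : [v, x, y, z].Nodup := by
    have := hvx.ne; have := hvy.ne; have := hvz.ne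
    have := hxy.ne; have := hxz.ne; have := hyz.ne
    simp; tauto
  have hK : ∀ p ∈ ({v, x, y, z} : Set V), ∀ q ∈ ({v, x, y, z} : Set V), p ≠ q →
      A.graph.Adj p q := by
    rintro p (rfl | rfl | rfl | rfl) q (rfl | rfl | rfl | rfl) hpq <;>
      first | exact (hpq rfl).elim | assumption | (apply SimpleGraph.Adj.symm; assumption)
  by_cases hd : ∀ p ∈ ({v, x, y, z} : Set V), A.σ p ∉ ({v, x, y, z} : Set V)
  swap
  · push Not at hd
    obtain ⟨p, hp, hp'⟩ := hd
    have hpp : A.σ p = p := by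
      by_contra hne
      exact (h.noFixedEdge _ _ (hK p hp _ hp' (Ne.symm hne))).2 rfl
    refine Or.inr (Or.inr (Or.inl ?_))
    rcases hp with rfl | rfl | rfl | rfl
    · exact (hn.ne_self hpp).elim
    · exact h.isomorphic_baseWd42 hpp hvx.symm hxy hxz hvy hvz hyz
    · exact h.isomorphic_baseWd42 hpp hvy.symm hxy.symm hyz hvx hvz hxz
    · exact h.isomorphic_baseWd42 hpp hvz.symm hxz.symm hyz.symm hvx hvy hxy
  have hself : ∀ p ∈ ({v, x, y, z} : Set V), A.σ p ≠ p := fun p hp h' => hd p hp (h'.symm ▸ hp)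
  have hK4 : ({v, x, y, z} : Set V).ncard = 4 := by
    rw [ncard_insert_of_notMem (by simp; exact ⟨hvx.ne, hvy.ne, hvz.ne⟩),
      ncard_eq_three.2 ⟨x, y, z, hxy.ne, hxz.ne, hyz.ne, rfl⟩]
  by_cases hcross : ∀ p ∈ ({v, x, y, z} : Set V), ∀ q, A.σ q ∈ ({v, x, y, z} : Set V) →
      ¬ A.graph.Adj p q
  swap
  · push Not at hcross
    obtain ⟨p, hp, q, hq, hpq⟩ := hcross
    have hpq' : A.graph.Adj p (A.σ (A.σ q)) := by rwa [A.invol]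
    -- From here on q stands for the mirror image of the previous q, so that p and q both lie in the
    -- `K₄` and p is adjacent to σ q.
    generalize A.σ q = q at hq hpq'
    have hne : p ≠ q := by
      rintro rfl
      exact (h.noFixedEdge _ _ hpq').2 rfl
    have h2 : (({v, x, y, z} : Set V) \ {p, q}).ncard = 2 := by
      have := ncard_sdiff_add_ncard_of_subset (s := {p, q}) (t := ({v, x, y, z} : Set V)) (by
        rintro t (rfl | rfl) <;> assumption)
      rw [ncard_pair hne] at this
      omega
    obtain ⟨r, s, hrs, hrs'⟩ := ncard_eq_two.1 h2
    obtain ⟨hr1, hr2⟩ : r ∈ ({v, x, y, z} : Set V) \ {p, q} := by rw [hrs']; simp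
    obtain ⟨hs1, hs2⟩ : s ∈ ({v, x, y, z} : Set V) \ {p, q} := by rw [hrs']; simp
    simp only [mem_insert_iff, mem_singleton_iff, not_or] at hr2 hs2
    exact Or.inl (h.isomorphic_baseF2 (hK p hp q hq hne) (hK p hp r hr1 (Ne.symm hr2.1))
      (hK p hp s hs1 (Ne.symm hs2.1)) (hK q hq r hr1 (Ne.symm hr2.2))
      (hK q hq s hs1 (Ne.symm hs2.2)) (hK r hr1 s hs1 hrs)
      (hself p hp) (hself q hq) (hself r hr1) (hself s hs1) hpq')
  refine (hr (reducible_of_complete h.isTight hnd hK hd hcross fun t ht p hp q hq hpt hqt => ?_)).elim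
  by_contra hpq
  have hvt : ¬ A.graph.Adj v t := fun h' => ht (by right; exact (hn.adj_iff t).1 h')
  have hv0 : v ∈ ({v, x, y, z} : Set V) := by simp
  have hx0 : x ∈ ({v, x, y, z} : Set V) := by simp
  have hy0 : y ∈ ({v, x, y, z} : Set V) := by simp
  have hz0 : z ∈ ({v, x, y, z} : Set V) := by simp
  have key₁ := h.reducible_of_complete_of_adj hn hK4 hK hd hcross hv0 hx0 hy0 hz0 ht
  have key₂ := h.reducible_of_complete_of_adj hn.swap' hK4 hK hd hcross hv0 hx0 hz0 hy0 ht
  have key₃ := h.reducible_of_complete_of_adj hn.rotate hK4 hK hd hcross hv0 hy0 hz0 hx0 ht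
  rcases hp with rfl | rfl | rfl | rfl <;> rcases hq with rfl | rfl | rfl | rfl <;> tauto

/-- The common vertex x cannot be exchanged with y and also be fixed or exchanged with z, so all
three neighbours are fixed. -/
theorem isBase_of_fixedPair_of_fixedPair (h : A.Irreducible) (hr : ¬ A.Reducible)
    (hn : A.HasNeighbors v x y z) (hxy : A.FixedPair x y) (hxz : A.FixedPair x z) : A.IsBase := by
  rcases hxy with h1 | ⟨h1, h2⟩ <;> rcases hxz with h3 | ⟨h3, h4⟩
  · exact (hn.ne₂₃ (h1.symm.trans h3)).elim
  · exact (hn.ne₁₂ (h3.symm.trans h1)).elim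
  · exact (hn.ne₁₃ (h1.symm.trans h3)).elim
  · exact h.isBase_of_fixed hr hn h1 h2 h4

/-- Some degree is below four and hence equal to three; that number being odd, the vertex is not
fixed. -/
theorem exists_hasNeighbors (h : A.Irreducible) : ∃ v x y z, A.HasNeighbors v x y z := by
  obtain ⟨v, hv⟩ := A.exists_ncard_neighborSet_lt_four h.count
  have h3 : (A.graph.neighborSet v).ncard = 3 := by have := h.three_le v; omega
  obtain ⟨x, y, z, hxy, hxz, hyz, hN⟩ := ncard_eq_three.1 h3
  refine ⟨v, x, y, z, fun hf => ?_, fun t => ?_, hxy, hxz, hyz⟩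
  · have := even_ncard_neighborSet h.noFixedEdge hf
    rw [h3] at this
    exact absurd this (by decide)
  · rw [← SimpleGraph.mem_neighborSet, hN]; simp

/-- Cases by the edges among x, y, z. Three or two edges are treated directly. With one edge, the
other two pairs are each fixed or blocked; mixed and doubly blocked combinations are impossible, so
both are fixed. With no edge, at most one of the three pairs is blocked, so two are fixed. -/
theorem isBase (h : A.Irreducible) (hr : ¬ A.Reducible) : A.IsBase := by
  obtain ⟨v, x, y, z, hn⟩ := h.exists_hasNeighbors
  by_cases axy : A.graph.Adj x y <;> by_cases axz : A.graph.Adj x z <;>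
    by_cases ayz : A.graph.Adj y z
  · exact h.isBase_of_complete hr hn axy axz ayz
  · exact h.isBase_of_adj_of_adj hr hn axy axz ayz
  · exact h.isBase_of_adj_of_adj hr hn.swap axy.symm ayz axz
  · rcases (h.pair_cases hr hn.swap').resolve_left axz with ixz | dxz <;>
      rcases (h.pair_cases hr hn.rotate).resolve_left ayz with iyz | dyz
    · exact h.isBase_of_fixedPair_of_fixedPair hr hn.rotate.rotate ixz.symm iyz.symm
    · exact (h.not_adj_and_fixedPair_and_blocked hn.swap' axy ixz dyz.symm).elim
    · exact (h.not_adj_and_fixedPair_and_blocked hn.rotate axy.symm iyz dxz.symm).elim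
    · exact (h.not_blocked_and_blocked hn.rotate.rotate dxz.symm dyz.symm).elim
  · exact h.isBase_of_adj_of_adj hr hn.rotate.rotate axz.symm ayz.symm axy
  · rcases (h.pair_cases hr hn).resolve_left axy with ixy | dxy <;>
      rcases (h.pair_cases hr hn.rotate).resolve_left ayz with iyz | dyz
    · exact h.isBase_of_fixedPair_of_fixedPair hr hn.swap ixy.symm iyz
    · exact (h.not_adj_and_fixedPair_and_blocked hn axz ixy dyz).elim
    · exact (h.not_adj_and_fixedPair_and_blocked hn.rotate.swap axz.symm iyz.symm dxy.symm).elim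
    · exact (h.not_blocked_and_blocked hn.swap dxy.symm dyz).elim
  · rcases (h.pair_cases hr hn).resolve_left axy with ixy | dxy <;>
      rcases (h.pair_cases hr hn.swap').resolve_left axz with ixz | dxz
    · exact h.isBase_of_fixedPair_of_fixedPair hr hn ixy ixz
    · exact (h.not_adj_and_fixedPair_and_blocked hn.swap ayz ixy.symm dxz).elim
    · exact (h.not_adj_and_fixedPair_and_blocked hn.rotate.rotate ayz.symm ixz.symm dxy).elim
    · exact (h.not_blocked_and_blocked hn dxy dxz).elim
  · rcases (h.pair_cases hr hn).resolve_left axy with ixy | dxy <;>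
      rcases (h.pair_cases hr hn.swap').resolve_left axz with ixz | dxz <;>
      rcases (h.pair_cases hr hn.rotate).resolve_left ayz with iyz | dyz
    · exact h.isBase_of_fixedPair_of_fixedPair hr hn ixy ixz
    · exact h.isBase_of_fixedPair_of_fixedPair hr hn ixy ixz
    · exact h.isBase_of_fixedPair_of_fixedPair hr hn.swap ixy.symm iyz
    · exact (h.not_blocked_and_blocked hn.rotate.rotate dxz.symm dyz.symm).elim
    · exact h.isBase_of_fixedPair_of_fixedPair hr hn.rotate.rotate ixz.symm iyz.symm
    · exact (h.not_blocked_and_blocked hn.swap dxy.symm dyz).elim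
    · exact (h.not_blocked_and_blocked hn dxy dxz).elim
    · exact (h.not_blocked_and_blocked hn dxy dxz).elim

end Irreducible

/-- Strong induction on the number of vertices. Reductions are realised on a subset of V, which
keeps the universe, and on a non-trivial one, so that the induction hypothesis applies. -/
theorem IsTight.generated {V : Type u} [Finite V] [Nontrivial V] {A : CsGraph V}
    (hA : A.IsTight) : A.Generated := by
  by_cases hr : A.Reducible
  · obtain ⟨S, A', hA', hS, hS', hm⟩ := hr
    have : Nontrivial S := hS.coe_sort
    have : Nat.card S < Nat.card V := ncard_lt_card hS'
    exact Generated.step A' A hA'.generated hm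
  · exact Generated.base A ((reducible_or_irreducible hA).resolve_left hr |>.isBase hr)
termination_by Nat.card V

end CsGraph

theorem mainTheorem7 {V : Type*} [Finite V] [Nontrivial V] (A : CsGraph V) :
    A.IsTight ↔ A.Generated :=
  ⟨CsGraph.IsTight.generated, CsGraph.Generated.isTight⟩
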